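/- All structures are finite, single-sorted relational structures over a finite relational signature $\sigma$ all of whose symbols have positive arity; the base set of $\mathcal H$ is $H$. **Definitions.** A *2-modular primitive positive formula* (2-mpp-formula) over $\mathcal H$ is $\exists^{\equiv 2}\bar y_1\cdots\exists^{\equiv 2}\bar y_s\,\Phi(\bar x,\bar y_1,\dots,\bar y_s)$, where $\Phi$ is a conjunction of atoms $z_1=z_2$ or $R(z_1,\dots,z_\ell)$, $R\in\sigma$, each $\bar y_i$ is a finite group of variables, and $\exists^{\equiv 2}\bar y\,\psi(\bar x,\bar y)$ is true if the number of assignments to the whole group $\bar y$ that satisfy $\psi(\bar x,\bar y)$ is odd. The *2-modular clone* $\langle\mathcal H\rangle_2$ is the set of all relations on $H$ defined by such formulas. $\mathcal H$ is *2-rigid* if it has no automorphism of order $2$. A relation $R\subseteq H^k$, $k\ge 2$, is *rectangular* if for every $I\subsetneq[k]$, when $R$ is viewed as a binary relation between $I$-tuples and $([k]\setminus I)$-tuples, $(\mathbf a,\mathbf c),(\mathbf a,\mathbf d),(\mathbf b,\mathbf c)\in R$ implies $(\mathbf b,\mathbf d)\in R$; $\mathcal H$ is *strongly 2-rectangular*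 if every relation of arity at least $2$ in $\langle\mathcal H\rangle_2$ is rectangular. $\langle\mathcal H\rangle_2$ *has a Mal'tsev polymorphism* if there is one operation $f:H^3\to H$ with $f(a,a,b)=f(b,a,a)=b$ for all $a,b\in H$ that, applied componentwise, preserves every relation in $\langle\mathcal H\rangle_2$. An instance of $\#_2\mathsf{CSP}(\mathcal H)$ consists of $n$ variables and a list of $m$ constraints, each a symbol $R\in\sigma$ with a scope of variables of length equal to the arity of $R$; the task is to compute, modulo $2$, the number of maps from the variables to $H$ that satisfy all constraints. (Equivalently: the number, modulo $2$, of homomorphisms to $\mathcal H$ from a $\sigma$-structure with $n$ elements whose relations are given as lists of $m$ tuples in total.) Running time is the number of steps of a word RAM: addition, truncated subtraction, multiplication, comparison, branching and array access cost one step each, and all numbers that occur are bounded by a polynomial in $n+m$. **Theorem.** Suppose that $\mathcal H$ is 2-rigid and strongly 2-rectangular, and that $\langle\mathcal H\rangle_2$ has a Mal'tsev polymorphism. Then $\#_2\mathsf{CSP}(\mathcal H)$ is solvable in time $O(n^5+nm)$, where the algorithm and the constant depend only on $\mathcal H$ (and the numbering of its signature). That is, there are a program $P$ and a constant $C$ such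 that on every instance with $n$ variables and $m$ constraints, $P$ halts with the parity of the number of solutions after at most $C(1+n^5+nm)$ steps, with all numbers bounded by $C(1+n+m)^C$. In particular, the time is $O(n^5)$ on instances with $m=O(n^4)$ constraints. -/

import Mathlib

open FirstOrder

/-! ### Modular primitive positive formulas and the modular clone

A (single-sorted) relational structure is a `FirstOrder.Language.Structure` over a relational
language. An `n`-ary relation on `H` is a `Set (Fin n → H)`. -/

/-- An atomic formula in the variables `x₀, …, x_{k-1}`: an equality of two variables, or a
relation symbol applied to a tuple of variables. -/
inductive PPAtom (L : Language) (k : ℕ) where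
  | eq (i j : Fin k) : PPAtom L k
  | rel {l : ℕ} (R : L.Relations l) (v : Fin l → Fin k) : PPAtom L k

/-- Truth of an atomic formula under an assignment of its variables. -/
def PPAtom.Holds {L : Language} {H : Type*} [L.Structure H] {k : ℕ} (a : Fin k → H) :
    PPAtom L k → Prop
  | .eq i j => a i = a j
  | .rel R v => Language.Structure.RelMap R (fun i => a (v i))

/-- A modular primitive positive formula with free variables `x₀, …, x_{k-1}`: a prefix of
modular quantifiers, each binding a whole group of `l` variables at once, followed by a
conjunction of atomic formulas. -/
inductive MPPFormula (L : Language) : ℕ → Type _ where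
  | conj {k : ℕ} (Φ : List (PPAtom L k)) : MPPFormula L k
  | quant {k : ℕ} (l : ℕ) (φ : MPPFormula L (k + l)) : MPPFormula L k

/-- The relation defined by a formula when the quantifiers are read modulo `p`: a group of
variables `y` satisfies `∃^{≡p} y, φ (x, y)` when the number of `y` with `φ (x, y)` is not
divisible by `p`. -/
def MPPFormula.eval {L : Language} (H : Type*) [L.Structure H] (p : ℕ) :
    {k : ℕ} → MPPFormula L k → Set (Fin k → H)
  | _, .conj Φ => {a | ∀ A ∈ Φ, A.Holds a}
  | k, .quant l φ =>
      {a : Fin k → H | ¬ p ∣ Nat.card {b : Fin l → H // Fin.append a b ∈ φ.eval H p}}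

/-- The `k`-ary part of the `p`-modular clone of the structure `H`: all `k`-ary relations that
are definable by a `p`-modular primitive positive formula. -/
def modularClone (L : Language) (H : Type*) [L.Structure H] (p k : ℕ) : Set (Set (Fin k → H)) :=
  {R | ∃ φ : MPPFormula L k, φ.eval H p = R}

/-! ### Rigidity, rectangularity and Mal'tsev polymorphisms -/

/-- A structure is `p`-rigid if it has no automorphism of order `p`. -/
def IsRigidMod (L : Language) (H : Type*) [L.Structure H] (p : ℕ) : Prop :=
  ∀ π : H ≃[L] H, orderOf (π.toEquiv : Equiv.Perm H) ≠ p

/-- An `n`-ary relation is rectangular if for every proper subset `I` of the coordinates it is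
rectangular as a binary relation between `I`-tuples and tuples over the complement of `I`.
`I.piecewise a c` is the tuple that agrees with `a` on `I` and with `c` off `I`. -/
def IsRectangular {H : Type*} {n : ℕ} (R : Set (Fin n → H)) : Prop :=
  ∀ I : Finset (Fin n), I ≠ Finset.univ → ∀ a b c d : Fin n → H,
    I.piecewise a c ∈ R → I.piecewise a d ∈ R → I.piecewise b c ∈ R → I.piecewise b d ∈ R

/-- A structure is strongly `p`-rectangular if every relation of arity at least two in its
`p`-modular clone is rectangular. -/
def IsStronglyRectangularMod (L : Language) (H : Type*) [L.Structure H] (p : ℕ) : Prop :=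
  ∀ n : ℕ, 2 ≤ n → ∀ R ∈ modularClone L H p n, IsRectangular R

/-- A Mal'tsev operation. -/
def IsMaltsev {H : Type*} (f : H → H → H → H) : Prop :=
  ∀ a b : H, f a a b = b ∧ f b a a = b

/-- A ternary polymorphism of a relation (the operation is applied componentwise). -/
def IsPolymorphism₃ {H : Type*} {n : ℕ} (f : H → H → H → H) (R : Set (Fin n → H)) : Prop :=
  ∀ u ∈ R, ∀ v ∈ R, ∀ w ∈ R, (fun i => f (u i) (v i) (w i)) ∈ R

/-- One Mal'tsev operation is a polymorphism of all relations in the `p`-modular clone. -/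
def ModularCloneHasMaltsev (L : Language) (H : Type*) [L.Structure H] (p : ℕ) : Prop :=
  ∃ f : H → H → H → H, IsMaltsev f ∧
    ∀ (n : ℕ), ∀ R ∈ modularClone L H p n, IsPolymorphism₃ f R

/-! ### Instances of the constraint satisfaction problem -/

/-- A constraint over `n` variables: a relation symbol and a scope of matching length. -/
structure Constraint (L : Language) (n : ℕ) where
  arity : ℕ
  symbol : L.Relations arity
  scope : Fin arity → Fin n

/-- An instance over a structure in the language `L`: variables `0, …, n - 1` and a list of
constraints. -/
structure CSPInstance (L : Language) where
  numVars : ℕ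
  constraints : List (Constraint L numVars)

/-- The number of constraints of an instance. -/
def CSPInstance.numConstraints {L : Language} (I : CSPInstance L) : ℕ := I.constraints.length

/-- The number of solutions of an instance in the structure `H`. -/
noncomputable def CSPInstance.numSolutions {L : Language} (I : CSPInstance L) (H : Type*)
    [L.Structure H] : ℕ :=
  Nat.card {φ : Fin I.numVars → H //
    ∀ c ∈ I.constraints, Language.Structure.RelMap c.symbol (fun i => φ (c.scope i))}

/-- A constraint written as a list of numbers: the number of its symbol, then its scope. -/
def Constraint.encode {L : Language} {n r : ℕ} (e : (Σ l, L.Relations l) ≃ Fin r)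
    (c : Constraint L n) : List ℕ :=
  (e ⟨c.arity, c.symbol⟩ : ℕ) :: List.ofFn fun i => (c.scope i : ℕ)

/-- An instance written as a list of numbers: the number of variables, the number of
constraints, then the constraints one after the other. -/
def CSPInstance.encode {L : Language} {r : ℕ} (e : (Σ l, L.Relations l) ≃ Fin r)
    (I : CSPInstance L) : List ℕ :=
  I.numVars :: I.numConstraints :: I.constraints.flatMap (Constraint.encode e)

/-! ### Random access machines

Structured programs of a random access machine. A program uses finitely many registers and
finitely many one-dimensional arrays, all of whose cells hold natural numbers. Every node of an
expression and every executed statement costs one step. No number above the word bound `B` may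
ever occur, not even as an intermediate value; with `B` polynomial in the size of the input this
is the word RAM with words of logarithmically many bits. -/

namespace RAM

/-- Contents of the registers and of the arrays. -/
structure State where
  reg : ℕ → ℕ
  arr : ℕ → ℕ → ℕ

/-- Expressions: constants, registers, array cells, sum, truncated difference, product, and the
comparison `e < e'` with value `0` or `1`. -/
inductive Expr where
  | lit (c : ℕ) : Expr
  | reg (x : ℕ) : Expr
  | get (a : ℕ) (i : Expr) : Expr
  | add (e e' : Expr) : Expr
  | sub (e e' : Expr) : Expr
  | mul (e e' : Expr) : Expr
  | lt (e e' : Expr) : Expr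

/-- Value of an expression. -/
def Expr.eval (s : State) : Expr → ℕ
  | .lit c => c
  | .reg x => s.reg x
  | .get a i => s.arr a (i.eval s)
  | .add e e' => e.eval s + e'.eval s
  | .sub e e' => e.eval s - e'.eval s
  | .mul e e' => e.eval s * e'.eval s
  | .lt e e' => if e.eval s < e'.eval s then 1 else 0

/-- Number of steps for the evaluation of an expression. -/
def Expr.cost : Expr → ℕ
  | .lit _ => 1
  | .reg _ => 1
  | .get _ i => i.cost + 1
  | .add e e' => e.cost + e'.cost + 1
  | .sub e e' => e.cost + e'.cost + 1
  | .mul e e' => e.cost + e'.cost + 1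
  | .lt e e' => e.cost + e'.cost + 1

/-- All values that occur in the evaluation of an expression are at most `B`. -/
def Expr.Fits (B : ℕ) (s : State) : Expr → Prop
  | .lit c => c ≤ B
  | .reg x => s.reg x ≤ B
  | .get a i => i.Fits B s ∧ s.arr a (i.eval s) ≤ B
  | .add e e' => e.Fits B s ∧ e'.Fits B s ∧ e.eval s + e'.eval s ≤ B
  | .sub e e' => e.Fits B s ∧ e'.Fits B s
  | .mul e e' => e.Fits B s ∧ e'.Fits B s ∧ e.eval s * e'.eval s ≤ B
  | .lt e e' => e.Fits B s ∧ e'.Fits B s ∧ 1 ≤ B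

/-- Programs: assignment to a register, assignment to the cell with index `i` of array `a`,
composition, branching on whether `e` is nonzero, and repetition while `e` is nonzero. -/
inductive Prog where
  | skip : Prog
  | assign (x : ℕ) (e : Expr) : Prog
  | put (a : ℕ) (i e : Expr) : Prog
  | seq (P Q : Prog) : Prog
  | ite (e : Expr) (P Q : Prog) : Prog
  | loop (e : Expr) (P : Prog) : Prog

/-- `Exec B P s t s'`: with word bound `B`, the program `P` started in the state `s` halts after
exactly `t` steps in the state `s'`. -/
inductive Exec (B : ℕ) : Prog → State → ℕ → State → Prop where
  | skip (s : State) : Exec B .skip s 1 s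
  | assign (x : ℕ) (e : Expr) (s : State) (he : e.Fits B s) :
      Exec B (.assign x e) s (e.cost + 1) { s with reg := Function.update s.reg x (e.eval s) }
  | put (a : ℕ) (i e : Expr) (s : State) (hi : i.Fits B s) (he : e.Fits B s) :
      Exec B (.put a i e) s (i.cost + e.cost + 1)
        { s with
          arr := Function.update s.arr a (Function.update (s.arr a) (i.eval s) (e.eval s)) }
  | seq {P Q : Prog} {s s₁ s₂ : State} {t₁ t₂ : ℕ} (hP : Exec B P s t₁ s₁)
      (hQ : Exec B Q s₁ t₂ s₂) : Exec B (.seq P Q) s (t₁ + t₂) s₂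
  | ite_true {e : Expr} {P Q : Prog} {s s' : State} {t : ℕ} (he : e.Fits B s)
      (h : e.eval s ≠ 0) (hP : Exec B P s t s') : Exec B (.ite e P Q) s (e.cost + 1 + t) s'
  | ite_false {e : Expr} {P Q : Prog} {s s' : State} {t : ℕ} (he : e.Fits B s)
      (h : e.eval s = 0) (hQ : Exec B Q s t s') : Exec B (.ite e P Q) s (e.cost + 1 + t) s'
  | loop_done {e : Expr} {P : Prog} {s : State} (he : e.Fits B s) (h : e.eval s = 0) :
      Exec B (.loop e P) s (e.cost + 1) s
  | loop_step {e : Expr} {P : Prog} {s s₁ s₂ : State} {t₁ t₂ : ℕ} (he : e.Fits B s)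
      (h : e.eval s ≠ 0) (hP : Exec B P s t₁ s₁) (hL : Exec B (.loop e P) s₁ t₂ s₂) :
      Exec B (.loop e P) s (e.cost + 1 + t₁ + t₂) s₂

/-- The initial state on an input: array `0` holds the input from its cell `0` on, and
everything else is `0`. -/
def State.init (input : List ℕ) : State where
  reg := fun _ => 0
  arr := fun a i => if a = 0 then input.getD i 0 else 0

end RAM

/-!
Let `f` be a Mal'tsev operation that preserves all relations in the clone. The algorithm keeps a
small representation of the set `S` of solutions of the constraints treated so far.

*Representation.* The signature of `S` at position `i` is the set of pairs `(a, b)` such that two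
tuples of `S` agree before `i` and have the values `a` and `b` at `i`. `Represents` stores the
signature and one witness in `S` for each of its at most `q ^ 2 * n` elements, where `q` is the
size of the structure. For tuples `t`, `u`, `v` such that `u` and `v` agree before `i`, the tuple
`f t u v` agrees with `t` before `i`; so the signature is rectangular (`IsRel.exists_of_sig`) and
the witnesses generate `S` under `f` (`Represents.generates`). Consequently, a constraint holds on
all of `S` if it holds for the witnesses (`run_check`, time `O(n)`), and the projection of `S` to
boundedly many positions is obtained from the witnesses by closing a set of bounded size under `f`
(`run_closure`, time `O(n)`).

*Adding a constraint.* The value at the first free position can be fixed by a combination of old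
witnesses with one tuple (`Represents.fix`, time `O(n ^ 2)`). For every position `i` and every
`a`, one looks for a tuple `u` of `S` that satisfies the constraint and has the value `a` at `i`,
fixes the values of `u` at the positions before `i`, and reads off which values at `i` are
compatible with the constraint (`run_update`, time `O(n ^ 4)`). By rectangularity, a single `u` is
enough. If some witness violates the constraint, then the signature gets strictly smaller
(`IsRel.sigCard_lt`), so there are at most `q ^ 2 * n` such updates. All other constraints only
cost `O(n)`. This gives `O(n ^ 5 + n * m)`; see `exec_step` for the amortized count.

*Counting modulo two.* Let `P n` be the set of all solutions and `P j` the relation `∃^{≡2} x_j` of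
`P (j + 1)`. All `P j` lie in the modular clone, hence are closed under `f`, and the parity of the
number of solutions is the truth value of `P 0`. No tuple of `P j` needs to be handled as such:
among the tuples of a set `T` that projects onto `P (j + 1)`, those with beginnings in `P j` are cut
out by a unary constraint on the variable `x_j`, because by rectangularity the number of values
that extend a beginning of length `j` is a number of elements in the signature of `T` at `j`
(`oddAt_iff`, `eliminated_spec`). So the elimination of all variables consists of `n` further
updates, and the answer is whether the last relation is nonempty (`eliminated_lift`, `run_finish`).

*The machine.* `Code` is a language of programs whose loops have `c + d * n` rounds. Such a program
is a function on states, its time is bounded by a polynomial whose degree is the nesting depth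
of the loops with `d ≠ 0`, and it only stores tame values, so that all values stay polynomial
(`Code.exec`). Only the loop over the constraints is treated by hand.
-/

namespace RAM

/-! ### Structured programs with counting loops -/

/-- The state with register `x` set to `v`. -/
def State.setReg (s : State) (x v : ℕ) : State := { s with reg := Function.update s.reg x v }

/-- The state with cell `i` of array `a` set to `v`. -/
def State.setCell (s : State) (a i v : ℕ) : State :=
  { s with arr := Function.update s.arr a (Function.update (s.arr a) i v) }

@[simp] theorem State.setReg_arr (s : State) (x v : ℕ) : (s.setReg x v).arr = s.arr := rfl

@[simp] theorem State.setCell_reg (s : State) (a i v : ℕ) : (s.setCell a i v).reg = s.reg := rfl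

@[simp] theorem State.setReg_reg (s : State) (x v y : ℕ) :
    (s.setReg x v).reg y = if y = x then v else s.reg y := by
  simp [State.setReg, Function.update_apply]

theorem State.setCell_arr (s : State) (a i v b j : ℕ) :
    (s.setCell a i v).arr b j = if b = a ∧ j = i then v else s.arr b j := by
  by_cases h : b = a
  · subst h; simp [State.setCell, Function.update_apply]
  · simp [State.setCell, h]

theorem State.setCell_arr_ne (s : State) {a i v b : ℕ} (h : b ≠ a) :
    (s.setCell a i v).arr b = s.arr b := by
  simp [State.setCell, h]

/-- All registers and all cells hold numbers up to `D`. -/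
def State.AllLe (D : ℕ) (s : State) : Prop := (∀ x, s.reg x ≤ D) ∧ ∀ a i, s.arr a i ≤ D

theorem State.AllLe.setReg {D : ℕ} {s : State} (h : s.AllLe D) {x v : ℕ} (hv : v ≤ D) :
    (s.setReg x v).AllLe D := by
  refine ⟨fun y => ?_, h.2⟩
  rw [State.setReg_reg]
  split_ifs
  exacts [hv, h.1 y]

theorem State.AllLe.setCell {D : ℕ} {s : State} (h : s.AllLe D) {a i v : ℕ} (hv : v ≤ D) :
    (s.setCell a i v).AllLe D := by
  refine ⟨h.1, fun b j => ?_⟩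
  rw [State.setCell_arr]
  split_ifs
  exacts [hv, h.2 b j]

/-- The sum of the constants that occur in an expression. -/
def Expr.lits : Expr → ℕ
  | .lit c => c
  | .reg _ => 0
  | .get _ i => i.lits
  | .add e e' => e.lits + e'.lits
  | .sub e e' => e.lits + e'.lits
  | .mul e e' => e.lits + e'.lits
  | .lt e e' => e.lits + e'.lits

/-- A bound for all values that occur in the evaluation of an expression in a state all of whose
cells hold numbers up to `D`. -/
def Expr.size (D : ℕ) : Expr → ℕ
  | .lit c => c
  | .reg _ => D
  | .get _ i => i.size D + D
  | .add e e' => e.size D + e'.size D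
  | .sub e e' => e.size D + e'.size D
  | .mul e e' => e.size D * e'.size D + e.size D + e'.size D
  | .lt e e' => e.size D + e'.size D + 1

/-- An expression whose value cannot exceed the numbers in the state and `1`. -/
def Expr.Tame : Expr → Bool
  | .lit _ => true
  | .reg _ => true
  | .get _ _ => true
  | .sub e _ => e.Tame
  | .lt _ _ => true
  | .add _ _ => false
  | .mul _ _ => false

theorem Expr.eval_le_size {D : ℕ} {s : State} (hs : s.AllLe D) (e : Expr) :
    e.eval s ≤ e.size D := by
  induction e with
  | lit c => exact le_rfl
  | reg x => exact hs.1 x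
  | get a i ih => exact (hs.2 _ _).trans (Nat.le_add_left _ _)
  | add e e' h h' => exact Nat.add_le_add h h'
  | sub e e' h h' => exact (Nat.sub_le _ _).trans (h.trans (Nat.le_add_right _ _))
  | mul e e' h h' =>
    exact (Nat.mul_le_mul h h').trans (by simp only [Expr.size]; omega)
  | lt e e' h h' => simp only [Expr.eval, Expr.size]; split_ifs <;> omega

theorem Expr.fits {D B : ℕ} {s : State} (hs : s.AllLe D) (e : Expr) (hB : e.size D ≤ B) :
    e.Fits B s := by
  induction e with
  | lit c => exact hB
  | reg x => exact (hs.1 x).trans hB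
  | get a i ih =>
    simp only [Expr.size] at hB
    exact ⟨ih (by omega), (hs.2 _ _).trans (by omega)⟩
  | add e e' h h' =>
    simp only [Expr.size] at hB
    exact ⟨h (by omega), h' (by omega), (Expr.eval_le_size hs (.add e e')).trans hB⟩
  | sub e e' h h' =>
    simp only [Expr.size] at hB
    exact ⟨h (by omega), h' (by omega)⟩
  | mul e e' h h' =>
    refine ⟨h (le_trans ?_ hB), h' (le_trans ?_ hB), (Expr.eval_le_size hs (.mul e e')).trans hB⟩
    all_goals simp only [Expr.size]; omega
  | lt e e' h h' =>
    simp only [Expr.size] at hB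
    exact ⟨h (by omega), h' (by omega), by omega⟩

theorem Expr.Tame.eval_le {D : ℕ} {s : State} (hs : s.AllLe D) (hD : 1 ≤ D) {e : Expr}
    (he : e.Tame = true) (hl : e.lits ≤ D) : e.eval s ≤ D := by
  induction e with
  | lit c => exact hl
  | reg x => exact hs.1 x
  | get a i ih => exact hs.2 _ _
  | add e e' h h' => simp [Expr.Tame] at he
  | sub e e' h h' =>
    simp only [Expr.lits] at hl
    exact (Nat.sub_le _ _).trans (h he (by omega))
  | mul e e' h h' => simp [Expr.Tame] at he
  | lt e e' h h' => simp only [Expr.eval]; split_ifs <;> omega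

/-- Programs in which every loop counts up to `c + d * n`, where `n` is the content of
register `1`. For such programs, the final state is a function of the initial state, and running
time and word size have static bounds. -/
inductive Code where
  | skip : Code
  | set (x : ℕ) (e : Expr) : Code
  | put (a : ℕ) (i e : Expr) : Code
  | seq (P Q : Code) : Code
  | ite (e : Expr) (P Q : Code) : Code
  | iter (x c d : ℕ) (P : Code) : Code

namespace Code

/-- The number of rounds `c + d * n` of a loop as an expression. -/
def boundExpr (c d : ℕ) : Expr := .add (.lit c) (.mul (.lit d) (.reg 1))

/-- Translation to a RAM program. -/
def prog : Code → Prog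
  | skip => .skip
  | set x e => .assign x e
  | put a i e => .put a i e
  | seq P Q => .seq P.prog Q.prog
  | ite e P Q => .ite e P.prog Q.prog
  | iter x c d P => .seq (.assign x (.lit 0)) (.loop (.lt (.reg x) (boundExpr c d))
      (.seq P.prog (.assign x (.add (.reg x) (.lit 1)))))

/-- The final state. -/
def run : Code → State → State
  | skip, s => s
  | set x e, s => s.setReg x (e.eval s)
  | put a i e, s => s.setCell a (i.eval s) (e.eval s)
  | seq P Q, s => Q.run (P.run s)
  | ite e P Q, s => if e.eval s = 0 then Q.run s else P.run s
  | iter x c d P, s =>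
      (fun u => (P.run u).setReg x ((P.run u).reg x + 1))^[c + d * s.reg 1] (s.setReg x 0)

/-- Whether register `y` may be written. -/
def writesReg (y : ℕ) : Code → Bool
  | skip => false
  | set x _ => y == x
  | put _ _ _ => false
  | seq P Q => P.writesReg y || Q.writesReg y
  | ite _ P Q => P.writesReg y || Q.writesReg y
  | iter x _ _ P => y == x || P.writesReg y

/-- Whether array `b` may be written. -/
def writesArr (b : ℕ) : Code → Bool
  | skip => false
  | set _ _ => false
  | put a _ _ => b == a
  | seq P Q => P.writesArr b || Q.writesArr b
  | ite _ P Q => P.writesArr b || Q.writesArr b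
  | iter _ _ _ P => P.writesArr b

/-- Only values of tame expressions are stored, register `1` is never written, and the counter of
a loop is not written in its body. -/
def WF : Code → Bool
  | skip => true
  | set x e => e.Tame && !(1 == x)
  | put _ _ e => e.Tame
  | seq P Q => P.WF && Q.WF
  | ite _ P Q => P.WF && Q.WF
  | iter x _ _ P => P.WF && !(P.writesReg x) && !(1 == x)

/-- A bound for the number of steps when register `1` holds `n`. -/
def cost (n : ℕ) : Code → ℕ
  | skip => 1
  | set _ e => e.cost + 1
  | put _ i e => i.cost + e.cost + 1
  | seq P Q => P.cost n + Q.cost n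
  | ite e P Q => e.cost + 1 + (P.cost n + Q.cost n)
  | iter _ c d P => 10 + (c + d * n) * (P.cost n + 12)

/-- The sum of the constants that occur in a program. -/
def lits : Code → ℕ
  | skip => 0
  | set _ e => e.lits
  | put _ i e => i.lits + e.lits
  | seq P Q => P.lits + Q.lits
  | ite e P Q => e.lits + (P.lits + Q.lits)
  | iter _ c d P => c + d + P.lits

/-- A bound for all values that occur in a run in which registers and cells hold numbers up
to `D`. -/
def size (D : ℕ) : Code → ℕ
  | skip => 0
  | set _ e => e.size D
  | put _ i e => i.size D + e.size D
  | seq P Q => P.size D + Q.size D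
  | ite e P Q => e.size D + (P.size D + Q.size D)
  | iter x c d P => (Expr.lt (.reg x) (boundExpr c d)).size D + (D + 1) + P.size D

/-- The nesting depth of the loops whose number of rounds depends on `n`. -/
def depth : Code → ℕ
  | skip => 0
  | set _ _ => 0
  | put _ _ _ => 0
  | seq P Q => max P.depth Q.depth
  | ite _ P Q => max P.depth Q.depth
  | iter _ _ d P => (match d with | 0 => 0 | _ + 1 => 1) + P.depth

theorem run_reg {P : Code} {y : ℕ} (h : P.writesReg y = false) (s : State) :
    (P.run s).reg y = s.reg y := by
  induction P generalizing s with
  | skip => rfl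
  | set x e =>
    have : y ≠ x := by simpa [writesReg] using h
    simp [run, this]
  | put a i e => rfl
  | seq P Q hP hQ =>
    simp only [writesReg, Bool.or_eq_false_iff] at h
    simp only [run]
    rw [hQ h.2, hP h.1]
  | ite e P Q hP hQ =>
    simp only [writesReg, Bool.or_eq_false_iff] at h
    simp only [run]
    split_ifs
    exacts [hQ h.2 s, hP h.1 s]
  | iter x c d P hP =>
    simp only [writesReg, Bool.or_eq_false_iff, beq_eq_false_iff_ne] at h
    simp only [run]
    generalize c + d * s.reg 1 = N
    have h0 : (s.setReg x 0).reg y = s.reg y := by simp [h.1]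
    rw [← h0]
    generalize s.setReg x 0 = u
    induction N with
    | zero => rfl
    | succ N ih => rw [Function.iterate_succ_apply', State.setReg_reg, if_neg h.1, hP h.2, ih]

theorem run_arr {P : Code} {b : ℕ} (h : P.writesArr b = false) (s : State) :
    (P.run s).arr b = s.arr b := by
  induction P generalizing s with
  | skip => rfl
  | set x e => rfl
  | put a i e =>
    have : b ≠ a := by simpa [writesArr] using h
    exact State.setCell_arr_ne s this
  | seq P Q hP hQ =>
    simp only [writesArr, Bool.or_eq_false_iff] at h
    simp only [run]
    rw [hQ h.2, hP h.1]
  | ite e P Q hP hQ =>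
    simp only [writesArr, Bool.or_eq_false_iff] at h
    simp only [run]
    split_ifs
    exacts [hQ h.2 s, hP h.1 s]
  | iter x c d P hP =>
    simp only [run]
    generalize c + d * s.reg 1 = N
    rw [← State.setReg_arr s x 0]
    generalize s.setReg x 0 = u
    induction N with
    | zero => rfl
    | succ N ih => rw [Function.iterate_succ_apply', State.setReg_arr, hP h, ih]

theorem WF.writesReg_one {P : Code} (h : P.WF = true) : P.writesReg 1 = false := by
  induction P with
  | skip => rfl
  | set x e => simpa [WF, writesReg] using And.right (by simpa [WF] using h)
  | put a i e => rfl
  | seq P Q hP hQ =>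
    simp only [WF, Bool.and_eq_true] at h
    simp [writesReg, hP h.1, hQ h.2]
  | ite e P Q hP hQ =>
    simp only [WF, Bool.and_eq_true] at h
    simp [writesReg, hP h.1, hQ h.2]
  | iter x c d P hP =>
    simp only [WF, Bool.and_eq_true, Bool.not_eq_true'] at h
    simp [writesReg, hP h.1.1, h.2]

/-- Induction principle for loops whose invariant speaks of the arrays only. In the step, the
registers and arrays that the body does not write are known to be those of the start. -/
theorem iter_inv {x c d n : ℕ} {P : Code} {s : State} (hn : s.reg 1 = n)
    (hx : P.writesReg x = false) (Inv : ℕ → (ℕ → ℕ → ℕ) → Prop) (h0 : Inv 0 s.arr)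
    (step : ∀ k < c + d * n, ∀ u : State, u.reg x = k →
      (∀ y, y ≠ x → P.writesReg y = false → u.reg y = s.reg y) →
      (∀ a, P.writesArr a = false → u.arr a = s.arr a) →
      Inv k u.arr → Inv (k + 1) (P.run u).arr) :
    Inv (c + d * n) ((iter x c d P).run s).arr := by
  simp only [run, hn]
  suffices H : ∀ N ≤ c + d * n, ∀ v,
      v = (fun u => (P.run u).setReg x ((P.run u).reg x + 1))^[N] (s.setReg x 0) →
      v.reg x = N ∧ (∀ y, y ≠ x → P.writesReg y = false → v.reg y = s.reg y) ∧
      (∀ a, P.writesArr a = false → v.arr a = s.arr a) ∧ Inv N v.arr from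
    (H _ le_rfl _ rfl).2.2.2
  intro N
  induction N with
  | zero =>
    rintro - v rfl
    exact ⟨by simp, fun y hy _ => by simp [hy], fun a _ => by simp, h0⟩
  | succ N ih =>
    rintro hN v hv
    rw [Function.iterate_succ_apply'] at hv
    obtain ⟨i1, i2, i3, i4⟩ := ih (by omega) _ rfl
    generalize (fun u => (P.run u).setReg x ((P.run u).reg x + 1))^[N] (s.setReg x 0) = w at *
    subst hv
    refine ⟨by simp [run_reg hx, i1], fun y hy hy' => ?_, fun a ha => ?_, ?_⟩
    · rw [State.setReg_reg, if_neg hy, run_reg hy', i2 y hy hy']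
    · rw [State.setReg_arr, run_arr ha, i3 a ha]
    · exact step N (by omega) w i1 i2 i3 i4

/-- The translation of a well-formed program runs in the static time and word bounds. -/
theorem exec {n D B : ℕ} (P : Code) (s : State) (hW : P.WF = true) (h1 : s.reg 1 = n)
    (hD : 1 ≤ D) (hl : P.lits * (n + 1) ≤ D) (hB : P.size D ≤ B) (hs : s.AllLe D) :
    (∃ t ≤ P.cost n, Exec B P.prog s t (P.run s)) ∧ (P.run s).AllLe D := by
  have hlit : P.lits ≤ D := (Nat.le_mul_of_pos_right _ (Nat.succ_pos _)).trans hl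
  induction P generalizing s with
  | skip => exact ⟨⟨1, le_rfl, .skip s⟩, hs⟩
  | set x e =>
    simp only [WF, Bool.and_eq_true] at hW
    exact ⟨⟨_, le_rfl, .assign x e s (e.fits hs hB)⟩, hs.setReg (Expr.Tame.eval_le hs hD hW.1 hlit)⟩
  | put a i e =>
    simp only [lits, size] at hlit hB
    exact ⟨⟨_, le_rfl, .put a i e s (i.fits hs (by omega)) (e.fits hs (by omega))⟩,
      hs.setCell (Expr.Tame.eval_le hs hD hW (by omega))⟩
  | seq P Q hP hQ =>
    simp only [WF, Bool.and_eq_true] at hW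
    simp only [lits, size, add_mul] at hlit hB hl
    obtain ⟨⟨t, ht, hx⟩, ha⟩ := hP s hW.1 h1 (by omega) (by omega) hs (by omega)
    obtain ⟨⟨t', ht', hx'⟩, ha'⟩ := hQ (P.run s) hW.2 (by rw [run_reg (WF.writesReg_one hW.1), h1])
      (by omega) (by omega) ha (by omega)
    exact ⟨⟨t + t', Nat.add_le_add ht ht', .seq hx hx'⟩, ha'⟩
  | ite e P Q hP hQ =>
    simp only [WF, Bool.and_eq_true] at hW
    simp only [lits, size, add_mul] at hlit hB hl
    simp only [run, cost]
    split_ifs with h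
    · obtain ⟨⟨t, ht, hx⟩, ha⟩ := hQ s hW.2 h1 (by omega) (by omega) hs (by omega)
      exact ⟨⟨_, by omega, .ite_false (e.fits hs (by omega)) h hx⟩, ha⟩
    · obtain ⟨⟨t, ht, hx⟩, ha⟩ := hP s hW.1 h1 (by omega) (by omega) hs (by omega)
      exact ⟨⟨_, by omega, .ite_true (e.fits hs (by omega)) h hx⟩, ha⟩
  | iter x c d P hP =>
    simp only [WF, Bool.and_eq_true, Bool.not_eq_true'] at hW
    obtain ⟨⟨hW, hx⟩, hx1⟩ := hW
    have hx1' : (1 : ℕ) ≠ x := by simpa using hx1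
    simp only [lits, add_mul] at hl
    simp only [lits] at hlit
    have hbd : c + d * n ≤ D := by nlinarith
    simp only [size] at hB
    simp only [run, h1, cost, prog]
    set N := c + d * n with hN
    set F := (fun u : State => (P.run u).setReg x ((P.run u).reg x + 1)) with hF
    -- the loop from its `k`-th round on
    have key : ∀ j k, k + j = N → ∀ u : State, u.AllLe D → u.reg 1 = n → u.reg x = k →
        (∃ t ≤ 8 + j * (P.cost n + 12), Exec B (.loop (.lt (.reg x) (boundExpr c d))
          (.seq P.prog (.assign x (.add (.reg x) (.lit 1))))) u t (F^[j] u)) ∧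
          (F^[j] u).AllLe D := by
      intro j
      induction j with
      | zero =>
        intro k hk u hu hu1 hux
        refine ⟨⟨8, by omega, Exec.loop_done (Expr.fits hu _ (by omega)) ?_⟩, hu⟩
        simp only [Expr.eval, boundExpr, hux, hu1]
        rw [if_neg (by omega)]
      | succ j ih =>
        intro k hk u hu hu1 hux
        obtain ⟨⟨t, ht, he⟩, hv⟩ := hP u hW hu1 (by omega) (by omega) hu (by omega)
        have hvx : (P.run u).reg x = k := by rw [run_reg hx, hux]
        have hFu : F u = (P.run u).setReg x (k + 1) := by simp only [hF, hvx]
        obtain ⟨⟨t', ht', he'⟩, hv'⟩ := ih (k + 1) (by omega) (F u)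
          (by rw [hFu]; exact hv.setReg (by omega))
          (by rw [hFu, State.setReg_reg, if_neg hx1', run_reg (WF.writesReg_one hW), hu1])
          (by rw [hFu]; simp)
        rw [Function.iterate_succ_apply]
        refine ⟨⟨_, ?_, Exec.loop_step (Expr.fits hu _ (by omega)) ?_
          (.seq he (.assign x (.add (.reg x) (.lit 1)) (P.run u)
            (Expr.fits hv _ (by simp only [Expr.size] at hB ⊢; omega)))) he'⟩, hv'⟩
        · simp only [Expr.cost, boundExpr]
          have : (j + 1) * (P.cost n + 12) = j * (P.cost n + 12) + (P.cost n + 12) := by ring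
          omega
        · simp only [Expr.eval, boundExpr, hux, hu1]
          rw [if_pos (by omega)]
          exact one_ne_zero
    obtain ⟨⟨t, ht, he⟩, hv⟩ := key N 0 (by omega) (s.setReg x 0) (hs.setReg (Nat.zero_le _))
      (by rw [State.setReg_reg, if_neg hx1', h1]) (by simp)
    exact ⟨⟨_, by simp only [Expr.cost]; omega,
      .seq (.assign x (.lit 0) s (Nat.zero_le _)) he⟩, hv⟩

/-- The time is polynomial in `n`, of degree the nesting depth of the loops that depend on `n`. -/
theorem exists_cost_le (P : Code) : ∃ C, ∀ n, P.cost n ≤ C * (n + 1) ^ P.depth := by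
  have mono : ∀ {C m k n : ℕ}, m ≤ k → C * (n + 1) ^ m ≤ C * (n + 1) ^ k := fun h =>
    Nat.mul_le_mul_left _ (Nat.pow_le_pow_right (Nat.succ_pos _) h)
  induction P with
  | skip => exact ⟨1, fun n => by simp [cost, depth]⟩
  | set x e => exact ⟨e.cost + 1, fun n => by simp [cost, depth]⟩
  | put a i e => exact ⟨i.cost + e.cost + 1, fun n => by simp [cost, depth]⟩
  | seq P Q hP hQ =>
    obtain ⟨C, hC⟩ := hP
    obtain ⟨C', hC'⟩ := hQ
    refine ⟨C + C', fun n => ?_⟩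
    rw [add_mul]
    exact Nat.add_le_add ((hC n).trans (mono (le_max_left _ _)))
      ((hC' n).trans (mono (le_max_right _ _)))
  | ite e P Q hP hQ =>
    obtain ⟨C, hC⟩ := hP
    obtain ⟨C', hC'⟩ := hQ
    refine ⟨e.cost + 1 + (C + C'), fun n => ?_⟩
    rw [add_mul, add_mul C]
    exact Nat.add_le_add (Nat.le_mul_of_pos_right _ (by positivity))
      (Nat.add_le_add ((hC n).trans (mono (le_max_left _ _)))
        ((hC' n).trans (mono (le_max_right _ _))))
  | iter x c d P hP =>
    obtain ⟨C, hC⟩ := hP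
    refine ⟨10 + (c + d) * (C + 12), fun n => ?_⟩
    have h1 : c + d * n ≤ (c + d) * (n + 1) ^ (match d with | 0 => 0 | _ + 1 => 1) := by
      cases d with
      | zero => simp
      | succ d => simp only [pow_one]; nlinarith
    have h2 : P.cost n + 12 ≤ (C + 12) * (n + 1) ^ P.depth := by
      rw [add_mul]
      exact Nat.add_le_add (hC n) (Nat.le_mul_of_pos_right _ (by positivity))
    calc cost n (iter x c d P) = 10 + (c + d * n) * (P.cost n + 12) := rfl
      _ ≤ 10 * (n + 1) ^ (iter x c d P).depth + (c + d) * (C + 12) *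
          (n + 1) ^ (iter x c d P).depth := by
        refine Nat.add_le_add (Nat.le_mul_of_pos_right _ (by positivity)) ?_
        refine (Nat.mul_le_mul h1 h2).trans (le_of_eq ?_)
        simp only [depth]
        rw [pow_add]; ring
      _ = _ := by ring

end Code

/-- Growth at most polynomial, with one constant for the factor and the exponent. -/
def PolyBounded (g : ℕ → ℕ) : Prop := ∃ C, ∀ M, 1 ≤ M → g M ≤ C * M ^ C

theorem PolyBounded.const (c : ℕ) : PolyBounded fun _ => c :=
  ⟨c, fun _ hM => Nat.le_mul_of_pos_right _ (Nat.pow_pos hM)⟩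

theorem PolyBounded.linear (c : ℕ) : PolyBounded fun M => c * M :=
  ⟨c + 1, fun M hM => Nat.mul_le_mul (Nat.le_succ c)
    ((pow_one M).symm.le.trans (Nat.pow_le_pow_right hM (Nat.le_add_left _ _)))⟩

theorem PolyBounded.add {g h : ℕ → ℕ} (hg : PolyBounded g) (hh : PolyBounded h) :
    PolyBounded fun M => g M + h M := by
  obtain ⟨C, hC⟩ := hg
  obtain ⟨C', hC'⟩ := hh
  refine ⟨C + C', fun M hM => ?_⟩
  rw [add_mul]
  exact Nat.add_le_add
    ((hC M hM).trans (Nat.mul_le_mul_left _ (Nat.pow_le_pow_right hM (Nat.le_add_right _ _))))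
    ((hC' M hM).trans (Nat.mul_le_mul_left _ (Nat.pow_le_pow_right hM (Nat.le_add_left _ _))))

theorem PolyBounded.mul {g h : ℕ → ℕ} (hg : PolyBounded g) (hh : PolyBounded h) :
    PolyBounded fun M => g M * h M := by
  obtain ⟨C, hC⟩ := hg
  obtain ⟨C', hC'⟩ := hh
  refine ⟨C * C' + C + C', fun M hM => ?_⟩
  calc g M * h M ≤ (C * M ^ C) * (C' * M ^ C') := Nat.mul_le_mul (hC M hM) (hC' M hM)
    _ = (C * C') * M ^ (C + C') := by ring
    _ ≤ _ := Nat.mul_le_mul (by omega) (Nat.pow_le_pow_right hM (by omega))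

theorem Expr.polyBounded_size (K : ℕ) (e : Expr) : PolyBounded fun M => e.size (K * M) := by
  induction e with
  | lit c => exact .const c
  | reg x => exact .linear K
  | get a i ih => exact ih.add (.linear K)
  | add e e' h h' => exact h.add h'
  | sub e e' h h' => exact h.add h'
  | mul e e' h h' => exact ((h.mul h').add h).add h'
  | lt e e' h h' => exact (h.add h').add (.const 1)

theorem Code.polyBounded_size (K : ℕ) (P : Code) : PolyBounded fun M => P.size (K * M) := by
  induction P with
  | skip => exact .const 0
  | set x e => exact e.polyBounded_size K
  | put a i e => exact (i.polyBounded_size K).add (e.polyBounded_size K)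
  | seq P Q h h' => exact h.add h'
  | ite e P Q h h' => exact (e.polyBounded_size K).add (h.add h')
  | iter x c d P h =>
    exact ((Expr.polyBounded_size K _).add ((PolyBounded.linear K).add (.const 1))).add h

end RAM

/-! ### Relations closed under a Mal'tsev operation -/

namespace Maltsev

/-- A set of `n`-tuples over `{0, …, q - 1}` that is closed under the operation `f`. Tuples are
sequences of which only the first `n` entries matter. -/
structure IsRel (n q : ℕ) (f : ℕ → ℕ → ℕ → ℕ) (S : (ℕ → ℕ) → Prop) : Prop where
  ext : ∀ t t', (∀ k < n, t k = t' k) → S t → S t'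
  lt : ∀ t, S t → ∀ k < n, t k < q
  closed : ∀ x y z, S x → S y → S z → S fun k => f (x k) (y k) (z k)

/-- A Mal'tsev operation on `{0, …, q - 1}`. -/
structure IsOp (q : ℕ) (f : ℕ → ℕ → ℕ → ℕ) : Prop where
  lt : ∀ a b c, a < q → b < q → c < q → f a b c < q
  left : ∀ a b, a < q → b < q → f a a b = b
  right : ∀ a b, a < q → b < q → f b a a = b

/-- The signature of `S` at position `i`: the pairs of values that two tuples in `S` which agree
before `i` may have at `i`. -/
def sig (S : (ℕ → ℕ) → Prop) (i a b : ℕ) : Prop :=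
  ∃ t t', S t ∧ S t' ∧ (∀ k < i, t k = t' k) ∧ t i = a ∧ t' i = b

variable {n q : ℕ} {f : ℕ → ℕ → ℕ → ℕ} {S S' : (ℕ → ℕ) → Prop}

theorem sig.mono (hS : ∀ t, S t → S' t) {i a b : ℕ} (h : sig S i a b) : sig S' i a b := by
  obtain ⟨t, t', h1, h2, h3⟩ := h
  exact ⟨t, t', hS _ h1, hS _ h2, h3⟩

/-- Rectangularity: if `(a, b)` is in the signature at `i`, then every tuple with value `a` at `i`
may be changed to have value `b` there without a change before `i`. -/
theorem IsRel.exists_of_sig (hf : IsOp q f) (hS : IsRel n q f S) {i a b : ℕ} (hi : i < n)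
    (h : sig S i a b) {t : ℕ → ℕ} (ht : S t) (hta : t i = a) :
    ∃ t', S t' ∧ (∀ k < i, t' k = t k) ∧ t' i = b := by
  obtain ⟨u, v, hu, hv, huv, rfl, rfl⟩ := h
  refine ⟨_, hS.closed _ _ _ ht hu hv, fun k hk => ?_, ?_⟩
  · have hk' : k < n := hk.trans hi
    rw [huv k hk]
    exact hf.right _ _ (hS.lt _ hv k hk') (hS.lt _ ht k hk')
  · rw [hta]
    exact hf.left _ _ (hS.lt _ hu i hi) (hS.lt _ hv i hi)

/-- A nonempty closed subset with the same signature is everything. If all tuples agree before `j`,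
it is enough to compare the signatures from `j` on. -/
theorem IsRel.subset_of_sig (hf : IsOp q f) (hS' : IsRel n q f S')
    (hsub : ∀ t, S' t → S t) {j : ℕ} (hfix : ∀ t t', S t → S t' → ∀ k < j, t k = t' k)
    (hne : ∃ t, S' t) (hsig : ∀ i < n, j ≤ i → ∀ a b, sig S i a b → sig S' i a b) :
    ∀ t, S t → S' t := by
  intro t ht
  have key : ∀ i ≤ n, ∃ x, S' x ∧ ∀ k < i, x k = t k := by
    intro i
    induction i with
    | zero => exact fun _ => ⟨_, hne.choose_spec, fun k hk => absurd hk (Nat.not_lt_zero k)⟩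
    | succ i ih =>
      intro hi
      obtain ⟨x, hx, hxt⟩ := ih (by omega)
      by_cases hj : j ≤ i
      · obtain ⟨y, hy, hyx, hyi⟩ := hS'.exists_of_sig hf (by omega)
          (hsig i (by omega) hj _ _ ⟨x, t, hsub _ hx, ht, hxt, rfl, rfl⟩) hx rfl
        refine ⟨y, hy, fun k hk => ?_⟩
        rcases Nat.lt_succ_iff_lt_or_eq.mp hk with hk | rfl
        · rw [hyx k hk, hxt k hk]
        · exact hyi
      · exact ⟨x, hx, fun k hk => hfix _ _ (hsub _ hx) ht k (by omega)⟩
  obtain ⟨x, hx, hxt⟩ := key n le_rfl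
  exact hS'.ext _ _ hxt hx

theorem IsRel.and_eq (hS : IsRel n q f S) {j v : ℕ} (hj : j < n) (hv : v < q)
    (hf : IsOp q f) : IsRel n q f fun t => S t ∧ t j = v where
  ext t t' h ht := ⟨hS.ext _ _ h ht.1, by rw [← h j hj, ht.2]⟩
  lt t ht := hS.lt t ht.1
  closed x y z hx hy hz := ⟨hS.closed _ _ _ hx.1 hy.1 hz.1, by
    simp only [hx.2, hy.2, hz.2]; exact hf.left _ _ hv hv⟩

/-! ### Representations by signature and witnesses -/

/-- Row `r` of a two-dimensional array with rows of length `n`. -/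
def row (n : ℕ) (W : ℕ → ℕ) (r : ℕ) : ℕ → ℕ := fun k => W (r * n + k)

/-- The number of the entry `(i, a, b)` of a table. -/
def idx (q i a b : ℕ) : ℕ := (i * q + a) * q + b

/-- The arrays `G` and `W` represent the relation `S` whose tuples all agree before `j`: from
position `j` on, `G` is the characteristic function of the signature, and for every `(i, a, b)`
in the signature, `W` has a tuple of `S` with value `b` at `i` in row `(i, a, b)`, which agrees
before `i` with the tuple in row `(i, a, a)`. -/
structure Represents (n q j : ℕ) (G W : ℕ → ℕ) (S : (ℕ → ℕ) → Prop) : Prop where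
  fixed : ∀ t t', S t → S t' → ∀ k < j, t k = t' k
  flag : ∀ i < n, ∀ a < q, ∀ b < q, G (idx q i a b) ≠ 0 ↔ j ≤ i ∧ sig S i a b
  mem : ∀ i < n, ∀ a < q, ∀ b < q, G (idx q i a b) ≠ 0 → S (row n W (idx q i a b))
  value : ∀ i < n, ∀ a < q, ∀ b < q, G (idx q i a b) ≠ 0 → row n W (idx q i a b) i = b
  agree : ∀ i < n, ∀ a < q, ∀ b < q, G (idx q i a b) ≠ 0 → ∀ k < i,
    row n W (idx q i a b) k = row n W (idx q i a a) k

variable {j : ℕ} {G W : ℕ → ℕ}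

theorem exists_idx {x : ℕ} (hx : x < q * q * n) :
    ∃ i < n, ∃ a < q, ∃ b < q, x = idx q i a b := by
  have hq : 0 < q := by
    rcases Nat.eq_zero_or_pos q with rfl | h
    · simp at hx
    · exact h
  refine ⟨x / q / q, ?_, x / q % q, Nat.mod_lt _ hq, x % q, Nat.mod_lt _ hq, ?_⟩
  · rw [Nat.div_div_eq_div_mul]
    exact Nat.div_lt_of_lt_mul hx
  · rw [idx, Nat.div_add_mod', Nat.div_add_mod']

theorem idx_lt {i a b : ℕ} (hi : i < n) (ha : a < q) (hb : b < q) : idx q i a b < q * q * n := by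
  have h1 : i * q + a + 1 ≤ n * q := by nlinarith
  have h2 : (i * q + a + 1) * q ≤ n * q * q := Nat.mul_le_mul_right _ h1
  rw [idx]
  nlinarith

theorem idx_inj {i a b i' a' b' : ℕ} (ha : a < q) (hb : b < q) (ha' : a' < q) (hb' : b' < q) :
    idx q i a b = idx q i' a' b' ↔ i = i' ∧ a = a' ∧ b = b' := by
  have aux : ∀ {x y c d : ℕ}, c < q → d < q → x * q + c = y * q + d → x = y ∧ c = d := by
    intro x y c d hc hd h
    have hx := congrArg (· / q) h
    have hm := congrArg (· % q) h
    have hq : 0 < q := by omega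
    simp only [mul_comm _ q, Nat.mul_add_div hq, Nat.div_eq_of_lt hc, Nat.div_eq_of_lt hd,
      Nat.mul_add_mod, Nat.mod_eq_of_lt hc, Nat.mod_eq_of_lt hd, add_zero] at hx hm
    exact ⟨hx, hm⟩
  refine ⟨fun h => ?_, by rintro ⟨rfl, rfl, rfl⟩; rfl⟩
  obtain ⟨h1, rfl⟩ := aux hb hb' h
  obtain ⟨rfl, rfl⟩ := aux ha ha' h1
  exact ⟨rfl, rfl, rfl⟩

theorem IsRel.row_lt (hS : IsRel n q f S) (hR : Represents n q j G W S) {i a b : ℕ} (hi : i < n)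
    (ha : a < q) (hb : b < q) (hG : G (idx q i a b) ≠ 0) {k : ℕ} (hk : k < n) :
    row n W (idx q i a b) k < q :=
  hS.lt _ (hR.mem i hi a ha b hb hG) k hk

theorem Represents.flag_left (hR : Represents n q j G W S) {i a b : ℕ} (hi : i < n)
    (ha : a < q) (hb : b < q) (hG : G (idx q i a b) ≠ 0) : G (idx q i a a) ≠ 0 := by
  obtain ⟨hj, t, t', ht, -, -, hta, -⟩ := (hR.flag i hi a ha b hb).1 hG
  exact (hR.flag i hi a ha a ha).2 ⟨hj, t, t, ht, ht, fun _ _ => rfl, hta, hta⟩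

/-- A represented relation is generated by the witnesses. -/
theorem Represents.generates (hf : IsOp q f) (hS : IsRel n q f S) (hR : Represents n q j G W S)
    (hj : j < n) {X : (ℕ → ℕ) → Prop} (hX : IsRel n q f fun t => S t ∧ X t)
    (hW : ∀ i < n, ∀ a < q, ∀ b < q, G (idx q i a b) ≠ 0 → X (row n W (idx q i a b))) :
    ∀ t, S t → X t := by
  have hmem : ∀ i < n, ∀ a < q, ∀ b < q, G (idx q i a b) ≠ 0 →
      S (row n W (idx q i a b)) ∧ X (row n W (idx q i a b)) := fun i hi a ha b hb hG =>
    ⟨hR.mem i hi a ha b hb hG, hW i hi a ha b hb hG⟩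
  intro t ht
  refine (hX.subset_of_sig hf (fun t h => h.1) hR.fixed ?_ ?_ t ht).2
  · have h := hS.lt t ht j hj
    exact ⟨_, hmem j hj _ h _ h ((hR.flag j hj _ h _ h).2
      ⟨le_rfl, t, t, ht, ht, fun _ _ => rfl, rfl, rfl⟩)⟩
  · intro i hi hji a b hab
    have hab' := hab
    obtain ⟨u, v, hu, hv, -, rfl, rfl⟩ := hab'
    have ha := hS.lt u hu i hi
    have hb := hS.lt v hv i hi
    have hG := (hR.flag i hi _ ha _ hb).2 ⟨hji, hab⟩
    have hG' := hR.flag_left hi ha hb hG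
    exact ⟨_, _, hmem i hi _ ha _ ha hG', hmem i hi _ ha _ hb hG,
      fun k hk => (hR.agree i hi _ ha _ hb hG k hk).symm, hR.value i hi _ ha _ ha hG',
      hR.value i hi _ ha _ hb hG⟩

/-- Fixing the value at the first free position: every witness `w` of the new representation is
`f (t, u, u')` with witnesses `u` and `u'` of the old one and a tuple `t` with the right value. -/
theorem Represents.fix (hf : IsOp q f) (hS : IsRel n q f S) (hR : Represents n q j G W S)
    {v : ℕ} {G' W' : ℕ → ℕ}
    (hG : ∀ k < n, ∀ c < q, ∀ d < q, G' (idx q k c d) ≠ 0 ↔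
      j < k ∧ (∃ t, S t ∧ t j = v ∧ t k = c) ∧ G (idx q k c d) ≠ 0)
    (hW : ∀ k < n, ∀ c < q, (∃ d < q, G' (idx q k c d) ≠ 0) → ∃ t, S t ∧ t j = v ∧ t k = c ∧
      ∀ d < q, G' (idx q k c d) ≠ 0 → ∀ h < n, row n W' (idx q k c d) h =
        f (t h) (row n W (idx q k c c) h) (row n W (idx q k c d) h)) :
    Represents n q (j + 1) G' W' fun t => S t ∧ t j = v := by
  have key : ∀ k < n, ∀ c < q, ∀ d < q, G' (idx q k c d) ≠ 0 → ∃ t, S t ∧ t j = v ∧ t k = c ∧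
      ∀ e < q, G' (idx q k c e) ≠ 0 →
        (S (row n W' (idx q k c e)) ∧ row n W' (idx q k c e) j = v) ∧
        row n W' (idx q k c e) k = e ∧ ∀ h < k, row n W' (idx q k c e) h = t h := by
    intro k hk c hc d hd h
    obtain ⟨t, ht, htj, htk, hrow⟩ := hW k hk c hc ⟨d, hd, h⟩
    refine ⟨t, ht, htj, htk, fun e he h' => ?_⟩
    obtain ⟨hjk, -, hGe⟩ := (hG k hk c hc e he).1 h'
    have hGc := hR.flag_left hk hc he hGe
    have hu := hR.mem k hk c hc c hc hGc
    have hu' := hR.mem k hk c hc e he hGe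
    have below : ∀ h < k, row n W' (idx q k c e) h = t h := by
      intro h hh
      rw [hrow e he h' h (by omega), hR.agree k hk c hc e he hGe h hh]
      exact hf.right _ _ (hS.lt _ hu _ (by omega)) (hS.lt _ ht _ (by omega))
    refine ⟨⟨?_, by rw [below j hjk, htj]⟩, ?_, below⟩
    · exact hS.ext _ _ (fun h hh => (hrow e he h' h hh).symm) (hS.closed _ _ _ ht hu hu')
    · rw [hrow e he h' k hk, hR.value k hk c hc e he hGe, hR.value k hk c hc c hc hGc, htk]
      exact hf.left _ _ hc he
  refine ⟨fun t t' ht ht' k hk => ?_, fun k hk c hc d hd => ⟨fun h => ?_, fun h => ?_⟩,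
    fun k hk c hc d hd h => ?_, fun k hk c hc d hd h => ?_, fun k hk c hc d hd h => ?_⟩
  · rcases Nat.lt_succ_iff_lt_or_eq.mp hk with hk | rfl
    · exact hR.fixed _ _ ht.1 ht'.1 k hk
    · rw [ht.2, ht'.2]
  · obtain ⟨t, ht, htj, htk, H⟩ := key k hk c hc d hd h
    obtain ⟨h1, h2, h3⟩ := H d hd h
    exact ⟨((hG k hk c hc d hd).1 h).1, t, _, ⟨ht, htj⟩, h1, fun i hi => (h3 i hi).symm, htk, h2⟩
  · obtain ⟨hjk, hs⟩ := h
    have hs' := hs.mono (S' := S) fun t h => h.1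
    obtain ⟨t, -, ht, -, -, htc, -⟩ := hs
    exact (hG k hk c hc d hd).2 ⟨hjk, ⟨t, ht.1, ht.2, htc⟩,
      (hR.flag k hk c hc d hd).2 ⟨by omega, hs'⟩⟩
  · obtain ⟨t, ht, htj, htk, H⟩ := key k hk c hc d hd h
    exact (H d hd h).1
  · obtain ⟨t, ht, htj, htk, H⟩ := key k hk c hc d hd h
    exact (H d hd h).2.1
  · obtain ⟨t, ht, htj, htk, H⟩ := key k hk c hc d hd h
    have hc' : G' (idx q k c c) ≠ 0 := by
      obtain ⟨h1, h2, h3⟩ := (hG k hk c hc d hd).1 h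
      exact (hG k hk c hc c hc).2 ⟨h1, h2, hR.flag_left hk hc hd h3⟩
    intro i hi
    rw [(H d hd h).2.2 i hi, (H c hc hc').2.2 i hi]

/-- The entries `(i, a, ·)` of the tables are correct for `S`, as far as this can be seen from the
tuples with the same beginning as a single tuple `u` in `S` with `u i = a`. -/
def EntryDone (n q : ℕ) (G W : ℕ → ℕ) (S : (ℕ → ℕ) → Prop) (i a : ℕ) : Prop :=
  (∃ u, (S u ∧ u i = a) ∧ ∀ b < q,
    (G (idx q i a b) ≠ 0 ↔ ∃ t, S t ∧ (∀ k < i, t k = u k) ∧ t i = b) ∧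
    (G (idx q i a b) ≠ 0 → S (row n W (idx q i a b)) ∧
      (∀ k < i, row n W (idx q i a b) k = u k) ∧ row n W (idx q i a b) i = b)) ∨
  (∀ u, S u → u i ≠ a) ∧ ∀ b < q, G (idx q i a b) = 0

theorem EntryDone.congr (hS : IsRel n q f S) {G' W' : ℕ → ℕ} {i a : ℕ} (hi : i < n)
    (h : EntryDone n q G W S i a)
    (hGW : ∀ b < q, G' (idx q i a b) = G (idx q i a b) ∧
      ∀ k < n, row n W' (idx q i a b) k = row n W (idx q i a b) k) :
    EntryDone n q G' W' S i a := by
  refine h.imp (fun ⟨u, hu, H⟩ => ⟨u, hu, fun b hb => ?_⟩) fun ⟨h1, h2⟩ => ⟨h1, fun b hb => ?_⟩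
  · rw [(hGW b hb).1]
    refine ⟨(H b hb).1, fun hG => ?_⟩
    obtain ⟨g1, g2, g3⟩ := (H b hb).2 hG
    have hrow := (hGW b hb).2
    exact ⟨hS.ext _ _ (fun k hk => (hrow k hk).symm) g1,
      fun k hk => (hrow k (hk.trans hi)).trans (g2 k hk), (hrow i hi).trans g3⟩
  · rw [(hGW b hb).1, h2 b hb]

/-- By rectangularity, tables all of whose entries are correct in this sense represent `S`. -/
theorem represents_of_entryDone (hf : IsOp q f) (hS : IsRel n q f S)
    (h : ∀ i < n, ∀ a < q, EntryDone n q G W S i a) : Represents n q 0 G W S := by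
  have key : ∀ i < n, ∀ a < q, ∀ b < q, G (idx q i a b) ≠ 0 → ∃ u, (S u ∧ u i = a) ∧ ∀ b < q,
        (G (idx q i a b) ≠ 0 ↔ ∃ t, S t ∧ (∀ k < i, t k = u k) ∧ t i = b) ∧
        (G (idx q i a b) ≠ 0 → S (row n W (idx q i a b)) ∧
          (∀ k < i, row n W (idx q i a b) k = u k) ∧ row n W (idx q i a b) i = b) := by
    intro i hi a ha b hb hG
    rcases h i hi a ha with h | h
    · exact h
    · exact absurd (h.2 b hb) hG
  refine ⟨fun _ _ _ _ k hk => absurd hk (Nat.not_lt_zero k), fun i hi a ha b hb =>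
    ⟨fun hG => ?_, fun hs => ?_⟩, fun i hi a ha b hb hG => ?_, fun i hi a ha b hb hG => ?_,
    fun i hi a ha b hb hG => ?_⟩
  · obtain ⟨u, ⟨hu, hua⟩, H⟩ := key i hi a ha b hb hG
    obtain ⟨t, ht, htu, htb⟩ := (H b hb).1.1 hG
    exact ⟨Nat.zero_le _, u, t, hu, ht, fun k hk => (htu k hk).symm, hua, htb⟩
  · rcases h i hi a ha with ⟨u, ⟨hu, hua⟩, H⟩ | h
    · exact (H b hb).1.2 (hS.exists_of_sig hf hi hs.2 hu hua)
    · obtain ⟨-, t, -, ht, -, -, hta, -⟩ := hs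
      exact absurd hta (h.1 t ht)
  · obtain ⟨u, -, H⟩ := key i hi a ha b hb hG
    exact ((H b hb).2 hG).1
  · obtain ⟨u, -, H⟩ := key i hi a ha b hb hG
    exact ((H b hb).2 hG).2.2
  · obtain ⟨u, hu, H⟩ := key i hi a ha b hb hG
    have hGa : G (idx q i a a) ≠ 0 := (H a ha).1.2 ⟨u, hu.1, fun _ _ => rfl, hu.2⟩
    intro k hk
    rw [((H b hb).2 hG).2.1 k hk, ((H a ha).2 hGa).2.1 k hk]

/-- The number of pairs in the signatures. -/
noncomputable def sigCard (n q : ℕ) (S : (ℕ → ℕ) → Prop) : ℕ := by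
  classical
  exact ((Finset.range n ×ˢ Finset.range q ×ˢ Finset.range q).filter
    fun x => sig S x.1 x.2.1 x.2.2).card

theorem sigCard_le : sigCard n q S ≤ q * q * n := by
  classical
  refine (Finset.card_filter_le _ _).trans (le_of_eq ?_)
  simp only [Finset.card_product, Finset.card_range]
  ring

/-- A proper closed subset has a smaller signature. -/
theorem IsRel.sigCard_lt (hf : IsOp q f) (hS : IsRel n q f S) (hS' : IsRel n q f S') (hn : 0 < n)
    (hsub : ∀ t, S' t → S t) {t : ℕ → ℕ} (ht : S t) (ht' : ¬ S' t) :
    sigCard n q S' < sigCard n q S := by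
  classical
  refine Finset.card_lt_card ((Finset.ssubset_iff_of_subset ?_).2 ?_)
  · intro x
    simp only [Finset.mem_filter]
    exact fun h => ⟨h.1, h.2.mono hsub⟩
  by_contra hcon
  push Not at hcon
  have hmem : ∀ i < n, ∀ a b, sig S i a b → sig S' i a b := by
    intro i hi a b hab
    have hab' := hab
    obtain ⟨u, v, hu, hv, -, rfl, rfl⟩ := hab'
    have := hcon (i, u i, v i) (by
      simp only [Finset.mem_filter, Finset.mem_product, Finset.mem_range]
      exact ⟨⟨hi, hS.lt u hu i hi, hS.lt v hv i hi⟩, hab⟩)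
    exact (Finset.mem_filter.1 this).2
  refine ht' (hS'.subset_of_sig hf hsub (j := 0)
    (fun _ _ _ _ k hk => absurd hk (Nat.not_lt_zero k)) ?_ (fun i hi _ => hmem i hi) t ht)
  obtain ⟨u, -, hu, -⟩ := hmem 0 hn _ _ ⟨t, t, ht, ht, fun _ _ => rfl, rfl, rfl⟩
  exact ⟨u, hu⟩

/-! ### Codes of short tuples -/

/-- The number with the digits `g 0, …, g (l - 1)` in base `q`, the lowest first. -/
def enc (q : ℕ) : ℕ → (ℕ → ℕ) → ℕ
  | 0, _ => 0
  | l + 1, g => g 0 + q * enc q l fun i => g (i + 1)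

/-- Digit `i` of `v` in base `q`. -/
def digit (q v i : ℕ) : ℕ := v / q ^ i % q

theorem enc_congr {l : ℕ} {g g' : ℕ → ℕ} (h : ∀ i < l, g i = g' i) : enc q l g = enc q l g' := by
  induction l generalizing g g' with
  | zero => rfl
  | succ l ih => rw [enc, enc, h 0 (by omega), ih fun i hi => h (i + 1) (by omega)]

theorem enc_lt {l : ℕ} {g : ℕ → ℕ} (h : ∀ i < l, g i < q) : enc q l g < q ^ l := by
  induction l generalizing g with
  | zero => simp [enc]
  | succ l ih =>
    have h0 := h 0 (by omega)
    have h1 := ih (g := fun i => g (i + 1)) fun i hi => h (i + 1) (by omega)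
    rw [enc, pow_succ']
    calc _ < q + q * enc q l (fun i => g (i + 1)) := by omega
      _ = q * (enc q l (fun i => g (i + 1)) + 1) := by ring
      _ ≤ _ := Nat.mul_le_mul_left _ h1

theorem digit_enc {l : ℕ} {g : ℕ → ℕ} (h : ∀ i < l, g i < q) {i : ℕ} (hi : i < l) :
    digit q (enc q l g) i = g i := by
  induction l generalizing g i with
  | zero => omega
  | succ l ih =>
    have h0 := h 0 (by omega)
    cases i with
    | zero => rw [digit, pow_zero, Nat.div_one, enc, Nat.add_mul_mod_self_left, Nat.mod_eq_of_lt h0]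
    | succ i =>
      rw [← ih (g := fun i => g (i + 1)) (fun i hi => h (i + 1) (by omega)) (by omega : i < l)]
      rw [digit, digit, enc, pow_succ', ← Nat.div_div_eq_div_mul,
        Nat.add_mul_div_left _ _ (by omega), Nat.div_eq_of_lt h0, zero_add]

/-- The operation `f` on codes of tuples. -/
def codeOp (q l : ℕ) (f : ℕ → ℕ → ℕ → ℕ) (u v w : ℕ) : ℕ :=
  enc q l fun i => f (digit q u i) (digit q v i) (digit q w i)

/-- The code of the projection of `t` to the positions `p 0, …, p (l - 1)`. -/
def projCode (q l : ℕ) (p t : ℕ → ℕ) : ℕ := enc q l fun i => t (p i)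

theorem IsRel.projCode_lt (hS : IsRel n q f S) {l : ℕ} {p t : ℕ → ℕ} (hp : ∀ i < l, p i < n)
    (ht : S t) : projCode q l p t < q ^ l :=
  enc_lt fun i hi => hS.lt t ht _ (hp i hi)

theorem IsRel.projCode_op (hS : IsRel n q f S) {l : ℕ} {p x y z : ℕ → ℕ} (hp : ∀ i < l, p i < n)
    (hx : S x) (hy : S y) (hz : S z) :
    projCode q l p (fun k => f (x k) (y k) (z k)) =
      codeOp q l f (projCode q l p x) (projCode q l p y) (projCode q l p z) := by
  refine enc_congr fun i hi => ?_
  have h : ∀ t, S t → digit q (projCode q l p t) i = t (p i) := fun t ht =>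
    digit_enc (fun i hi => hS.lt t ht _ (hp i hi)) hi
  rw [h x hx, h y hy, h z hz]

theorem projCode_ext {l : ℕ} {p t t' : ℕ → ℕ} (hp : ∀ i < l, p i < n)
    (h : ∀ k < n, t k = t' k) : projCode q l p t = projCode q l p t' :=
  enc_congr fun i hi => h _ (hp i hi)

end Maltsev

namespace RAM

open Maltsev

/-! ### The pieces of the program

Register `0` is the answer and register `1` holds the number of variables; the others are counters
and temporary values. -/

/-- Counter along a row. -/
abbrev rH : ℕ := 2
/-- Counter through a table. -/
abbrev rX : ℕ := 3
/-- Code of a short tuple. -/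
abbrev rZ : ℕ := 4
/-- Counter of rounds. -/
abbrev rR : ℕ := 5
/-- Counter through codes, or through triples of codes. -/
abbrev rY : ℕ := 6
/-- Position in a tuple. -/
abbrev rK : ℕ := 7
/-- Element of the structure. -/
abbrev rC : ℕ := 8
/-- Element of the structure. -/
abbrev rD : ℕ := 9
/-- Code of a short tuple. -/
abbrev rV : ℕ := 10
/-- Counter along a scope. -/
abbrev rL : ℕ := 11
/-- Position in a tuple. -/
abbrev rI : ℕ := 12
/-- Element of the structure. -/
abbrev rA : ℕ := 13
/-- Position whose value is being fixed. -/
abbrev rJ : ℕ := 14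
/-- Symbol of a constraint. -/
abbrev rS : ℕ := 15
/-- Number of constraints. -/
abbrev rM : ℕ := 16
/-- Number of constraints read so far. -/
abbrev rT : ℕ := 17
/-- Position in the input. -/
abbrev rP : ℕ := 18
/-- Counter of eliminated variables. -/
abbrev rE : ℕ := 19
/-- Variable being eliminated. -/
abbrev rF : ℕ := 20

/-- Flags of the current relation. -/
abbrev aG : ℕ := 1
/-- Witnesses of the current relation. -/
abbrev aW : ℕ := 2
/-- Flags of the relation whose values are being fixed. -/
abbrev aWorkG : ℕ := 3
/-- Witnesses of the relation whose values are being fixed. -/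
abbrev aWorkW : ℕ := 4
/-- Flags under construction when a value is being fixed. -/
abbrev aTmpG : ℕ := 5
/-- Witnesses under construction when a value is being fixed. -/
abbrev aTmpW : ℕ := 6
/-- Flags under construction when a constraint is being added. -/
abbrev aNewG : ℕ := 7
/-- Witnesses under construction when a constraint is being added. -/
abbrev aNewW : ℕ := 8
/-- Characteristic function of the codes of a projection. -/
abbrev aHas : ℕ := 9
/-- Tuples with given codes. -/
abbrev aTup : ℕ := 10
/-- Witness from which a tuple is copied. -/
abbrev aSrc : ℕ := 11
/-- Positions of a projection. -/
abbrev aPos : ℕ := 12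
/-- Scope of a constraint. -/
abbrev aScope : ℕ := 13
/-- A tuple whose beginning is being fixed. -/
abbrev aFix : ℕ := 14
/-- Characteristic function of a constraint on codes. -/
abbrev aCon : ℕ := 15
/-- Cell `0` is a flag for success or violation. -/
abbrev aFound : ℕ := 16
/-- Table of the values that survive an elimination. -/
abbrev aOdd : ℕ := 17
/-- Constant table: the identity. -/
abbrev aId : ℕ := 20
/-- Constant table: first component of a triple of codes. -/
abbrev aFst : ℕ := 21
/-- Constant table: second component of a triple of codes. -/
abbrev aSnd : ℕ := 22
/-- Constant table: third component of a triple of codes. -/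
abbrev aTrd : ℕ := 23
/-- Constant table: the operation on codes. -/
abbrev aCodeOp : ℕ := 24
/-- Constant table: the operation on elements. -/
abbrev aOp : ℕ := 25
/-- Constant table: code of a tuple that is constant up to its last entry. -/
abbrev aPair : ℕ := 26
/-- Constant table: last digit of a code. -/
abbrev aLast : ℕ := 27
/-- Constant table: first digit of a code. -/
abbrev aFirst : ℕ := 28
/-- Constant table: arities of the symbols. -/
abbrev aArity : ℕ := 29
/-- Constant table: the relations of the structure on codes. -/
abbrev aRel : ℕ := 30

namespace Code

/-- The index of an entry `(i, a, b)`. -/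
def idxE (q : ℕ) (i a b : Expr) : Expr := .add (.mul (.add (.mul i (.lit q)) a) (.lit q)) b

/-- The index of cell `k` of row `r`. -/
def cellE (r k : Expr) : Expr := .add (.mul r (.reg 1)) k

/-- The code of the projection of row `r` of array `w` to the positions in cells `o, …, o + l - 1`
of the array of positions. -/
def projE (q w : ℕ) (r : Expr) : ℕ → ℕ → Expr
  | 0, _ => .lit 0
  | l + 1, o => .add (.get w (cellE r (.get aPos (.lit o)))) (.mul (.lit q) (projE q w r l (o + 1)))

/-- Fill row `r` of an array; the entries are the values of `e` for the values of the counter. -/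
def fillRow (dst : ℕ) (r e : Expr) : Code := .iter rH 0 1 (.put dst (cellE r (.reg rH)) e)

/-- Copy row `r'` of one array to row `r` of another. -/
def copyRow (dst : ℕ) (r : Expr) (src : ℕ) (r' : Expr) : Code :=
  fillRow dst r (.get src (cellE r' (.reg rH)))

/-- Apply the operation to three rows. -/
def opRow (q dst : ℕ) (r : Expr) (a₁ : ℕ) (r₁ : Expr) (a₂ : ℕ) (r₂ : Expr) (a₃ : ℕ) (r₃ : Expr) :
    Code :=
  fillRow dst r (.get aOp (idxE q (.get a₁ (cellE r₁ (.reg rH))) (.get a₂ (cellE r₂ (.reg rH)))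
    (.get a₃ (cellE r₃ (.reg rH)))))

/-- Copy flags and witnesses of a relation. -/
def copyRep (q g' w' g w : ℕ) : Code :=
  .iter rX 0 (q * q) (.seq (.put g' (.reg rX) (.get g (.reg rX)))
    (copyRow w' (.reg rX) w (.reg rX)))

/-- Delete all flags. -/
def clear (q g : ℕ) : Code := .iter rX 0 (q * q) (.put g (.reg rX) (.lit 0))

/-- Start of `closure`: no code has been found. -/
def closureInit (q l : ℕ) : Code := .iter rX (q ^ (l + 1)) 0 (.put aHas (.reg rX) (.lit 0))

/-- The codes of the witnesses, and for each of them one witness. -/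
def closureScan (q l : ℕ) : Code :=
  .iter rX 0 (q * q) (.ite (.get aWorkG (.reg rX))
    (.seq (.set rZ (.get aId (projE q aWorkW (.reg rX) (l + 1) 0)))
      (.seq (.put aHas (.reg rZ) (.lit 1)) (.put aSrc (.reg rZ) (.reg rX)))) .skip)

/-- Copy the witnesses that have been chosen. -/
def closureCopy (q l : ℕ) : Code :=
  .iter rX (q ^ (l + 1)) 0 (.ite (.get aHas (.reg rX))
    (copyRow aTup (.reg rX) aWorkW (.get aSrc (.reg rX))) .skip)

/-- Apply the operation to one triple of codes, if this yields a new code. -/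
def closureStep (q : ℕ) : Code :=
  .ite (.get aHas (.get aFst (.reg rY))) (.ite (.get aHas (.get aSnd (.reg rY)))
    (.ite (.get aHas (.get aTrd (.reg rY))) (.seq (.set rZ (.get aCodeOp (.reg rY)))
      (.ite (.get aHas (.reg rZ)) .skip (.seq (.put aHas (.reg rZ) (.lit 1))
        (opRow q aTup (.reg rZ) aTup (.get aFst (.reg rY)) aTup (.get aSnd (.reg rY))
          aTup (.get aTrd (.reg rY)))))) .skip) .skip) .skip

/-- Apply the operation to all triples of codes. -/
def closureRound (q l : ℕ) : Code :=
  .iter rY (q ^ (l + 1) * q ^ (l + 1) * q ^ (l + 1)) 0 (closureStep q)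

/-- Apply the operation until no new code can appear. -/
def closureRounds (q l : ℕ) : Code := .iter rR (q ^ (l + 1) + 1) 0 (closureRound q l)

/-- The projection of the relation in the work arrays to the positions listed in `aPos`: its
codes, and a tuple for each of them. -/
def closure (q l : ℕ) : Code :=
  .seq (closureInit q l) (.seq (closureScan q l) (.seq (closureCopy q l) (closureRounds q l)))

/-- New witnesses at position `rK`, for the first entry `rC`, after the value at `rJ` is fixed. -/
def fixValue (q : ℕ) : Code :=
  .seq (.set rV (.get aPair (.add (.mul (.get aFix (.reg rJ)) (.lit q)) (.reg rC))))
    (.ite (.get aHas (.reg rV)) (.iter rD q 0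
      (.ite (.get aWorkG (idxE q (.reg rK) (.reg rC) (.reg rD)))
        (.seq (.put aTmpG (idxE q (.reg rK) (.reg rC) (.reg rD)) (.lit 1))
          (opRow q aTmpW (idxE q (.reg rK) (.reg rC) (.reg rD)) aTup (.reg rV)
            aWorkW (idxE q (.reg rK) (.reg rC) (.reg rC))
            aWorkW (idxE q (.reg rK) (.reg rC) (.reg rD)))) .skip)) .skip)

/-- New witnesses at position `rK` after the value at `rJ` is fixed. -/
def fixLevel (q l : ℕ) : Code :=
  .seq (.iter rL l 0 (.put aPos (.reg rL) (.reg rJ))) (.seq (.put aPos (.lit l) (.reg rK))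
    (.seq (closure q l) (.iter rC q 0 (fixValue q))))

/-- Fix the value at position `rJ` as in `aFix` for the relation in the work arrays. -/
def fix (q l : ℕ) : Code :=
  .seq (clear q aTmpG) (.seq (.iter rK 0 1 (.ite (.lt (.reg rJ) (.reg rK)) (fixLevel q l) .skip))
    (copyRep q aWorkG aWorkW aTmpG aTmpW))

/-- Project to the scope of the constraint and to one more position. -/
def scopePos (l : ℕ) (i : Expr) : Code :=
  .seq (.iter rL l 0 (.put aPos (.reg rL) (.get aScope (.reg rL)))) (.put aPos (.lit l) i)

/-- Search for a tuple that satisfies the constraint and has value `rA` at position `rI`. -/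
def search (q l : ℕ) : Code :=
  .seq (.put aFound (.lit 0) (.lit 0)) (.iter rY (q ^ (l + 1)) 0
    (.ite (.get aHas (.reg rY)) (.ite (.get aCon (.reg rY))
      (.ite (.lt (.get aLast (.reg rY)) (.reg rA)) .skip
        (.ite (.lt (.reg rA) (.get aLast (.reg rY))) .skip
          (.seq (copyRow aFix (.lit 0) aTup (.reg rY)) (.put aFound (.lit 0) (.lit 1)))))
      .skip) .skip))

/-- Store the tuples that satisfy the constraint as new witnesses for position `rI` and first
entry `rA`. -/
def store (q l : ℕ) : Code :=
  .iter rY (q ^ (l + 1)) 0 (.ite (.get aHas (.reg rY)) (.ite (.get aCon (.reg rY))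
    (.seq (.put aNewG (idxE q (.reg rI) (.reg rA) (.get aLast (.reg rY))) (.lit 1))
      (copyRow aNewW (idxE q (.reg rI) (.reg rA) (.get aLast (.reg rY))) aTup (.reg rY)))
    .skip) .skip)

/-- Fix all values before position `rI`. -/
def fixPrefix (q l : ℕ) : Code :=
  .iter rJ 0 1 (.ite (.lt (.reg rJ) (.reg rI)) (fix q l) .skip)

/-- New witnesses for position `rI` and first entry `rA`, once a tuple has been found. -/
def extend (q l : ℕ) : Code :=
  .seq (fixPrefix q l) (.seq (scopePos l (.reg rI)) (.seq (closure q l) (store q l)))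

/-- New witnesses for position `rI` and first entry `rA`. -/
def updateEntry (q l : ℕ) : Code :=
  .seq (copyRep q aWorkG aWorkW aG aW) (.seq (scopePos l (.reg rI)) (.seq (closure q l)
    (.seq (search q l) (.ite (.get aFound (.lit 0)) (extend q l) .skip))))

/-- Add the constraint given by `aScope` and `aCon` to the current relation. -/
def update (q l : ℕ) : Code :=
  .seq (clear q aNewG) (.seq (.iter rI 0 1 (.iter rA q 0 (updateEntry q l)))
    (copyRep q aG aW aNewG aNewW))

/-- Decide whether some witness violates the constraint given by `aScope` and `aCon`. -/
def check (q l : ℕ) : Code :=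
  .seq (scopePos l (.lit 0)) (.seq (.put aFound (.lit 0) (.lit 0)) (.iter rX 0 (q * q)
    (.ite (.get aG (.reg rX)) (.ite (.get aCon (projE q aW (.reg rX) (l + 1) 0)) .skip
      (.put aFound (.lit 0) (.lit 1))) .skip)))

/-- The set of all tuples. -/
def full (q : ℕ) : Code :=
  .iter rK 0 1 (.iter rC q 0 (.iter rD q 0
    (.seq (.put aG (idxE q (.reg rK) (.reg rC) (.reg rD)) (.lit 1))
      (.seq (fillRow aW (idxE q (.reg rK) (.reg rC) (.reg rD)) (.lit 0))
        (.put aW (cellE (idxE q (.reg rK) (.reg rC) (.reg rD)) (.reg rK)) (.reg rD))))))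

/-- Read the constraint at position `rP` of the input. -/
def read (q l : ℕ) : Code :=
  .seq (.set rS (.get 0 (.reg rP))) (.seq
    (.iter rL l 0 (.put aScope (.reg rL) (.lit 0))) (.seq
    (.iter rL l 0 (.ite (.lt (.reg rL) (.get aArity (.reg rS)))
      (.put aScope (.reg rL) (.get 0 (.add (.add (.reg rP) (.lit 1)) (.reg rL)))) .skip))
    (.iter rY (q ^ (l + 1)) 0 (.put aCon (.reg rY)
      (.get aRel (.add (.mul (.reg rS) (.lit (q ^ (l + 1)))) (.reg rY)))))))

/-- Table of the elements for which the number of related elements at position `rF` is odd. -/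
def oddTable (q : ℕ) : Code :=
  .iter rC q 0 (.seq (.put aOdd (.reg rC) (.lit 0)) (.iter rD q 0
    (.ite (.get aG (idxE q (.reg rF) (.reg rC) (.reg rD)))
      (.put aOdd (.reg rC) (.sub (.lit 1) (.get aOdd (.reg rC)))) .skip)))

/-- Eliminate the variable `rF`. -/
def eliminate (q l : ℕ) : Code :=
  .seq (.set rF (.sub (.sub (.reg 1) (.lit 1)) (.reg rE))) (.seq (oddTable q) (.seq
    (.iter rY (q ^ (l + 1)) 0 (.put aCon (.reg rY) (.get aOdd (.get aFirst (.reg rY)))))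
    (.seq (.iter rL l 0 (.put aScope (.reg rL) (.reg rF))) (update q l))))

/-- Eliminate all variables and decide whether any tuple survives. -/
def finish (q l : ℕ) : Code :=
  .seq (.iter rE 0 1 (eliminate q l)) (.seq (.put aFound (.lit 0) (.lit 0)) (.seq
    (.iter rC q 0 (.ite (.get aG (idxE q (.lit 0) (.reg rC) (.reg rC)))
      (.put aFound (.lit 0) (.lit 1)) .skip))
    (.set 0 (.get aFound (.lit 0)))))

/-- Write the numbers `g 0, …, g (m - 1)` into an array. -/
def table (a : ℕ) (g : ℕ → ℕ) : ℕ → Code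
  | 0 => .skip
  | m + 1 => .seq (table a g m) (.put a (.lit m) (.lit (g m)))

/-- Write the constant tables. -/
def tables (q l : ℕ) (f : ℕ → ℕ → ℕ → ℕ) (r : ℕ) (ar rel : ℕ → ℕ) : Code :=
  let K := q ^ (l + 1)
  .seq (table aId id K) <| .seq (table aFst (fun y => y / K / K) (K * K * K)) <|
  .seq (table aSnd (fun y => y / K % K) (K * K * K)) <|
  .seq (table aTrd (fun y => y % K) (K * K * K)) <|
  .seq (table aCodeOp (fun y => codeOp q (l + 1) f (y / K / K) (y / K % K) (y % K)) (K * K * K)) <|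
  .seq (table aOp (fun y => f (y / q / q) (y / q % q) (y % q)) (q * q * q)) <|
  .seq (table aPair (fun y => enc q (l + 1) fun i => if i < l then y / q else y % q) (q * q)) <|
  .seq (table aLast (fun y => digit q y l) K) <| .seq (table aFirst (fun y => digit q y 0) K) <|
  .seq (table aArity ar r) (table aRel rel (r * K))

theorem depth_check_read (q l : ℕ) : ((read q l).seq (check q l)).depth ≤ 1 := by
  simp only [read, check, scopePos, depth]
  generalize q * q = m
  cases m <;> simp

theorem depth_update (q l : ℕ) : (update q l).depth ≤ 4 := by
  simp only [update, updateEntry, clear, copyRep, copyRow, extend, store, fixPrefix, fix, fixLevel,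
    fixValue, opRow, search, scopePos, fillRow, closure, closureInit, closureScan, closureCopy,
    closureRounds, closureRound, closureStep, depth]
  generalize q * q = m
  cases m <;> simp

theorem depth_finish (q l : ℕ) : (finish q l).depth ≤ 5 := by
  have h : ∀ a, a ≤ 4 → max (1 + (max 0 (max 0 (max 0 (max 0 a))))) 0 ≤ 5 := by omega
  have := depth_update q l
  simp only [finish, eliminate, oddTable, depth]
  omega

end Code
end RAM

namespace RAM

open Maltsev

/-! ### Rows, projections and tables -/

/-- The contents of the constant tables. -/
structure Tables (q l : ℕ) (f : ℕ → ℕ → ℕ → ℕ) (A : ℕ → ℕ → ℕ) : Prop where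
  ident : ∀ v < q ^ (l + 1), A aId v = v
  fst : ∀ u v w, u < q ^ (l + 1) → v < q ^ (l + 1) → w < q ^ (l + 1) →
    A aFst (idx (q ^ (l + 1)) u v w) = u
  snd : ∀ u v w, u < q ^ (l + 1) → v < q ^ (l + 1) → w < q ^ (l + 1) →
    A aSnd (idx (q ^ (l + 1)) u v w) = v
  trd : ∀ u v w, u < q ^ (l + 1) → v < q ^ (l + 1) → w < q ^ (l + 1) →
    A aTrd (idx (q ^ (l + 1)) u v w) = w
  codeOp : ∀ u v w, u < q ^ (l + 1) → v < q ^ (l + 1) → w < q ^ (l + 1) →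
    A aCodeOp (idx (q ^ (l + 1)) u v w) = codeOp q (l + 1) f u v w
  op : ∀ a b c, a < q → b < q → c < q → A aOp (idx q a b c) = f a b c
  pair : ∀ a b, a < q → b < q →
    A aPair (a * q + b) = enc q (l + 1) fun i => if i < l then a else b
  last : ∀ v < q ^ (l + 1), A aLast v = digit q v l
  first : ∀ v < q ^ (l + 1), A aFirst v = digit q v 0

/-- No table that `Tables` speaks of is written. -/
def Code.KeepsTables (P : Code) : Bool :=
  !P.writesArr aId && !P.writesArr aFst && !P.writesArr aSnd && !P.writesArr aTrd &&
  !P.writesArr aCodeOp && !P.writesArr aOp && !P.writesArr aPair && !P.writesArr aLast &&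
  !P.writesArr aFirst

theorem Tables.of_keeps {q l : ℕ} {f : ℕ → ℕ → ℕ → ℕ} {A A' : ℕ → ℕ → ℕ} (h : Tables q l f A)
    (P : Code) (hP : P.KeepsTables = true)
    (hA : ∀ a, P.writesArr a = false → A' a = A a) : Tables q l f A' := by
  simp only [Code.KeepsTables, Bool.and_eq_true, Bool.not_eq_true'] at hP
  obtain ⟨⟨⟨⟨⟨⟨⟨⟨h1, h2⟩, h3⟩, h4⟩, h5⟩, h6⟩, h7⟩, h8⟩, h9⟩ := hP
  constructor
  · rw [hA _ h1]; exact h.ident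
  · rw [hA _ h2]; exact h.fst
  · rw [hA _ h3]; exact h.snd
  · rw [hA _ h4]; exact h.trd
  · rw [hA _ h5]; exact h.codeOp
  · rw [hA _ h6]; exact h.op
  · rw [hA _ h7]; exact h.pair
  · rw [hA _ h8]; exact h.last
  · rw [hA _ h9]; exact h.first

namespace Code

theorem run_seq (P Q : Code) (s : State) : (seq P Q).run s = Q.run (P.run s) := rfl

theorem run_put (a : ℕ) (i e : Expr) (s : State) :
    (put a i e).run s = s.setCell a (i.eval s) (e.eval s) := rfl

theorem run_ite (e : Expr) (P Q : Code) (s : State) :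
    (ite e P Q).run s = if e.eval s = 0 then Q.run s else P.run s := rfl

theorem row_index_inj {n r r' k k' : ℕ} (hk : k < n) (hk' : k' < n)
    (h : r * n + k = r' * n + k') : r = r' ∧ k = k' := by
  have hn : 0 < n := by omega
  have hx := congrArg (· / n) h
  have hm := congrArg (· % n) h
  simp only [mul_comm _ n, Nat.mul_add_div hn, Nat.div_eq_of_lt hk, Nat.div_eq_of_lt hk',
    Nat.mul_add_mod, Nat.mod_eq_of_lt hk, Nat.mod_eq_of_lt hk', add_zero] at hx hm
  exact ⟨hx, hm⟩

theorem eval_idxE (q : ℕ) (i a b : Expr) (s : State) :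
    (idxE q i a b).eval s = idx q (i.eval s) (a.eval s) (b.eval s) := rfl

theorem eval_cellE (r k : Expr) (s : State) :
    (cellE r k).eval s = r.eval s * s.reg 1 + k.eval s := rfl

theorem eval_projE (q w : ℕ) (r : Expr) (s : State) (l o : ℕ) :
    (projE q w r l o).eval s =
      enc q l fun i => row (s.reg 1) (s.arr w) (r.eval s) (s.arr aPos (o + i)) := by
  induction l generalizing o with
  | zero => rfl
  | succ l ih =>
    simp only [projE, Expr.eval, eval_cellE, ih, enc, row, add_zero]
    congr 2
    refine enc_congr fun i _ => ?_
    rw [add_right_comm, add_assoc o]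

/-- The effect of `fillRow`. The entries may depend on the other rows of the same array. -/
theorem run_fillRow {dst : ℕ} {r e : Expr} {s : State} {n R : ℕ} {val : ℕ → ℕ} (hn : s.reg 1 = n)
    (hr : ∀ u : State, (∀ y, y ≠ rH → u.reg y = s.reg y) →
      (∀ a, a ≠ dst → u.arr a = s.arr a) → r.eval u = R)
    (he : ∀ k < n, ∀ u : State, u.reg rH = k → (∀ y, y ≠ rH → u.reg y = s.reg y) →
      (∀ a, a ≠ dst → u.arr a = s.arr a) →
      (∀ R', R' ≠ R → ∀ k < n, row n (u.arr dst) R' k = row n (s.arr dst) R' k) →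
      e.eval u = val k) (R' : ℕ) :
    ∀ k < n, row n (((fillRow dst r e).run s).arr dst) R' k =
      if R' = R then val k else row n (s.arr dst) R' k := by
  have key := iter_inv (x := rH) (c := 0) (d := 1) (P := .put dst (cellE r (.reg rH)) e) hn rfl
    (fun m A => ∀ R', ∀ k < n, (R' ≠ R → row n (A dst) R' k = row n (s.arr dst) R' k) ∧
      (k < m → row n (A dst) R k = val k))
    (fun R' k hk => ⟨fun _ => rfl, fun h => absurd h (Nat.not_lt_zero k)⟩) ?_
  · intro k hk
    obtain ⟨h1, h2⟩ := key R' k hk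
    split_ifs with h
    · rw [h]; exact h2 (by omega)
    · exact h1 h
  · intro m hm u hum hu1 hu2 hinv R' k hk
    have hreg : ∀ y, y ≠ rH → u.reg y = s.reg y := fun y hy => hu1 y hy rfl
    have harr : ∀ a, a ≠ dst → u.arr a = s.arr a := fun a ha => hu2 a (by simpa [writesArr])
    have hidx : (cellE r (.reg rH)).eval u = R * n + m := by
      rw [eval_cellE, hr u hreg harr, hreg 1 (by decide), hn]
      simp only [Expr.eval, hum]
    have hm' : m < n := by omega
    simp only [run, row, State.setCell_arr, true_and, hidx,
      he m hm' u hum hreg harr fun R' hR k hk => (hinv R' k hk).1 hR]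
    refine ⟨fun hR => ?_, fun hkm => ?_⟩
    · rw [if_neg fun h => hR (row_index_inj hk hm' h).1]
      exact (hinv R' k hk).1 hR
    · rcases Nat.lt_succ_iff_lt_or_eq.mp hkm with h | rfl
      · rw [if_neg fun h' => by have := (row_index_inj hk hm' h').2; omega]
        exact (hinv R k hk).2 h
      · rw [if_pos rfl]

/-- The effect of `copyRow`. -/
theorem run_copyRow {dst src : ℕ} {r r' : Expr} {s : State} {n R Q : ℕ} (hn : s.reg 1 = n)
    (hne : src ≠ dst)
    (hr : ∀ u : State, (∀ y, y ≠ rH → u.reg y = s.reg y) →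
      (∀ a, a ≠ dst → u.arr a = s.arr a) → r.eval u = R)
    (hr' : ∀ u : State, (∀ y, y ≠ rH → u.reg y = s.reg y) →
      (∀ a, a ≠ dst → u.arr a = s.arr a) → r'.eval u = Q) (R' : ℕ) :
    ∀ k < n, row n (((copyRow dst r src r').run s).arr dst) R' k =
      if R' = R then row n (s.arr src) Q k else row n (s.arr dst) R' k := by
  refine run_fillRow (val := row n (s.arr src) Q) hn hr (fun k hk u h1 h2 h3 _ => ?_) R'
  simp only [Expr.eval, eval_cellE, hr' u h2 h3, h2 1 (by decide), hn, h1, h3 _ hne, row]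

/-- The effect of `opRow`. -/
theorem run_opRow {q l : ℕ} {f : ℕ → ℕ → ℕ → ℕ} {dst a₁ a₂ a₃ : ℕ} {r r₁ r₂ r₃ : Expr} {s : State}
    {n R R₁ R₂ R₃ : ℕ} (hn : s.reg 1 = n) (hT : Tables q l f s.arr) (hd : dst ≠ aOp)
    (hr : ∀ u : State, (∀ y, y ≠ rH → u.reg y = s.reg y) →
      (∀ a, a ≠ dst → u.arr a = s.arr a) →
      r.eval u = R ∧ r₁.eval u = R₁ ∧ r₂.eval u = R₂ ∧ r₃.eval u = R₃)
    (h₁ : a₁ = dst → R₁ ≠ R) (h₂ : a₂ = dst → R₂ ≠ R) (h₃ : a₃ = dst → R₃ ≠ R)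
    (hq₁ : ∀ k < n, row n (s.arr a₁) R₁ k < q) (hq₂ : ∀ k < n, row n (s.arr a₂) R₂ k < q)
    (hq₃ : ∀ k < n, row n (s.arr a₃) R₃ k < q) (R' : ℕ) :
    ∀ k < n, row n (((opRow q dst r a₁ r₁ a₂ r₂ a₃ r₃).run s).arr dst) R' k =
      if R' = R then f (row n (s.arr a₁) R₁ k) (row n (s.arr a₂) R₂ k) (row n (s.arr a₃) R₃ k)
      else row n (s.arr dst) R' k := by
  refine run_fillRow hn (fun u h h' => (hr u h h').1) (fun k hk u h1 h2 h3 h4 => ?_) R'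
  obtain ⟨-, e1, e2, e3⟩ := hr u h2 h3
  have aux : ∀ a Q, (a = dst → Q ≠ R) →
      u.arr a (Q * u.reg 1 + u.reg rH) = row n (s.arr a) Q k := by
    intro a Q hQ
    rw [h2 1 (by decide), hn, h1]
    by_cases ha : a = dst
    · subst ha; exact h4 Q (hQ rfl) k hk
    · rw [h3 a ha, row]
  simp only [Expr.eval, eval_idxE, eval_cellE, e1, e2, e3, aux _ _ h₁, aux _ _ h₂, aux _ _ h₃,
    h3 _ hd.symm]
  exact hT.op _ _ _ (hq₁ k hk) (hq₂ k hk) (hq₃ k hk)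

/-- The effect of `clear`. -/
theorem run_clear {q g n : ℕ} {s : State} (hn : s.reg 1 = n) :
    ∀ x < q * q * n, ((clear q g).run s).arr g x = 0 := by
  have := iter_inv (x := rX) (c := 0) (d := q * q) (P := .put g (.reg rX) (.lit 0)) hn rfl
    (fun m A => ∀ x < m, A g x = 0) (fun x hx => absurd hx (Nat.not_lt_zero x)) ?_
  · rwa [zero_add] at this
  · intro m hm u hum _ _ hinv x hx
    simp only [run, State.setCell_arr, Expr.eval, hum, true_and]
    split_ifs with h
    · rfl
    · exact hinv x (by omega)

/-- The effect of `copyRep`. -/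
theorem run_copyRep {q g' w' g w n : ℕ} {s : State} (hn : s.reg 1 = n) (h1 : g' ≠ w')
    (h2 : g ≠ g') (h3 : g ≠ w') (h4 : w ≠ g') (h5 : w ≠ w') :
    ∀ x < q * q * n, ((copyRep q g' w' g w).run s).arr g' x = s.arr g x ∧
      ∀ k < n, row n (((copyRep q g' w' g w).run s).arr w') x k = row n (s.arr w) x k := by
  have hw : ∀ a, a ≠ g' → a ≠ w' → writesArr a (.seq (.put g' (.reg rX) (.get g (.reg rX)))
      (copyRow w' (.reg rX) w (.reg rX))) = false := fun a h h' => by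
    simp [copyRow, fillRow, writesArr, h, h']
  have := iter_inv (x := rX) (c := 0) (d := q * q) (P := .seq (.put g' (.reg rX) (.get g (.reg rX)))
      (copyRow w' (.reg rX) w (.reg rX))) hn rfl
    (fun m A => ∀ x < m, A g' x = s.arr g x ∧ ∀ k < n, row n (A w') x k = row n (s.arr w) x k)
    (fun x hx => absurd hx (Nat.not_lt_zero x)) ?_
  · rwa [zero_add] at this
  · intro m hm u hum hu1 hu2 hinv x hx
    simp only [run]
    set v := u.setCell g' ((Expr.reg rX).eval u) ((Expr.get g (.reg rX)).eval u) with hv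
    have hvw : ∀ a, a ≠ g' → v.arr a = u.arr a := fun a ha => State.setCell_arr_ne u ha
    have hcr := run_copyRow (dst := w') (src := w) (r := .reg rX) (r' := .reg rX) (s := v)
      (n := n) (R := m) (Q := m) (by rw [hv, State.setCell_reg, hu1 1 (by decide) rfl, hn]) h5
      (fun t ht _ => by simp only [Expr.eval]; rw [ht rX (by decide), hv, State.setCell_reg, hum])
      (fun t ht _ => by simp only [Expr.eval]; rw [ht rX (by decide), hv, State.setCell_reg, hum])
    have hg' : ((copyRow w' (.reg rX) w (.reg rX)).run v).arr g' x = v.arr g' x := by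
      rw [run_arr (by simp [copyRow, fillRow, writesArr, h1])]
    rw [hg']
    refine ⟨?_, fun k hk => ?_⟩
    · simp only [hv, State.setCell_arr, Expr.eval, hum, true_and]
      split_ifs with h
      · rw [hu2 g (hw g h2 h3), h]
      · exact (hinv x (by omega)).1
    · rw [hcr x k hk]
      split_ifs with h
      · rw [hvw w h4, hu2 w (hw w h4 h5), h]
      · rw [hvw w' h1.symm]
        exact (hinv x (by omega)).2 k hk

theorem run_table (a : ℕ) (g : ℕ → ℕ) (m : ℕ) (s : State) :
    ∀ x < m, ((table a g m).run s).arr a x = g x := by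
  induction m with
  | zero => exact fun x hx => absurd hx (Nat.not_lt_zero x)
  | succ m ih =>
    intro x hx
    simp only [table, run, State.setCell_arr, Expr.eval, true_and]
    split_ifs with h
    · rw [h]
    · exact ih x (by omega)

theorem writesArr_table {a b : ℕ} (h : b ≠ a) (g : ℕ → ℕ) (m : ℕ) :
    (table a g m).writesArr b = false := by
  induction m with
  | zero => rfl
  | succ m ih => simp [table, writesArr, ih, h]

theorem writesReg_table (a y : ℕ) (g : ℕ → ℕ) (m : ℕ) : (table a g m).writesReg y = false := by
  induction m with
  | zero => rfl
  | succ m ih => simp [table, writesReg, ih]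

theorem WF_table (a : ℕ) (g : ℕ → ℕ) (m : ℕ) : (table a g m).WF = true := by
  induction m with
  | zero => rfl
  | succ m ih => simp [table, WF, ih, Expr.Tame]

theorem depth_table (a : ℕ) (g : ℕ → ℕ) (m : ℕ) : (table a g m).depth = 0 := by
  induction m with
  | zero => rfl
  | succ m ih => simp [table, depth, ih]

theorem WF_tables (q l : ℕ) (f : ℕ → ℕ → ℕ → ℕ) (r : ℕ) (ar rel : ℕ → ℕ) :
    (tables q l f r ar rel).WF = true := by simp [tables, WF, WF_table]

theorem depth_tables (q l : ℕ) (f : ℕ → ℕ → ℕ → ℕ) (r : ℕ) (ar rel : ℕ → ℕ) :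
    (tables q l f r ar rel).depth = 0 := by simp [tables, depth, depth_table]

theorem writesReg_tables (q l : ℕ) (f : ℕ → ℕ → ℕ → ℕ) (r : ℕ) (ar rel : ℕ → ℕ) (y : ℕ) :
    (tables q l f r ar rel).writesReg y = false := by simp [tables, writesReg, writesReg_table]

theorem writesArr_tables_zero (q l : ℕ) (f : ℕ → ℕ → ℕ → ℕ) (r : ℕ) (ar rel : ℕ → ℕ) :
    (tables q l f r ar rel).writesArr 0 = false := by simp [tables, writesArr, writesArr_table]

theorem run_tables (q l : ℕ) (f : ℕ → ℕ → ℕ → ℕ) (r : ℕ) (ar rel : ℕ → ℕ) (s : State) :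
    Tables q l f ((tables q l f r ar rel).run s).arr ∧
    (∀ x < r, ((tables q l f r ar rel).run s).arr aArity x = ar x) ∧
    ∀ x < r * q ^ (l + 1), ((tables q l f r ar rel).run s).arr aRel x = rel x := by
  have hfst : ∀ Q a b c, a < Q → b < Q → c < Q → idx Q a b c / Q / Q = a ∧
      idx Q a b c / Q % Q = b ∧ idx Q a b c % Q = c := by
    intro Q a b c ha hb hc
    have h1 : idx Q a b c / Q = a * Q + b := by
      rw [idx, mul_comm, Nat.mul_add_div (by omega), Nat.div_eq_of_lt hc, add_zero]
    have h2 : idx Q a b c % Q = c := by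
      rw [idx, mul_comm, Nat.mul_add_mod, Nat.mod_eq_of_lt hc]
    have h3 : (a * Q + b) / Q = a := by
      rw [mul_comm, Nat.mul_add_div (by omega), Nat.div_eq_of_lt hb, add_zero]
    have h4 : (a * Q + b) % Q = b := by
      rw [mul_comm, Nat.mul_add_mod, Nat.mod_eq_of_lt hb]
    exact ⟨by rw [h1, h3], by rw [h1, h4], h2⟩
  have hlt : ∀ {Q a b c}, a < Q → b < Q → c < Q → idx Q a b c < Q * Q * Q := idx_lt
  simp only [tables, run]
  refine ⟨⟨fun v hv => ?_, fun u v w hu hv hw => ?_, fun u v w hu hv hw => ?_,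
    fun u v w hu hv hw => ?_, fun u v w hu hv hw => ?_, fun u v w hu hv hw => ?_,
    fun a b ha hb => ?_, fun v hv => ?_, fun v hv => ?_⟩, fun x hx => ?_, fun x hx => ?_⟩
  all_goals repeat rw [run_arr (writesArr_table (by decide) _ _)]
  · rw [run_table _ _ _ _ _ hv, id]
  · rw [run_table _ _ _ _ _ (hlt hu hv hw), (hfst _ _ _ _ hu hv hw).1]
  · rw [run_table _ _ _ _ _ (hlt hu hv hw), (hfst _ _ _ _ hu hv hw).2.1]
  · rw [run_table _ _ _ _ _ (hlt hu hv hw), (hfst _ _ _ _ hu hv hw).2.2]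
  · obtain ⟨e1, e2, e3⟩ := hfst _ _ _ _ hu hv hw
    rw [run_table _ _ _ _ _ (hlt hu hv hw), e1, e2, e3]
  · obtain ⟨e1, e2, e3⟩ := hfst _ _ _ _ hu hv hw
    rw [run_table _ _ _ _ _ (hlt hu hv hw), e1, e2, e3]
  · have h3 : (a * q + b) / q = a := by
      rw [mul_comm, Nat.mul_add_div (by omega), Nat.div_eq_of_lt hb, add_zero]
    have h4 : (a * q + b) % q = b := by
      rw [mul_comm, Nat.mul_add_mod, Nat.mod_eq_of_lt hb]
    rw [run_table _ _ _ _ _ (by nlinarith), h3, h4]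
  · rw [run_table _ _ _ _ _ hv]
  · rw [run_table _ _ _ _ _ hv]
  · rw [run_table _ _ _ _ _ hx]
  · rw [run_table _ _ _ _ _ hx]

end Code
end RAM

namespace RAM

open Maltsev

/-! ### Projections of a represented relation -/

/-- `Has` is the characteristic function of the codes of the projection of `S` to the positions
listed in `p`, and for each of these codes `T` has a tuple of `S` with this code. -/
def Projects (n q l : ℕ) (S : (ℕ → ℕ) → Prop) (p Has T : ℕ → ℕ) : Prop :=
  ∀ v < q ^ (l + 1), (Has v ≠ 0 ↔ ∃ t, S t ∧ projCode q (l + 1) p t = v) ∧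
    (Has v ≠ 0 → S (row n T v) ∧ projCode q (l + 1) p (row n T v) = v)

namespace Code

variable {n q l j : ℕ} {f : ℕ → ℕ → ℕ → ℕ} {S : (ℕ → ℕ) → Prop} {s : State}

theorem run_closureInit (hn : s.reg 1 = n) :
    ∀ v < q ^ (l + 1), ((closureInit q l).run s).arr aHas v = 0 := by
  have := iter_inv (x := rX) (c := q ^ (l + 1)) (d := 0) (P := .put aHas (.reg rX) (.lit 0)) hn rfl
    (fun m A => ∀ x < m, A aHas x = 0) (fun x hx => absurd hx (Nat.not_lt_zero x)) ?_
  · rwa [zero_mul, add_zero] at this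
  · intro m hm u hum _ _ hinv x hx
    simp only [run, State.setCell_arr, Expr.eval, hum, true_and]
    split_ifs with h
    · rfl
    · exact hinv x (by omega)

theorem run_closureScan (hn : s.reg 1 = n) (hT : Tables q l f s.arr)
    (h0 : ∀ v < q ^ (l + 1), s.arr aHas v = 0)
    (hlt : ∀ x < q * q * n, s.arr aWorkG x ≠ 0 →
      projCode q (l + 1) (s.arr aPos) (row n (s.arr aWorkW) x) < q ^ (l + 1)) :
    (∀ v < q ^ (l + 1), ((closureScan q l).run s).arr aHas v ≠ 0 → ∃ x < q * q * n,
      s.arr aWorkG x ≠ 0 ∧ ((closureScan q l).run s).arr aSrc v = x ∧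
      projCode q (l + 1) (s.arr aPos) (row n (s.arr aWorkW) x) = v) ∧
    ∀ x < q * q * n, s.arr aWorkG x ≠ 0 → ((closureScan q l).run s).arr aHas
      (projCode q (l + 1) (s.arr aPos) (row n (s.arr aWorkW) x)) ≠ 0 := by
  set code := fun x => projCode q (l + 1) (s.arr aPos) (row n (s.arr aWorkW) x) with hcode
  unfold closureScan
  set P : Code := .ite (.get aWorkG (.reg rX))
    (.seq (.set rZ (.get aId (projE q aWorkW (.reg rX) (l + 1) 0)))
      (.seq (.put aHas (.reg rZ) (.lit 1)) (.put aSrc (.reg rZ) (.reg rX)))) .skip with hP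
  have := iter_inv (x := rX) (c := 0) (d := q * q) (P := P) hn rfl
    (fun m A => (∀ v < q ^ (l + 1), A aHas v ≠ 0 → ∃ x < q * q * n,
      s.arr aWorkG x ≠ 0 ∧ A aSrc v = x ∧ code x = v) ∧
      ∀ x < m, s.arr aWorkG x ≠ 0 → A aHas (code x) ≠ 0)
    ⟨fun v hv h => absurd (h0 v hv) h, fun x hx => absurd hx (Nat.not_lt_zero x)⟩ ?_
  · rwa [zero_add] at this
  rintro m hm u hum hu1 hu2 ⟨i1, i2⟩
  rw [zero_add] at hm
  have hG : (Expr.get aWorkG (.reg rX)).eval u = s.arr aWorkG m := by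
    simp only [Expr.eval, hum, hu2 aWorkG rfl]
  have hz : s.arr aWorkG m ≠ 0 →
      (Expr.get aId (projE q aWorkW (.reg rX) (l + 1) 0)).eval u = code m := by
    intro h
    have he : (projE q aWorkW (.reg rX) (l + 1) 0).eval u = code m := by
      rw [eval_projE, hu1 1 (by decide) rfl, hn, hu2 aWorkW rfl, hu2 aPos rfl]
      simp only [Expr.eval, hum, zero_add]
      rfl
    simp only [Expr.eval]
    rw [he, hu2 aId rfl]
    exact hT.ident _ (hlt m hm h)
  rw [hP, run, hG]
  split_ifs with h
  · refine ⟨i1, fun x hx hx' => i2 x ?_ hx'⟩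
    rcases Nat.lt_succ_iff_lt_or_eq.mp hx with hx | rfl
    · exact hx
    · exact absurd h hx'
  · have hH : ∀ v, ((seq (.set rZ (.get aId (projE q aWorkW (.reg rX) (l + 1) 0)))
        (.seq (.put aHas (.reg rZ) (.lit 1)) (.put aSrc (.reg rZ) (.reg rX)))).run u).arr aHas v =
        if v = code m then 1 else u.arr aHas v := by
      intro v
      simp only [run, hz h]
      simp [State.setCell_arr, Expr.eval]
    have hSrc : ∀ v, ((seq (.set rZ (.get aId (projE q aWorkW (.reg rX) (l + 1) 0)))
        (.seq (.put aHas (.reg rZ) (.lit 1)) (.put aSrc (.reg rZ) (.reg rX)))).run u).arr aSrc v =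
        if v = code m then m else u.arr aSrc v := by
      intro v
      simp only [run, hz h]
      simp [State.setCell_arr, Expr.eval, hum]
    refine ⟨fun v hv hv' => ?_, fun x hx hx' => ?_⟩
    · rw [hH] at hv'
      rw [hSrc]
      by_cases hvm : v = code m
      · exact ⟨m, hm, h, by rw [if_pos hvm], hvm.symm⟩
      · rw [if_neg hvm] at hv' ⊢
        exact i1 v hv hv'
    · rw [hH]
      split_ifs with hc
      · exact one_ne_zero
      · rcases Nat.lt_succ_iff_lt_or_eq.mp hx with hx | rfl
        · exact i2 x hx hx'
        · exact absurd rfl hc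

theorem run_closureCopy (hn : s.reg 1 = n) :
    ∀ v < q ^ (l + 1), s.arr aHas v ≠ 0 → ∀ k < n,
      row n (((closureCopy q l).run s).arr aTup) v k = row n (s.arr aWorkW) (s.arr aSrc v) k := by
  unfold closureCopy
  set P : Code := .ite (.get aHas (.reg rX))
    (copyRow aTup (.reg rX) aWorkW (.get aSrc (.reg rX))) .skip with hP
  have := iter_inv (x := rX) (c := q ^ (l + 1)) (d := 0) (P := P) hn rfl
    (fun m A => ∀ v < m, s.arr aHas v ≠ 0 → ∀ k < n,
      row n (A aTup) v k = row n (s.arr aWorkW) (s.arr aSrc v) k)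
    (fun x hx => absurd hx (Nat.not_lt_zero x)) ?_
  · rwa [zero_mul, add_zero] at this
  intro m hm u hum hu1 hu2 hinv v hv hHv k hk
  have hG : (Expr.get aHas (.reg rX)).eval u = s.arr aHas m := by
    simp only [Expr.eval, hum, hu2 aHas rfl]
  rw [hP, run, hG]
  split_ifs with h
  · rcases Nat.lt_succ_iff_lt_or_eq.mp hv with hv | rfl
    · exact hinv v hv hHv k hk
    · exact absurd h hHv
  · rw [run_copyRow (n := n) (R := m) (Q := s.arr aSrc m) (by rw [hu1 1 (by decide) rfl, hn])
      (by decide) (fun t ht _ => by simp only [Expr.eval]; rw [ht rX (by decide), hum])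
      (fun t ht ht' => by
        simp only [Expr.eval]; rw [ht rX (by decide), hum, ht' aSrc (by decide), hu2 aSrc rfl])
      v k hk, hu2 aWorkW rfl]
    split_ifs with hvm
    · rw [hvm]
    · exact hinv v (by omega) hHv k hk

/-- One step of the closure either does nothing, since there is nothing to do for the triple of
codes, or adds the code that the operation yields, together with a tuple. -/
theorem run_closureStep (hn : s.reg 1 = n) (hT : Tables q l f s.arr) {a b c : ℕ}
    (ha : a < q ^ (l + 1)) (hb : b < q ^ (l + 1)) (hc : c < q ^ (l + 1))
    (hy : s.reg rY = idx (q ^ (l + 1)) a b c)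
    (hlt : ∀ v < q ^ (l + 1), s.arr aHas v ≠ 0 → ∀ k < n, row n (s.arr aTup) v k < q) :
    ((s.arr aHas a ≠ 0 → s.arr aHas b ≠ 0 → s.arr aHas c ≠ 0 →
        s.arr aHas (codeOp q (l + 1) f a b c) ≠ 0) ∧
      ((closureStep q).run s).arr aHas = s.arr aHas ∧
      ((closureStep q).run s).arr aTup = s.arr aTup) ∨
    ((s.arr aHas a ≠ 0 ∧ s.arr aHas b ≠ 0 ∧ s.arr aHas c ≠ 0) ∧
      (∀ v, ((closureStep q).run s).arr aHas v =
        if v = codeOp q (l + 1) f a b c then 1 else s.arr aHas v) ∧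
      ∀ v, ∀ k < n, row n (((closureStep q).run s).arr aTup) v k =
        if v = codeOp q (l + 1) f a b c then
          f (row n (s.arr aTup) a k) (row n (s.arr aTup) b k) (row n (s.arr aTup) c k)
        else row n (s.arr aTup) v k) := by
  have e1 : (Expr.get aHas (.get aFst (.reg rY))).eval s = s.arr aHas a := by
    simp only [Expr.eval, hy, hT.fst a b c ha hb hc]
  have e2 : (Expr.get aHas (.get aSnd (.reg rY))).eval s = s.arr aHas b := by
    simp only [Expr.eval, hy, hT.snd a b c ha hb hc]
  have e3 : (Expr.get aHas (.get aTrd (.reg rY))).eval s = s.arr aHas c := by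
    simp only [Expr.eval, hy, hT.trd a b c ha hb hc]
  have e4 : (Expr.get aCodeOp (.reg rY)).eval s = codeOp q (l + 1) f a b c := by
    simp only [Expr.eval, hy, hT.codeOp a b c ha hb hc]
  rw [closureStep]
  generalize codeOp q (l + 1) f a b c = z at *
  simp only [run, e1, e2, e3, e4]
  by_cases h1 : s.arr aHas a = 0
  · rw [if_pos h1]
    exact Or.inl ⟨fun h => absurd h1 h, rfl, rfl⟩
  rw [if_neg h1]
  by_cases h2 : s.arr aHas b = 0
  · rw [if_pos h2]
    exact Or.inl ⟨fun _ h => absurd h2 h, rfl, rfl⟩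
  rw [if_neg h2]
  by_cases h3 : s.arr aHas c = 0
  · rw [if_pos h3]
    exact Or.inl ⟨fun _ _ h => absurd h3 h, rfl, rfl⟩
  rw [if_neg h3]
  by_cases h4 : s.arr aHas z = 0
  · have e5 : (Expr.get aHas (.reg rZ)).eval (s.setReg rZ z) = 0 := by
      simpa [Expr.eval] using h4
    rw [if_pos e5]
    right
    refine ⟨⟨h1, h2, h3⟩, fun v => ?_, fun v k hk => ?_⟩
    · rw [run_arr rfl]
      simp [State.setCell_arr, Expr.eval]
    · have harr : ∀ x, x ≠ aHas → ((s.setReg rZ z).setCell aHas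
          ((Expr.reg rZ).eval (s.setReg rZ z)) ((Expr.lit 1).eval (s.setReg rZ z))).arr x =
          s.arr x := fun x hx => State.setCell_arr_ne _ hx
      have hy' : rY ≠ rZ := by decide
      rw [run_opRow (l := l) (f := f) (n := n) (R := z) (R₁ := a) (R₂ := b) (R₃ := c) (by simp [hn])
        (hT.of_keeps (.put aHas (.lit 0) (.lit 0)) rfl fun x hx => harr x (by
          simpa [writesArr] using hx)) (by decide) ?_
        (fun _ h => h1 (h ▸ h4)) (fun _ h => h2 (h ▸ h4)) (fun _ h => h3 (h ▸ h4)) ?_ ?_ ?_ v k hk,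
        harr aTup (by decide)]
      · intro t ht ht'
        simp only [Expr.eval]
        rw [ht rZ (by decide), ht rY (by decide), ht' aFst (by decide), ht' aSnd (by decide),
          ht' aTrd (by decide), harr _ (by decide), harr _ (by decide), harr _ (by decide)]
        simp only [State.setCell_reg, State.setReg_reg, if_neg hy', hy]
        exact ⟨rfl, hT.fst a b c ha hb hc, hT.snd a b c ha hb hc, hT.trd a b c ha hb hc⟩
      · rw [harr _ (by decide)]; exact hlt a ha h1
      · rw [harr _ (by decide)]; exact hlt b hb h2
      · rw [harr _ (by decide)]; exact hlt c hc h3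
  · have e5 : (Expr.get aHas (.reg rZ)).eval (s.setReg rZ z) ≠ 0 := by
      simpa [Expr.eval] using h4
    rw [if_neg e5]
    exact Or.inl ⟨fun _ _ _ => h4, rfl, rfl⟩

/-- The set of codes `X` is closed under the operation. -/
def CodesClosed (q l : ℕ) (f : ℕ → ℕ → ℕ → ℕ) (X : ℕ → Prop) : Prop :=
  ∀ a b c, a < q ^ (l + 1) → b < q ^ (l + 1) → c < q ^ (l + 1) → X a → X b → X c →
    X (codeOp q (l + 1) f a b c)

theorem codeOp_lt (hf : IsOp q f) {a b c : ℕ} (ha : a < q ^ (l + 1)) :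
    codeOp q (l + 1) f a b c < q ^ (l + 1) := by
  have hq : 0 < q := by
    rcases Nat.eq_zero_or_pos q with rfl | h
    · simp at ha
    · exact h
  exact enc_lt fun i _ =>
    hf.lt _ _ _ (Nat.mod_lt _ hq) (Nat.mod_lt _ hq) (Nat.mod_lt _ hq)

/-- Every code that is marked has a tuple of `S`. -/
def Sound (n q l : ℕ) (S : (ℕ → ℕ) → Prop) (p : ℕ → ℕ) (A : ℕ → ℕ → ℕ) : Prop :=
  ∀ v < q ^ (l + 1), A aHas v ≠ 0 →
    S (row n (A aTup) v) ∧ projCode q (l + 1) p (row n (A aTup) v) = v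

/-- A round keeps every marked code justified by a tuple, marks no code outside of a closed set that
contains the codes marked before, and marks everything that the operation yields at once. -/
theorem run_closureRound (hS : IsRel n q f S) (hn : s.reg 1 = n)
    (hT : Tables q l f s.arr) {p : ℕ → ℕ} (hp : ∀ i < l + 1, p i < n)
    (hs : Sound n q l S p s.arr) :
    Sound n q l S p ((closureRound q l).run s).arr ∧
    (∀ v, s.arr aHas v ≠ 0 → ((closureRound q l).run s).arr aHas v ≠ 0) ∧
    (∀ X, CodesClosed q l f X → (∀ v < q ^ (l + 1), s.arr aHas v ≠ 0 → X v) →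
      ∀ v < q ^ (l + 1), ((closureRound q l).run s).arr aHas v ≠ 0 → X v) ∧
    ∀ a b c, a < q ^ (l + 1) → b < q ^ (l + 1) → c < q ^ (l + 1) → s.arr aHas a ≠ 0 →
      s.arr aHas b ≠ 0 → s.arr aHas c ≠ 0 →
      ((closureRound q l).run s).arr aHas (codeOp q (l + 1) f a b c) ≠ 0 := by
  have := iter_inv (x := rY) (c := q ^ (l + 1) * q ^ (l + 1) * q ^ (l + 1)) (d := 0)
    (P := closureStep q) hn rfl
    (fun m A => Sound n q l S p A ∧ (∀ v, s.arr aHas v ≠ 0 → A aHas v ≠ 0) ∧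
    (∀ X, CodesClosed q l f X → (∀ v < q ^ (l + 1), s.arr aHas v ≠ 0 → X v) →
      ∀ v < q ^ (l + 1), A aHas v ≠ 0 → X v) ∧
    ∀ a b c, a < q ^ (l + 1) → b < q ^ (l + 1) → c < q ^ (l + 1) → s.arr aHas a ≠ 0 →
      s.arr aHas b ≠ 0 → s.arr aHas c ≠ 0 → idx (q ^ (l + 1)) a b c < m →
      A aHas (codeOp q (l + 1) f a b c) ≠ 0)
    ⟨hs, fun v h => h, fun X _ h => h, fun a b c _ _ _ _ _ _ h => absurd h (Nat.not_lt_zero _)⟩ ?_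
  · rw [zero_mul, add_zero] at this
    obtain ⟨h1, h2, h3, h4⟩ := this
    exact ⟨h1, h2, h3, fun a b c ha hb hc h h' h'' => h4 a b c ha hb hc h h' h'' (idx_lt ha hb hc)⟩
  rintro m hm u hum hu1 hu2 ⟨i1, i2, i3, i4⟩
  rw [zero_mul, add_zero] at hm
  obtain ⟨a, ha, b, hb, c, hc, rfl⟩ := exists_idx hm
  have hle : ∀ {a' b' c'}, a' < q ^ (l + 1) → b' < q ^ (l + 1) → c' < q ^ (l + 1) →
      idx (q ^ (l + 1)) a' b' c' < idx (q ^ (l + 1)) a b c + 1 →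
      idx (q ^ (l + 1)) a' b' c' < idx (q ^ (l + 1)) a b c ∨ a' = a ∧ b' = b ∧ c' = c := by
    intro a' b' c' ha' hb' hc' h
    rcases Nat.lt_succ_iff_lt_or_eq.mp h with h | h
    · exact Or.inl h
    · exact Or.inr ((idx_inj hb' hc' hb hc).1 h)
  rcases run_closureStep (n := n) (by rw [hu1 1 (by decide) rfl, hn])
    (hT.of_keeps (closureStep q) rfl hu2) ha hb hc hum
    (fun v hv h => hS.lt _ (i1 v hv h).1) with ⟨h1, h2, h3⟩ | ⟨⟨g1, g2, g3⟩, h2, h3⟩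
  · refine ⟨fun v hv => ?_, ?_, ?_, ?_⟩
    · rw [h2, h3]; exact i1 v hv
    · rw [h2]; exact i2
    · rw [h2]; exact i3
    · rw [h2]
      intro a' b' c' ha' hb' hc' k1 k2 k3 h
      rcases hle ha' hb' hc' h with h | ⟨rfl, rfl, rfl⟩
      · exact i4 a' b' c' ha' hb' hc' k1 k2 k3 h
      · exact h1 (i2 _ k1) (i2 _ k2) (i2 _ k3)
  · refine ⟨fun v hv hv' => ?_, fun v hv => ?_, fun X hX hX' v hv hv' => ?_,
      fun a' b' c' ha' hb' hc' k1 k2 k3 h => ?_⟩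
    · rw [h2] at hv'
      have hrow := h3 v
      by_cases hz : v = codeOp q (l + 1) f a b c
      · simp only [if_pos hz] at hrow
        obtain ⟨a1, a2⟩ := i1 a ha g1
        obtain ⟨b1, b2⟩ := i1 b hb g2
        obtain ⟨c1, c2⟩ := i1 c hc g3
        have hrow' := fun k hk => (hrow k hk).symm
        refine ⟨hS.ext _ _ hrow' (hS.closed _ _ _ a1 b1 c1), ?_⟩
        rw [projCode_ext hp hrow, hS.projCode_op hp a1 b1 c1, a2, b2, c2, hz]
      · simp only [if_neg hz] at hrow hv'
        have hrow' := fun k hk => (hrow k hk).symm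
        obtain ⟨a1, a2⟩ := i1 v hv hv'
        exact ⟨hS.ext _ _ hrow' a1, by rw [projCode_ext hp hrow, a2]⟩
    · rw [h2]
      split_ifs
      exacts [one_ne_zero, i2 v hv]
    · rw [h2] at hv'
      split_ifs at hv' with hz
      · rw [hz]
        exact hX a b c ha hb hc (i3 X hX hX' a ha g1) (i3 X hX hX' b hb g2) (i3 X hX hX' c hc g3)
      · exact i3 X hX hX' v hv hv'
    · rw [h2]
      split_ifs with hz
      · exact one_ne_zero
      · rcases hle ha' hb' hc' h with h | ⟨rfl, rfl, rfl⟩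
        · exact i4 a' b' c' ha' hb' hc' k1 k2 k3 h
        · exact absurd rfl hz

/-- After as many rounds as there are codes, the set of marked codes is closed. -/
theorem run_closureRounds (hf : IsOp q f) (hS : IsRel n q f S) (hn : s.reg 1 = n)
    (hT : Tables q l f s.arr) {p : ℕ → ℕ} (hp : ∀ i < l + 1, p i < n)
    (hs : Sound n q l S p s.arr) :
    Sound n q l S p ((closureRounds q l).run s).arr ∧
    (∀ v, s.arr aHas v ≠ 0 → ((closureRounds q l).run s).arr aHas v ≠ 0) ∧
    CodesClosed q l f fun v => ((closureRounds q l).run s).arr aHas v ≠ 0 := by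
  classical
  set marked : (ℕ → ℕ → ℕ) → Finset ℕ := fun A =>
    (Finset.range (q ^ (l + 1))).filter fun v => A aHas v ≠ 0 with hmarked
  -- every round that does not start with a closed set marks a new code
  have := iter_inv (x := rR) (c := q ^ (l + 1) + 1) (d := 0)
    (P := closureRound q l) hn rfl
    (fun m A => Sound n q l S p A ∧ (∀ v, s.arr aHas v ≠ 0 → A aHas v ≠ 0) ∧
      ((CodesClosed q l f fun v => A aHas v ≠ 0) ∨ m ≤ (marked A).card))
    ⟨hs, fun v h => h, Or.inr (Nat.zero_le _)⟩ ?_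
  · rw [zero_mul, add_zero] at this
    obtain ⟨h1, h2, h3⟩ := this
    refine ⟨h1, h2, h3.resolve_right fun h => ?_⟩
    have h' := Finset.card_filter_le (Finset.range (q ^ (l + 1))) fun v =>
      ((closureRounds q l).run s).arr aHas v ≠ 0
    rw [Finset.card_range] at h'
    exact absurd (h.trans h') (by omega)
  rintro m hm u hum hu1 hu2 ⟨i1, i2, i3⟩
  obtain ⟨h1, h2, h3, h4⟩ := run_closureRound (n := n) hS (by rw [hu1 1 (by decide) rfl, hn])
    (hT.of_keeps (closureRound q l) rfl hu2) hp i1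
  refine ⟨h1, fun v hv => h2 v (i2 v hv), ?_⟩
  by_cases hcl : CodesClosed q l f fun v => u.arr aHas v ≠ 0
  · left
    intro a b c ha hb hc ha' hb' hc'
    have h5 := h3 _ hcl fun v _ h => h
    exact h2 _ (hcl a b c ha hb hc (h5 a ha ha') (h5 b hb hb') (h5 c hc hc'))
  · right
    have h6 := i3.resolve_left hcl
    refine Nat.lt_of_le_of_lt h6 (Finset.card_lt_card
      ((Finset.ssubset_iff_of_subset fun v hv => ?_).2 ?_))
    · rw [hmarked, Finset.mem_filter] at hv ⊢
      exact ⟨hv.1, h2 v hv.2⟩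
    · unfold CodesClosed at hcl
      push Not at hcl
      obtain ⟨a, b, c, ha, hb, hc, ha', hb', hc', hz⟩ := hcl
      refine ⟨codeOp q (l + 1) f a b c, ?_, ?_⟩
      · rw [hmarked, Finset.mem_filter, Finset.mem_range]
        exact ⟨codeOp_lt hf ha, h4 a b c ha hb hc ha' hb' hc'⟩
      · rw [hmarked, Finset.mem_filter]
        exact fun h => h.2 hz

/-- The codes of the projection are closed under the operation, and the witnesses generate the
relation; so the closure of the codes of the witnesses consists of all codes of the projection. -/
theorem run_closure (hf : IsOp q f) (hS : IsRel n q f S) (hn : s.reg 1 = n)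
    (hT : Tables q l f s.arr) (hR : Represents n q j (s.arr aWorkG) (s.arr aWorkW) S)
    (hj : j < n) (hp : ∀ i < l + 1, s.arr aPos i < n) :
    Projects n q l S (s.arr aPos) (((closure q l).run s).arr aHas)
      (((closure q l).run s).arr aTup) := by
  have hwit : ∀ x < q * q * n, s.arr aWorkG x ≠ 0 → S (row n (s.arr aWorkW) x) := by
    intro x hx hG
    obtain ⟨i, hi, a, ha, b, hb, rfl⟩ := exists_idx hx
    exact hR.mem i hi a ha b hb hG
  simp only [closure, run]
  set s1 := (closureInit q l).run s with hs1
  set s2 := (closureScan q l).run s1 with hs2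
  set s3 := (closureCopy q l).run s2 with hs3
  have n1 : s1.reg 1 = n := by rw [hs1, run_reg rfl, hn]
  have n2 : s2.reg 1 = n := by rw [hs2, run_reg rfl, n1]
  have n3 : s3.reg 1 = n := by rw [hs3, run_reg rfl, n2]
  have t1 : Tables q l f s1.arr := hT.of_keeps (closureInit q l) rfl fun a h => run_arr h s
  have t2 : Tables q l f s2.arr := t1.of_keeps (closureScan q l) rfl fun a h => run_arr h s1
  have t3 : Tables q l f s3.arr := t2.of_keeps (closureCopy q l) rfl fun a h => run_arr h s2
  have g1 : s1.arr aWorkG = s.arr aWorkG := run_arr rfl s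
  have w1 : s1.arr aWorkW = s.arr aWorkW := run_arr rfl s
  have p1 : s1.arr aPos = s.arr aPos := run_arr rfl s
  have w2 : s2.arr aWorkW = s.arr aWorkW := (run_arr rfl s1).trans w1
  obtain ⟨c1, c2⟩ := run_closureScan n1 t1 (run_closureInit hn) (fun x hx h => by
    rw [g1] at h; rw [p1, w1]; exact hS.projCode_lt hp (hwit x hx h))
  rw [← hs2, g1, p1, w1] at c1 c2
  have h3 : s3.arr aHas = s2.arr aHas := run_arr rfl s2
  have hsound : Sound n q l S (s.arr aPos) s3.arr := by
    intro v hv hv'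
    rw [h3] at hv'
    have hrow := run_closureCopy n2 v hv hv'
    obtain ⟨x, hx, hG, hsrc, hcode⟩ := c1 v hv hv'
    rw [hsrc, w2, ← hs3] at hrow
    exact ⟨hS.ext _ _ (fun k hk => (hrow k hk).symm) (hwit x hx hG),
      by rw [projCode_ext hp hrow, hcode]⟩
  obtain ⟨d1, d2, d3⟩ := run_closureRounds hf hS n3 t3 hp hsound
  set A := ((closureRounds q l).run s3).arr with hA
  have hall : ∀ t, S t → A aHas (projCode q (l + 1) (s.arr aPos) t) ≠ 0 := by
    refine hR.generates hf hS hj (X := fun t => A aHas (projCode q (l + 1) (s.arr aPos) t) ≠ 0)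
      ⟨fun t t' h ht => ⟨hS.ext _ _ h ht.1, ?_⟩, fun t ht => hS.lt t ht.1,
        fun x y z hx hy hz => ⟨hS.closed _ _ _ hx.1 hy.1 hz.1, ?_⟩⟩ ?_
    · rw [← projCode_ext hp h]; exact ht.2
    · rw [hS.projCode_op hp hx.1 hy.1 hz.1]
      exact d3 _ _ _ (hS.projCode_lt hp hx.1) (hS.projCode_lt hp hy.1) (hS.projCode_lt hp hz.1)
        hx.2 hy.2 hz.2
    · intro i hi a ha b hb hG
      refine d2 _ ?_
      rw [h3]
      exact c2 _ (idx_lt hi ha hb) hG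
  refine fun v hv => ⟨⟨fun h => ⟨_, d1 v hv h⟩, ?_⟩, d1 v hv⟩
  rintro ⟨t, ht, rfl⟩
  exact hall t ht

end Code
end RAM

namespace RAM

open Maltsev

namespace Code

variable {n q l j : ℕ} {f : ℕ → ℕ → ℕ → ℕ} {S : (ℕ → ℕ) → Prop} {s : State}

/-! ### Fixing values -/

/-- The effect of a loop that fills an array. -/
theorem run_fill {x c d a : ℕ} {e : Expr} {val : ℕ → ℕ} (hn : s.reg 1 = n)
    (he : ∀ k < c + d * n, ∀ u : State, u.reg x = k → (∀ y, y ≠ x → u.reg y = s.reg y) →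
      (∀ b, b ≠ a → u.arr b = s.arr b) → e.eval u = val k) :
    ∀ k < c + d * n, ((iter x c d (.put a (.reg x) e)).run s).arr a k = val k := by
  refine iter_inv (x := x) (c := c) (d := d) (P := .put a (.reg x) e) hn rfl
    (fun m A => ∀ x < m, A a x = val x) (fun x hx => absurd hx (Nat.not_lt_zero x)) ?_
  intro m hm u hum h1 h2 hinv y hy
  have he' := he m hm u hum (fun y hy => h1 y hy rfl) (fun b hb => h2 b (by simpa [writesArr]))
  simp only [run, State.setCell_arr, he', true_and]
  simp only [Expr.eval, hum]
  split_ifs with h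
  · rw [h]
  · exact hinv y (by omega)

/-- The tables `G'` and `W'` arise from `G` and `W` when the entries for the triples that satisfy
`cond` are set, with the rows `val`. -/
def Filled (n q : ℕ) (G W G' W' : ℕ → ℕ) (cond : ℕ → ℕ → ℕ → Prop)
    (val : ℕ → ℕ → ℕ → ℕ → ℕ) : Prop :=
  ∀ k c d, c < q → d < q →
    (cond k c d → G' (idx q k c d) ≠ 0 ∧ ∀ h < n, row n W' (idx q k c d) h = val k c d h) ∧
    (¬ cond k c d → G' (idx q k c d) = G (idx q k c d) ∧
      ∀ h < n, row n W' (idx q k c d) h = row n W (idx q k c d) h)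

/-- The code of a tuple that is constant up to its last entry. -/
def pairCode (q l a b : ℕ) : ℕ := enc q (l + 1) fun i => if i < l then a else b

theorem pairCode_lt {a b : ℕ} (ha : a < q) (hb : b < q) : pairCode q l a b < q ^ (l + 1) :=
  enc_lt fun i _ => by split_ifs <;> assumption

/-- A new witness at position `k`. -/
def fixVal (n q l : ℕ) (f : ℕ → ℕ → ℕ → ℕ) (T W : ℕ → ℕ) (V k c d h : ℕ) : ℕ :=
  f (row n T (pairCode q l V c) h) (row n W (idx q k c c) h) (row n W (idx q k c d) h)

/-- The code of the tuple with entries `aFix j, …, aFix j, c` decides whether `c` is a possible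
value at `k` once the value at `j` is fixed. -/
theorem run_fixValue (hn : s.reg 1 = n) (hT : Tables q l f s.arr) {k c : ℕ} (hk : s.reg rK = k)
    (hc : s.reg rC = c) (hj : s.reg rJ = j) (hV : s.arr aFix j < q) (hcq : c < q)
    (htup : ∀ v < q ^ (l + 1), s.arr aHas v ≠ 0 → ∀ h < n, row n (s.arr aTup) v h < q)
    (hwit : ∀ d < q, s.arr aWorkG (idx q k c d) ≠ 0 → ∀ h < n,
      row n (s.arr aWorkW) (idx q k c c) h < q ∧ row n (s.arr aWorkW) (idx q k c d) h < q) :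
    Filled n q (s.arr aTmpG) (s.arr aTmpW) (((fixValue q).run s).arr aTmpG)
      (((fixValue q).run s).arr aTmpW)
      (fun k' c' d => k' = k ∧ c' = c ∧ s.arr aHas (pairCode q l (s.arr aFix j) c) ≠ 0 ∧
        s.arr aWorkG (idx q k c d) ≠ 0)
      (fixVal n q l f (s.arr aTup) (s.arr aWorkW) (s.arr aFix j)) := by
  have hv : (Expr.get aPair (.add (.mul (.get aFix (.reg rJ)) (.lit q)) (.reg rC))).eval s =
      pairCode q l (s.arr aFix j) c := by
    simp only [Expr.eval, hj, hc]
    exact hT.pair _ _ hV hcq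
  have hvlt := pairCode_lt (l := l) hV hcq
  rw [fixValue, run, run, hv]
  set V := s.arr aFix j with hVdef
  set z := pairCode q l V c with hz
  have hH : (Expr.get aHas (.reg rV)).eval (s.setReg rV z) = s.arr aHas z := by
    simp [Expr.eval]
  rw [run, hH]
  by_cases h0 : s.arr aHas z = 0
  · rw [if_pos h0]
    exact fun k' c' d hc' hd => ⟨fun h => absurd h0 h.2.2.1, fun _ => ⟨rfl, fun _ _ => rfl⟩⟩
  rw [if_neg h0]
  set P : Code := .ite (.get aWorkG (idxE q (.reg rK) (.reg rC) (.reg rD)))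
        (.seq (.put aTmpG (idxE q (.reg rK) (.reg rC) (.reg rD)) (.lit 1))
          (opRow q aTmpW (idxE q (.reg rK) (.reg rC) (.reg rD)) aTup (.reg rV)
            aWorkW (idxE q (.reg rK) (.reg rC) (.reg rC))
            aWorkW (idxE q (.reg rK) (.reg rC) (.reg rD)))) .skip with hP
  have := iter_inv (x := rD) (c := q) (d := 0) (P := P) (s := s.setReg rV z) (n := n)
    (by simp [hn]) rfl
    (fun m A => Filled n q (s.arr aTmpG) (s.arr aTmpW) (A aTmpG) (A aTmpW)
      (fun k' c' d => k' = k ∧ c' = c ∧ d < m ∧ s.arr aWorkG (idx q k c d) ≠ 0)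
      (fixVal n q l f (s.arr aTup) (s.arr aWorkW) V))
    (fun k' c' d hc' hd => ⟨fun h => absurd h.2.2.1 (Nat.not_lt_zero d),
      fun _ => ⟨rfl, fun _ _ => rfl⟩⟩) ?_
  · rw [zero_mul, add_zero] at this
    intro k' c' d hc' hd
    obtain ⟨h1, h2⟩ := this k' c' d hc' hd
    exact ⟨fun h => h1 ⟨h.1, h.2.1, hd, h.2.2.2⟩, fun h => h2 fun h' => h
      ⟨h'.1, h'.2.1, h0, h'.2.2.2⟩⟩
  intro m hm u hum hu1 hu2 hinv k' c' d' hc' hd'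
  rw [zero_mul, add_zero] at hm
  have uK : u.reg rK = k := by rw [hu1 rK (by decide) rfl]; simpa using hk
  have uC : u.reg rC = c := by rw [hu1 rC (by decide) rfl]; simpa using hc
  have uV : u.reg rV = z := by rw [hu1 rV (by decide) rfl]; simp
  have u1 : u.reg 1 = n := by rw [hu1 1 (by decide) rfl]; simpa using hn
  have hG : (Expr.get aWorkG (idxE q (.reg rK) (.reg rC) (.reg rD))).eval u =
      s.arr aWorkG (idx q k c m) := by
    simp only [Expr.eval, eval_idxE, uK, uC, hum, hu2 aWorkG rfl, State.setReg_arr]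
  obtain ⟨h1, h2⟩ := hinv k' c' d' hc' hd'
  rw [hP, run, hG]
  split_ifs with hg
  · refine ⟨fun h => h1 ⟨h.1, h.2.1, ?_, h.2.2.2⟩, fun h => h2 fun h' => h
      ⟨h'.1, h'.2.1, by omega, h'.2.2.2⟩⟩
    rcases Nat.lt_succ_iff_lt_or_eq.mp h.2.2.1 with h' | rfl
    · exact h'
    · exact absurd hg h.2.2.2
  · rw [run, run]
    set w := u.setCell aTmpG ((idxE q (.reg rK) (.reg rC) (.reg rD)).eval u)
      ((Expr.lit 1).eval u) with hw
    have warr : ∀ x, x ≠ aTmpG → w.arr x = u.arr x := fun x hx => State.setCell_arr_ne u hx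
    have e1 : w.arr aTup = s.arr aTup := by rw [warr _ (by decide), hu2 aTup rfl]; rfl
    have e2 : w.arr aWorkW = s.arr aWorkW := by rw [warr _ (by decide), hu2 aWorkW rfl]; rfl
    have hop := run_opRow (q := q) (l := l) (f := f) (dst := aTmpW) (a₁ := aTup) (a₂ := aWorkW)
      (a₃ := aWorkW) (r := idxE q (.reg rK) (.reg rC) (.reg rD)) (r₁ := .reg rV)
      (r₂ := idxE q (.reg rK) (.reg rC) (.reg rC)) (r₃ := idxE q (.reg rK) (.reg rC) (.reg rD))
      (s := w) (n := n) (R := idx q k c m) (R₁ := z) (R₂ := idx q k c c) (R₃ := idx q k c m)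
      u1 (hT.of_keeps P rfl fun a ha => by
        rw [warr a (by rintro rfl; exact absurd ha (by simp [hP, writesArr])), hu2 a ha]; rfl)
      (by decide) (fun t ht _ => by
        simp only [eval_idxE, Expr.eval]
        rw [ht rK (by decide), ht rC (by decide), ht rD (by decide), ht rV (by decide)]
        simp only [hw, State.setCell_reg, uK, uC, uV, hum, and_self])
      (fun h => absurd h (by decide)) (fun h => absurd h (by decide))
      (fun h => absurd h (by decide)) (by rw [e1]; exact htup z hvlt h0)
      (by rw [e2]; exact fun h hh => (hwit m hm hg h hh).1)
      (by rw [e2]; exact fun h hh => (hwit m hm hg h hh).2) (idx q k' c' d')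
    rw [e1, e2, warr aTmpW (by decide)] at hop
    have hGw : ∀ x, ((opRow q aTmpW (idxE q (.reg rK) (.reg rC) (.reg rD)) aTup (.reg rV)
        aWorkW (idxE q (.reg rK) (.reg rC) (.reg rC))
        aWorkW (idxE q (.reg rK) (.reg rC) (.reg rD))).run w).arr aTmpG x =
        if x = idx q k c m then 1 else u.arr aTmpG x := by
      intro x
      rw [run_arr rfl]
      simp only [hw, State.setCell_arr, eval_idxE, Expr.eval, uK, uC, hum, true_and]
    rw [hGw]
    by_cases hx : idx q k' c' d' = idx q k c m
    · simp only [if_pos hx] at hop ⊢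
      obtain ⟨rfl, rfl, rfl⟩ := (idx_inj hc' hd' hcq hm).1 hx
      exact ⟨fun _ => ⟨one_ne_zero, hop⟩, fun h => absurd ⟨rfl, rfl, Nat.lt_succ_self _, hg⟩ h⟩
    · simp only [if_neg hx] at hop ⊢
      refine ⟨fun h => ?_, fun h => ?_⟩
      · have := h1 ⟨h.1, h.2.1, ?_, h.2.2.2⟩
        · exact ⟨this.1, fun k hk => (hop k hk).trans (this.2 k hk)⟩
        · rcases Nat.lt_succ_iff_lt_or_eq.mp h.2.2.1 with h' | h'
          · exact h'
          · exact absurd (by rw [h.1, h.2.1, h']) hx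
      · have := h2 fun h' => h ⟨h'.1, h'.2.1, by omega, h'.2.2.2⟩
        exact ⟨this.1, fun k hk => (hop k hk).trans (this.2 k hk)⟩

/-- The pair of positions `j` and `k` is coded as the tuple of positions `j, …, j, k`. -/
theorem projCode_eq_pairCode (hS : IsRel n q f S) (hl : 0 < l) {p t : ℕ → ℕ} {j k V c : ℕ}
    (hp : ∀ i < l, p i = j) (hpl : p l = k) (hj : j < n) (hk : k < n) (hV : V < q) (hc : c < q)
    (ht : S t) : projCode q (l + 1) p t = pairCode q l V c ↔ t j = V ∧ t k = c := by
  constructor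
  · intro h
    have hlt : ∀ i < l + 1, t (p i) < q := by
      intro i hi
      refine hS.lt t ht _ ?_
      rcases Nat.lt_succ_iff_lt_or_eq.mp hi with hi | rfl
      · rw [hp i hi]; exact hj
      · rw [hpl]; exact hk
    have hd : ∀ i < l + 1, t (p i) = if i < l then V else c := by
      intro i hi
      have := congrArg (fun v => digit q v i) h
      simpa only [projCode, pairCode, digit_enc hlt hi,
        digit_enc (q := q) (g := fun i => if i < l then V else c)
          (fun i _ => by split_ifs <;> assumption) hi] using this
    have h0 := hd 0 (by omega)
    have h1 := hd l (by omega)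
    rw [hp 0 hl, if_pos hl] at h0
    rw [hpl, if_neg (lt_irrefl l)] at h1
    exact ⟨h0, h1⟩
  · rintro ⟨h1, h2⟩
    refine enc_congr fun i hi => ?_
    split_ifs with h
    · rw [hp i h, h1]
    · rw [show i = l by omega, hpl, h2]

/-- The effect of `fixLevel`: the tables under construction are filled at position `k` and remain
unchanged elsewhere. -/
theorem run_fixLevel (hf : IsOp q f) (hS : IsRel n q f S) (hl : 0 < l) (hn : s.reg 1 = n)
    (hT : Tables q l f s.arr) {k : ℕ} (hk : s.reg rK = k) (hj : s.reg rJ = j) (hjk : j < k)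
    (hkn : k < n) (hV : s.arr aFix j < q)
    (hR : Represents n q j (s.arr aWorkG) (s.arr aWorkW) S) :
    ∃ T : ℕ → ℕ,
      (∀ c < q, (∃ t, S t ∧ t j = s.arr aFix j ∧ t k = c) →
        S (row n T (pairCode q l (s.arr aFix j) c)) ∧
        row n T (pairCode q l (s.arr aFix j) c) j = s.arr aFix j ∧
        row n T (pairCode q l (s.arr aFix j) c) k = c) ∧
      Filled n q (s.arr aTmpG) (s.arr aTmpW) (((fixLevel q l).run s).arr aTmpG)
        (((fixLevel q l).run s).arr aTmpW)
        (fun k' c d => k' = k ∧ (∃ t, S t ∧ t j = s.arr aFix j ∧ t k = c) ∧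
          s.arr aWorkG (idx q k c d) ≠ 0)
        (fixVal n q l f T (s.arr aWorkW) (s.arr aFix j)) := by
  rw [fixLevel, run_seq, run_seq, run_seq, run_put]
  set s1 := (iter rL l 0 (.put aPos (.reg rL) (.reg rJ))).run s with hs1
  set s2 := s1.setCell aPos ((Expr.lit l).eval s1) ((Expr.reg rK).eval s1) with hs2
  set s3 := (closure q l).run s2 with hs3
  clear_value s3 s2 s1
  have hpos : ∀ i < l, s1.arr aPos i = j := by
    have := run_fill (x := rL) (c := l) (d := 0) (a := aPos) (e := .reg rJ) (val := fun _ => j) hn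
      (fun i hi u _ h _ => by simp only [Expr.eval]; rw [h rJ (by decide), hj])
    rwa [zero_mul, add_zero, ← hs1] at this
  have r1 : ∀ y, y ≠ rL → s1.reg y = s.reg y := fun y hy => by
    rw [hs1, run_reg (by simp [writesReg, hy])]
  have a1 : ∀ a, a ≠ aPos → s1.arr a = s.arr a := fun a ha => by
    rw [hs1, run_arr (by simp [writesArr, ha])]
  have a2 : ∀ a, a ≠ aPos → s2.arr a = s.arr a := fun a ha => by
    rw [hs2, State.setCell_arr_ne s1 ha, a1 a ha]
  have n2 : s2.reg 1 = n := by rw [hs2, State.setCell_reg, r1 1 (by decide), hn]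
  have p2 : ∀ i < l, s2.arr aPos i = j := by
    intro i hi
    simp only [hs2, State.setCell_arr, Expr.eval, true_and]
    rw [if_neg (by omega), hpos i hi]
  have p2l : s2.arr aPos l = k := by
    simp only [hs2, State.setCell_arr, Expr.eval, true_and, if_true]
    rw [r1 rK (by decide), hk]
  have t2 : Tables q l f s2.arr := hT.of_keeps (.put aPos (.lit 0) (.lit 0)) rfl fun a ha =>
    a2 a (by simpa [writesArr] using ha)
  have hp : ∀ i < l + 1, s2.arr aPos i < n := by
    intro i hi
    rcases Nat.lt_succ_iff_lt_or_eq.mp hi with hi | rfl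
    · rw [p2 i hi]; omega
    · rw [p2l]; exact hkn
  have hproj := run_closure hf hS n2 t2 (by
    rw [a2 aWorkG (by decide), a2 aWorkW (by decide)]; exact hR) (hjk.trans hkn) hp
  rw [← hs3] at hproj
  have n3 : s3.reg 1 = n := by rw [hs3, run_reg rfl, n2]
  have t3 : Tables q l f s3.arr := t2.of_keeps (closure q l) rfl fun a h => by rw [hs3, run_arr h]
  have fix3 : s3.arr aFix = s.arr aFix := by
    rw [hs3, run_arr rfl, a2 _ (by decide)]
  have wg3 : s3.arr aWorkG = s.arr aWorkG := by
    rw [hs3, run_arr rfl, a2 _ (by decide)]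
  have ww3 : s3.arr aWorkW = s.arr aWorkW := by
    rw [hs3, run_arr rfl, a2 _ (by decide)]
  have tg3 : s3.arr aTmpG = s.arr aTmpG := by
    rw [hs3, run_arr rfl, a2 _ (by decide)]
  have tw3 : s3.arr aTmpW = s.arr aTmpW := by
    rw [hs3, run_arr rfl, a2 _ (by decide)]
  have k3 : s3.reg rK = k := by
    rw [hs3, run_reg rfl, hs2, State.setCell_reg, r1 rK (by decide), hk]
  have j3 : s3.reg rJ = j := by
    rw [hs3, run_reg rfl, hs2, State.setCell_reg, r1 rJ (by decide), hj]
  set V := s.arr aFix j with hVdef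
  have hhas : ∀ c < q, s3.arr aHas (pairCode q l V c) ≠ 0 ↔ ∃ t, S t ∧ t j = V ∧ t k = c := by
    intro c hc
    rw [(hproj _ (pairCode_lt hV hc)).1]
    refine exists_congr fun t => and_congr_right fun ht => ?_
    exact projCode_eq_pairCode hS hl p2 p2l (hjk.trans hkn) hkn hV hc ht
  refine ⟨s3.arr aTup, fun c hc h => ?_, ?_⟩
  · obtain ⟨g1, g2⟩ := (hproj _ (pairCode_lt hV hc)).2 ((hhas c hc).2 h)
    exact ⟨g1, (projCode_eq_pairCode hS hl p2 p2l (hjk.trans hkn) hkn hV hc g1).1 g2⟩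
  have := iter_inv (x := rC) (c := q) (d := 0) (P := fixValue q) n3 rfl
    (fun m A => Filled n q (s.arr aTmpG) (s.arr aTmpW) (A aTmpG) (A aTmpW)
      (fun k' c d => k' = k ∧ c < m ∧ (∃ t, S t ∧ t j = V ∧ t k = c) ∧
        s.arr aWorkG (idx q k c d) ≠ 0)
      (fixVal n q l f (s3.arr aTup) (s.arr aWorkW) V))
    (fun k' c d hc hd => ⟨fun h => absurd h.2.1 (Nat.not_lt_zero c), fun _ => by
      rw [tg3, tw3]; exact ⟨rfl, fun _ _ => rfl⟩⟩) ?_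
  · rw [zero_mul, add_zero] at this
    intro k' c d hc hd
    obtain ⟨h1, h2⟩ := this k' c d hc hd
    exact ⟨fun h => h1 ⟨h.1, hc, h.2⟩, fun h => h2 fun h' => h ⟨h'.1, h'.2.2⟩⟩
  intro m hm u hum hu1 hu2 hinv
  rw [zero_mul, add_zero] at hm
  have hfv := run_fixValue (n := n) (l := l) (f := f) (j := j) (s := u) (k := k) (c := m)
    (by rw [hu1 1 (by decide) rfl, n3]) (t3.of_keeps (fixValue q) rfl hu2)
    (by rw [hu1 rK (by decide) rfl, k3]) hum (by rw [hu1 rJ (by decide) rfl, j3])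
    (by rw [hu2 aFix rfl, fix3]; exact hV) hm
    (by rw [hu2 aHas rfl, hu2 aTup rfl]; exact fun v hv h => hS.lt _ ((hproj v hv).2 h).1)
    (by
      rw [hu2 aWorkG rfl, hu2 aWorkW rfl, wg3, ww3]
      exact fun d hd hG h hh =>
        ⟨hS.row_lt hR hkn hm hm (hR.flag_left hkn hm hd hG) hh, hS.row_lt hR hkn hm hd hG hh⟩)
  rw [hu2 aWorkG rfl, hu2 aWorkW rfl, hu2 aFix rfl, hu2 aHas rfl, hu2 aTup rfl, wg3, ww3, fix3,
    ← hVdef] at hfv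
  intro k' c d hc hd
  obtain ⟨h1, h2⟩ := hfv k' c d hc hd
  obtain ⟨h3, h4⟩ := hinv k' c d hc hd
  by_cases hcm : k' = k ∧ c = m
  · obtain ⟨rfl, rfl⟩ := hcm
    rw [hhas _ hc] at h1 h2
    refine ⟨fun h => h1 ⟨rfl, rfl, h.2.2⟩, fun h => ?_⟩
    obtain ⟨e1, e2⟩ := h2 fun h' => h ⟨rfl, Nat.lt_succ_self _, h'.2.2⟩
    obtain ⟨e3, e4⟩ := h4 fun h' => absurd h'.2.1 (lt_irrefl _)
    exact ⟨e1.trans e3, fun i hi => (e2 i hi).trans (e4 i hi)⟩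
  · obtain ⟨e1, e2⟩ := h2 fun h' => hcm ⟨h'.1, h'.2.1⟩
    rw [e1]
    refine ⟨fun h => ?_, fun h => ?_⟩
    · obtain ⟨e3, e4⟩ := h3 ⟨h.1, by have := h.2.1; omega, h.2.2⟩
      exact ⟨e3, fun i hi => (e2 i hi).trans (e4 i hi)⟩
    · obtain ⟨e3, e4⟩ := h4 fun h' => h ⟨h'.1, by have := h'.2.1; omega, h'.2.2⟩
      exact ⟨e3, fun i hi => (e2 i hi).trans (e4 i hi)⟩

theorem _root_.Maltsev.Represents.congr {G W G' W' : ℕ → ℕ} (hS : IsRel n q f S)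
    (hR : Represents n q j G W S)
    (h : ∀ x < q * q * n, G' x = G x ∧ ∀ k < n, row n W' x k = row n W x k) :
    Represents n q j G' W' S := by
  have hG : ∀ i < n, ∀ a < q, ∀ b < q, G' (idx q i a b) = G (idx q i a b) := fun i hi a ha b hb =>
    (h _ (idx_lt hi ha hb)).1
  have hW : ∀ i < n, ∀ a < q, ∀ b < q, ∀ k < n,
      row n W' (idx q i a b) k = row n W (idx q i a b) k := fun i hi a ha b hb =>
    (h _ (idx_lt hi ha hb)).2
  refine ⟨hR.fixed, fun i hi a ha b hb => ?_, fun i hi a ha b hb => ?_, fun i hi a ha b hb => ?_,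
    fun i hi a ha b hb => ?_⟩
  · rw [hG i hi a ha b hb]; exact hR.flag i hi a ha b hb
  · rw [hG i hi a ha b hb]
    exact fun hg => hS.ext _ _ (fun k hk => (hW i hi a ha b hb k hk).symm)
      (hR.mem i hi a ha b hb hg)
  · rw [hG i hi a ha b hb, hW i hi a ha b hb i hi]; exact hR.value i hi a ha b hb
  · rw [hG i hi a ha b hb]
    intro hg k hk
    rw [hW i hi a ha b hb k (hk.trans hi), hW i hi a ha a ha k (hk.trans hi)]
    exact hR.agree i hi a ha b hb hg k hk

/-- One call of `fix` moves the first free position from `j` to `j + 1`. -/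
theorem run_fix (hf : IsOp q f) (hS : IsRel n q f S) (hl : 0 < l) (hn : s.reg 1 = n)
    (hT : Tables q l f s.arr) (hj : s.reg rJ = j) (hjn : j < n) (hV : s.arr aFix j < q)
    (hR : Represents n q j (s.arr aWorkG) (s.arr aWorkW) S) :
    Represents n q (j + 1) (((fix q l).run s).arr aWorkG) (((fix q l).run s).arr aWorkW)
      fun t => S t ∧ t j = s.arr aFix j := by
  rw [fix, run_seq, run_seq]
  set s1 := (clear q aTmpG).run s with hs1
  set P : Code := .ite (.lt (.reg rJ) (.reg rK)) (fixLevel q l) .skip with hP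
  set s2 := (iter rK 0 1 P).run s1 with hs2
  have h0 : ∀ x < q * q * n, s1.arr aTmpG x = 0 := run_clear hn
  have n1 : s1.reg 1 = n := by rw [hs1, run_reg rfl, hn]
  have j1 : s1.reg rJ = j := by rw [hs1, run_reg rfl, hj]
  have t1 : Tables q l f s1.arr := hT.of_keeps (clear q aTmpG) rfl fun a h => run_arr h s
  have wg1 : s1.arr aWorkG = s.arr aWorkG := run_arr rfl s
  have ww1 : s1.arr aWorkW = s.arr aWorkW := run_arr rfl s
  have fx1 : s1.arr aFix = s.arr aFix := run_arr rfl s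
  set V := s.arr aFix j with hVdef
  have key := iter_inv (x := rK) (c := 0) (d := 1) (P := P) n1 rfl
    (fun m A => ∀ k < n, ∀ c < q,
      (k < m → (∀ d < q, A aTmpG (idx q k c d) ≠ 0 ↔ j < k ∧ (∃ t, S t ∧ t j = V ∧ t k = c) ∧
          s.arr aWorkG (idx q k c d) ≠ 0) ∧
        ((∃ d < q, A aTmpG (idx q k c d) ≠ 0) → ∃ t, S t ∧ t j = V ∧ t k = c ∧
          ∀ d < q, A aTmpG (idx q k c d) ≠ 0 → ∀ h < n, row n (A aTmpW) (idx q k c d) h =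
            f (t h) (row n (s.arr aWorkW) (idx q k c c) h)
              (row n (s.arr aWorkW) (idx q k c d) h))) ∧
      (m ≤ k → ∀ d < q, A aTmpG (idx q k c d) = 0))
    (fun k hk c hc => ⟨fun h => absurd h (Nat.not_lt_zero k),
      fun _ d hd => h0 _ (idx_lt hk hc hd)⟩) ?_
  · simp only [one_mul, zero_add, ← hs2] at key
    have hrep := hR.fix hf hS (v := V) (G' := s2.arr aTmpG) (W' := s2.arr aTmpW)
      (fun k hk c hc => ((key k hk c hc).1 hk).1) (fun k hk c hc => ((key k hk c hc).1 hk).2)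
    exact hrep.congr (hS.and_eq hjn hV hf) (run_copyRep (by rw [hs2, run_reg rfl, n1]) (by decide)
      (by decide) (by decide) (by decide) (by decide))
  intro m hm u hum hu1 hu2 hinv k hk c hc
  rw [one_mul, zero_add] at hm
  have hJ : (Expr.lt (.reg rJ) (.reg rK)).eval u = if j < m then 1 else 0 := by
    simp only [Expr.eval, hum, hu1 rJ (by decide) rfl, j1]
  rw [hP, run, hJ]
  obtain ⟨i1, i2⟩ := hinv k hk c hc
  by_cases hjm : j < m
  · rw [if_pos hjm, if_neg one_ne_zero]
    obtain ⟨T, hT1, hT2⟩ := run_fixLevel (n := n) (l := l) (f := f) (S := S) (j := j) (s := u)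
      (k := m) hf hS hl (by rw [hu1 1 (by decide) rfl, n1]) (t1.of_keeps P rfl hu2) hum
      (by rw [hu1 rJ (by decide) rfl, j1]) hjm hm
      (by rw [hu2 aFix rfl, fx1]; exact hV)
      (by rw [hu2 aWorkG rfl, hu2 aWorkW rfl, wg1, ww1]; exact hR)
    rw [hu2 aFix rfl, hu2 aWorkG rfl, hu2 aWorkW rfl, fx1, wg1, ww1, ← hVdef] at hT2
    rw [hu2 aFix rfl, fx1, ← hVdef] at hT1
    have hun : k ≠ m → ∀ d < q, ((fixLevel q l).run u).arr aTmpG (idx q k c d) =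
        u.arr aTmpG (idx q k c d) ∧ ∀ h < n, row n (((fixLevel q l).run u).arr aTmpW)
          (idx q k c d) h = row n (u.arr aTmpW) (idx q k c d) h := fun hkm d hd =>
      (hT2 k c d hc hd).2 fun h => hkm h.1
    refine ⟨fun hkm => ?_, fun hkm d hd => ?_⟩
    · rcases Nat.lt_succ_iff_lt_or_eq.mp hkm with hkm | rfl
      · obtain ⟨g1, g2⟩ := i1 hkm
        refine ⟨fun d hd => ?_, fun h => ?_⟩
        · rw [(hun hkm.ne d hd).1]; exact g1 d hd
        · obtain ⟨d, hd, hd'⟩ := h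
          rw [(hun hkm.ne d hd).1] at hd'
          obtain ⟨t, x1, x2, x3, x4⟩ := g2 ⟨d, hd, hd'⟩
          refine ⟨t, x1, x2, x3, fun e he he' h hh => ?_⟩
          rw [(hun hkm.ne e he).1] at he'
          rw [(hun hkm.ne e he).2 h hh]
          exact x4 e he he' h hh
      · have hiff : ∀ d < q, ((fixLevel q l).run u).arr aTmpG (idx q k c d) ≠ 0 ↔
            j < k ∧ (∃ t, S t ∧ t j = V ∧ t k = c) ∧ s.arr aWorkG (idx q k c d) ≠ 0 := by
          intro d hd
          obtain ⟨x1, x2⟩ := hT2 k c d hc hd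
          refine ⟨fun h => ⟨hjm, ?_⟩, fun h => (x1 ⟨rfl, h.2⟩).1⟩
          by_contra hcon
          rw [(x2 fun h' => hcon h'.2).1] at h
          exact h (i2 le_rfl d hd)
        refine ⟨hiff, fun ⟨d, hd, hd'⟩ => ?_⟩
        have hex := ((hiff d hd).1 hd').2.1
        obtain ⟨y1, y2, y3⟩ := hT1 c hc hex
        refine ⟨_, y1, y2, y3, fun e he he' h hh => ?_⟩
        exact ((hT2 k c e hc he).1 ⟨rfl, ((hiff e he).1 he').2⟩).2 h hh
    · rw [(hun (by omega) d hd).1]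
      exact i2 (by omega) d hd
  · rw [if_neg hjm, if_pos rfl]
    refine ⟨fun hkm => ?_, fun hkm => i2 (by omega)⟩
    rcases Nat.lt_succ_iff_lt_or_eq.mp hkm with hkm | rfl
    · exact i1 hkm
    · have := i2 le_rfl
      refine ⟨fun d hd => ⟨fun h => absurd (this d hd) h, fun h => absurd h.1 hjm⟩,
        fun ⟨d, hd, h⟩ => absurd (this d hd) h⟩

theorem _root_.Maltsev.IsRel.and_prefix (hf : IsOp q f) (hS : IsRel n q f S) {u : ℕ → ℕ} {m : ℕ}
    (hm : m ≤ n) (hu : ∀ k < m, u k < q) : IsRel n q f fun t => S t ∧ ∀ k < m, t k = u k where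
  ext t t' h ht := ⟨hS.ext _ _ h ht.1, fun k hk => by rw [← h k (by omega), ht.2 k hk]⟩
  lt t ht := hS.lt t ht.1
  closed x y z hx hy hz := ⟨hS.closed _ _ _ hx.1 hy.1 hz.1, fun k hk => by
    simp only [hx.2 k hk, hy.2 k hk, hz.2 k hk]; exact hf.left _ _ (hu k hk) (hu k hk)⟩

theorem run_fixPrefix (hf : IsOp q f) (hS : IsRel n q f S) (hl : 0 < l) (hn : s.reg 1 = n)
    (hT : Tables q l f s.arr) {i : ℕ} (hi : s.reg rI = i) (hin : i < n)
    (hV : ∀ k < n, s.arr aFix k < q)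
    (hR : Represents n q 0 (s.arr aWorkG) (s.arr aWorkW) S) :
    Represents n q i (((fixPrefix q l).run s).arr aWorkG) (((fixPrefix q l).run s).arr aWorkW)
      fun t => S t ∧ ∀ k < i, t k = s.arr aFix k := by
  set P : Code := .ite (.lt (.reg rJ) (.reg rI)) (fix q l) .skip with hP
  have key := iter_inv (x := rJ) (c := 0) (d := 1) (P := P) hn rfl
    (fun m A => Represents n q (min m i) (A aWorkG) (A aWorkW)
      fun t => S t ∧ ∀ k < min m i, t k = s.arr aFix k)
    (by simpa using hR) ?_
  · rwa [zero_add, one_mul, min_eq_right hin.le] at key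
  intro m hm u hum hu1 hu2 hinv
  rw [zero_add, one_mul] at hm
  have hJ : (Expr.lt (.reg rJ) (.reg rI)).eval u = if m < i then 1 else 0 := by
    simp only [Expr.eval, hum, hu1 rI (by decide) rfl, hi]
  rw [hP, run, hJ]
  by_cases hmi : m < i
  · rw [if_pos hmi, if_neg one_ne_zero, min_eq_left (by omega : m + 1 ≤ i)]
    rw [min_eq_left hmi.le] at hinv
    have h := run_fix (n := n) (l := l) (f := f) (s := u) (j := m) hf
      (hS.and_prefix hf (u := s.arr aFix) (m := m) hm.le fun k hk => hV k (by omega)) hl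
      (by rw [hu1 1 (by decide) rfl, hn]) (hT.of_keeps P rfl hu2) hum hm
      (by rw [hu2 aFix rfl]; exact hV m hm) hinv
    rw [hu2 aFix rfl] at h
    convert h using 2 with t
    refine ⟨fun ⟨h1, h2⟩ => ⟨⟨h1, fun k hk => h2 k (by omega)⟩, h2 m (by omega)⟩,
      fun ⟨⟨h1, h2⟩, h3⟩ => ⟨h1, fun k hk => ?_⟩⟩
    rcases Nat.lt_succ_iff_lt_or_eq.mp hk with hk | rfl
    · exact h2 k hk
    · exact h3
  · rw [if_neg hmi, if_pos rfl, min_eq_right (by omega : i ≤ m + 1)]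
    rwa [min_eq_right (by omega : i ≤ m)] at hinv

end Code
end RAM

namespace RAM

open Maltsev

namespace Code

variable {n q l j : ℕ} {f : ℕ → ℕ → ℕ → ℕ} {S X : (ℕ → ℕ) → Prop} {s : State}

/-! ### Adding a constraint -/

/-- The positions in a scope, followed by one more position. -/
def scopeVec (l : ℕ) (sc : ℕ → ℕ) (i : ℕ) : ℕ → ℕ := fun x => if x < l then sc x else i

/-- The table `Con` on codes with the scope `sc` decides `X` on `S`. -/
def Constrains (n q l : ℕ) (Con sc : ℕ → ℕ) (S X : (ℕ → ℕ) → Prop) : Prop :=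
  (∀ x < l, sc x < n) ∧
    ∀ t, S t → ∀ i < n, (Con (projCode q (l + 1) (scopeVec l sc i) t) ≠ 0 ↔ X t)

theorem run_scopePos {e : Expr} {i : ℕ} (hn : s.reg 1 = n)
    (he : ∀ u : State, (∀ y, y ≠ rL → u.reg y = s.reg y) → e.eval u = i) :
    ∀ x < l + 1, ((scopePos l e).run s).arr aPos x = scopeVec l (s.arr aScope) i x := by
  rw [scopePos, run_seq, run_put]
  have h1 := run_fill (x := rL) (c := l) (d := 0) (a := aPos) (e := .get aScope (.reg rL))
    (val := s.arr aScope) hn (fun k hk u h1 h2 h3 => by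
      simp only [Expr.eval, h1, h3 aScope (by decide)])
  rw [zero_mul, add_zero] at h1
  intro x hx
  rw [State.setCell_arr, he _ fun y hy => run_reg (by simp [writesReg, hy]) s, scopeVec]
  simp only [Expr.eval, true_and]
  by_cases h : x < l
  · rw [if_neg (by omega), if_pos h, h1 x h]
  · rw [if_pos (by omega), if_neg h]

theorem scopeVec_lt {sc : ℕ → ℕ} {i : ℕ} (h : ∀ x < l, sc x < n) (hi : i < n) :
    ∀ x < l + 1, scopeVec l sc i x < n := by
  intro x _
  unfold scopeVec
  split_ifs with hx
  exacts [h x hx, hi]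

/-- The last digit of the code of a projection that ends with position `i`. -/
theorem digit_projCode (hS : IsRel n q f S) {p t : ℕ → ℕ} (hp : ∀ x < l + 1, p x < n) (ht : S t) :
    digit q (projCode q (l + 1) p t) l = t (p l) :=
  digit_enc (fun x hx => hS.lt t ht _ (hp x hx)) (Nat.lt_succ_self l)

theorem run_search (hn : s.reg 1 = n) (hT : Tables q l f s.arr) {a : ℕ} (ha : s.reg rA = a) :
    (((search q l).run s).arr aFound 0 = 0 ∧ ∀ v < q ^ (l + 1),
      ¬ (s.arr aHas v ≠ 0 ∧ s.arr aCon v ≠ 0 ∧ digit q v l = a)) ∨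
    (((search q l).run s).arr aFound 0 ≠ 0 ∧ ∃ v < q ^ (l + 1),
      (s.arr aHas v ≠ 0 ∧ s.arr aCon v ≠ 0 ∧ digit q v l = a) ∧
      ∀ k < n, ((search q l).run s).arr aFix k = row n (s.arr aTup) v k) := by
  rw [search, run_seq, run_put]
  set s1 := s.setCell aFound ((Expr.lit 0).eval s) ((Expr.lit 0).eval s) with hs1
  have a1 : ∀ b, b ≠ aFound → s1.arr b = s.arr b := fun b hb => State.setCell_arr_ne s hb
  have f1 : s1.arr aFound 0 = 0 := by simp [hs1, State.setCell_arr, Expr.eval]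
  set P : Code := .ite (.get aHas (.reg rY)) (.ite (.get aCon (.reg rY))
      (.ite (.lt (.get aLast (.reg rY)) (.reg rA)) .skip
        (.ite (.lt (.reg rA) (.get aLast (.reg rY))) .skip
          (.seq (copyRow aFix (.lit 0) aTup (.reg rY)) (.put aFound (.lit 0) (.lit 1)))))
      .skip) .skip with hP
  have key := iter_inv (x := rY) (c := q ^ (l + 1)) (d := 0) (P := P) (s := s1) (n := n) hn rfl
    (fun m A => (A aFound 0 = 0 ∧ ∀ v < m,
      ¬ (s.arr aHas v ≠ 0 ∧ s.arr aCon v ≠ 0 ∧ digit q v l = a)) ∨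
      (A aFound 0 ≠ 0 ∧ ∃ v < q ^ (l + 1),
      (s.arr aHas v ≠ 0 ∧ s.arr aCon v ≠ 0 ∧ digit q v l = a) ∧
      ∀ k < n, A aFix k = row n (s.arr aTup) v k))
    (Or.inl ⟨f1, fun v hv => absurd hv (Nat.not_lt_zero v)⟩) ?_
  · rwa [zero_mul, add_zero] at key
  intro m hm u hum hu1 hu2 hinv
  rw [zero_mul, add_zero] at hm
  have uA : u.reg rA = a := by rw [hu1 rA (by decide) rfl, hs1, State.setCell_reg, ha]
  have u1 : u.reg 1 = n := by rw [hu1 1 (by decide) rfl, hs1, State.setCell_reg, hn]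
  have uL : u.arr aLast m = digit q m l := by
    rw [hu2 aLast rfl, a1 _ (by decide), hT.last m hm]
  have e1 : (Expr.get aHas (.reg rY)).eval u = s.arr aHas m := by
    simp only [Expr.eval, hum, hu2 aHas rfl, a1 aHas (by decide)]
  have e2 : (Expr.get aCon (.reg rY)).eval u = s.arr aCon m := by
    simp only [Expr.eval, hum, hu2 aCon rfl, a1 aCon (by decide)]
  have e3 : (Expr.lt (.get aLast (.reg rY)) (.reg rA)).eval u =
      if digit q m l < a then 1 else 0 := by
    simp only [Expr.eval, hum, uA, uL]
  have e4 : (Expr.lt (.reg rA) (.get aLast (.reg rY))).eval u =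
      if a < digit q m l then 1 else 0 := by
    simp only [Expr.eval, hum, uA, uL]
  -- if code `m` does not qualify, then the step does nothing
  have hskip : ¬ (s.arr aHas m ≠ 0 ∧ s.arr aCon m ≠ 0 ∧ digit q m l = a) →
      (u.arr aFound 0 = 0 ∧ ∀ v < m + 1,
        ¬ (s.arr aHas v ≠ 0 ∧ s.arr aCon v ≠ 0 ∧ digit q v l = a)) ∨
      (u.arr aFound 0 ≠ 0 ∧ ∃ v < q ^ (l + 1),
        (s.arr aHas v ≠ 0 ∧ s.arr aCon v ≠ 0 ∧ digit q v l = a) ∧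
        ∀ k < n, u.arr aFix k = row n (s.arr aTup) v k) := by
    refine fun h => hinv.imp_left fun ⟨h1, h2⟩ => ⟨h1, fun v hv => ?_⟩
    rcases Nat.lt_succ_iff_lt_or_eq.mp hv with hv | rfl
    exacts [h2 v hv, h]
  rw [hP, run_ite, e1]
  by_cases h1 : s.arr aHas m = 0
  · rw [if_pos h1]
    exact hskip fun h => h.1 h1
  rw [if_neg h1, run_ite, e2]
  by_cases h2 : s.arr aCon m = 0
  · rw [if_pos h2]
    exact hskip fun h => h.2.1 h2
  rw [if_neg h2, run_ite, e3]
  by_cases h3 : digit q m l < a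
  · rw [if_pos h3, if_neg one_ne_zero]
    exact hskip fun h => by omega
  rw [if_neg h3, if_pos rfl, run_ite, e4]
  by_cases h4 : a < digit q m l
  · rw [if_pos h4, if_neg one_ne_zero]
    exact hskip fun h => by omega
  rw [if_neg h4, if_pos rfl, run_seq, run_put]
  right
  have hcopy := run_copyRow (dst := aFix) (src := aTup) (r := .lit 0) (r' := .reg rY) (s := u)
    (n := n) (R := 0) (Q := m) u1 (by decide) (fun _ _ _ => rfl)
    (fun t ht _ => by simp only [Expr.eval]; rw [ht rY (by decide), hum]) 0
  refine ⟨by simp [State.setCell_arr, Expr.eval], m, hm, ⟨h1, h2, by omega⟩, fun k hk => ?_⟩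
  rw [State.setCell_arr_ne _ (by decide)]
  have := hcopy k hk
  rw [if_pos rfl, hu2 aTup rfl, a1 aTup (by decide), row, zero_mul, zero_add] at this
  exact this

theorem run_store (hn : s.reg 1 = n) (hT : Tables q l f s.arr) {i a : ℕ} (hi : s.reg rI = i)
    (ha : s.reg rA = a) (haq : a < q) (h0 : ∀ b < q, s.arr aNewG (idx q i a b) = 0) :
    (∀ b < q, (((store q l).run s).arr aNewG (idx q i a b) ≠ 0 ↔ ∃ v < q ^ (l + 1),
        (s.arr aHas v ≠ 0 ∧ s.arr aCon v ≠ 0) ∧ digit q v l = b) ∧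
      (((store q l).run s).arr aNewG (idx q i a b) ≠ 0 → ∃ v < q ^ (l + 1),
        (s.arr aHas v ≠ 0 ∧ s.arr aCon v ≠ 0) ∧ digit q v l = b ∧ ∀ k < n,
        row n (((store q l).run s).arr aNewW) (idx q i a b) k = row n (s.arr aTup) v k)) ∧
    ∀ i' a' b, a' < q → b < q → ¬ (i' = i ∧ a' = a) →
      ((store q l).run s).arr aNewG (idx q i' a' b) = s.arr aNewG (idx q i' a' b) ∧
      ∀ k < n, row n (((store q l).run s).arr aNewW) (idx q i' a' b) k =
        row n (s.arr aNewW) (idx q i' a' b) k := by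
  have hq : 0 < q := by omega
  set P : Code := .ite (.get aHas (.reg rY)) (.ite (.get aCon (.reg rY))
    (.seq (.put aNewG (idxE q (.reg rI) (.reg rA) (.get aLast (.reg rY))) (.lit 1))
      (copyRow aNewW (idxE q (.reg rI) (.reg rA) (.get aLast (.reg rY))) aTup (.reg rY)))
    .skip) .skip with hP
  have key := iter_inv (x := rY) (c := q ^ (l + 1)) (d := 0) (P := P) (s := s) (n := n) hn rfl
    (fun m A => (∀ b < q, (A aNewG (idx q i a b) ≠ 0 ↔ ∃ v < m,
        (s.arr aHas v ≠ 0 ∧ s.arr aCon v ≠ 0) ∧ digit q v l = b) ∧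
      (A aNewG (idx q i a b) ≠ 0 → ∃ v < m,
        (s.arr aHas v ≠ 0 ∧ s.arr aCon v ≠ 0) ∧ digit q v l = b ∧ ∀ k < n,
        row n (A aNewW) (idx q i a b) k = row n (s.arr aTup) v k)) ∧
      ∀ i' a' b, a' < q → b < q → ¬ (i' = i ∧ a' = a) →
        A aNewG (idx q i' a' b) = s.arr aNewG (idx q i' a' b) ∧
        ∀ k < n, row n (A aNewW) (idx q i' a' b) k = row n (s.arr aNewW) (idx q i' a' b) k)
    ⟨fun b hb => ⟨⟨fun h => absurd (h0 b hb) h, fun ⟨v, hv, _⟩ => absurd hv (Nat.not_lt_zero v)⟩,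
      fun h => absurd (h0 b hb) h⟩, fun _ _ _ _ _ _ => ⟨rfl, fun _ _ => rfl⟩⟩ ?_
  · rwa [zero_mul, add_zero] at key
  rintro m hm u hum hu1 hu2 ⟨i1, i2⟩
  rw [zero_mul, add_zero] at hm
  have uI : u.reg rI = i := by rw [hu1 rI (by decide) rfl, hi]
  have uA : u.reg rA = a := by rw [hu1 rA (by decide) rfl, ha]
  have u1 : u.reg 1 = n := by rw [hu1 1 (by decide) rfl, hn]
  have uL : u.arr aLast m = digit q m l := by rw [hu2 aLast rfl, hT.last m hm]
  have hdq : digit q m l < q := Nat.mod_lt _ hq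
  have e1 : (Expr.get aHas (.reg rY)).eval u = s.arr aHas m := by
    simp only [Expr.eval, hum, hu2 aHas rfl]
  have e2 : (Expr.get aCon (.reg rY)).eval u = s.arr aCon m := by
    simp only [Expr.eval, hum, hu2 aCon rfl]
  have hskip : ¬ (s.arr aHas m ≠ 0 ∧ s.arr aCon m ≠ 0) → ∀ b < q,
      (u.arr aNewG (idx q i a b) ≠ 0 ↔ ∃ v < m + 1,
        (s.arr aHas v ≠ 0 ∧ s.arr aCon v ≠ 0) ∧ digit q v l = b) ∧
      (u.arr aNewG (idx q i a b) ≠ 0 → ∃ v < m + 1,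
        (s.arr aHas v ≠ 0 ∧ s.arr aCon v ≠ 0) ∧ digit q v l = b ∧ ∀ k < n,
        row n (u.arr aNewW) (idx q i a b) k = row n (s.arr aTup) v k) := by
    refine fun h b hb => ⟨(i1 b hb).1.trans ⟨fun ⟨v, hv, hv'⟩ => ⟨v, by omega, hv'⟩,
      fun ⟨v, hv, hv'⟩ => ⟨v, ?_, hv'⟩⟩, fun hG => ?_⟩
    · rcases Nat.lt_succ_iff_lt_or_eq.mp hv with hv | rfl
      exacts [hv, absurd hv'.1 h]
    · obtain ⟨v, hv, hv'⟩ := (i1 b hb).2 hG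
      exact ⟨v, by omega, hv'⟩
  rw [hP, run_ite, e1]
  by_cases h1 : s.arr aHas m = 0
  · rw [if_pos h1]
    exact ⟨hskip fun h => h.1 h1, i2⟩
  rw [if_neg h1, run_ite, e2]
  by_cases h2 : s.arr aCon m = 0
  · rw [if_pos h2]
    exact ⟨hskip fun h => h.2 h2, i2⟩
  rw [if_neg h2, run_seq, run_put]
  have hidx : ∀ t : State, t.reg rI = i → t.reg rA = a → t.reg rY = m →
      t.arr aLast = u.arr aLast →
      (idxE q (.reg rI) (.reg rA) (.get aLast (.reg rY))).eval t = idx q i a (digit q m l) := by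
    intro t x1 x2 x3 x4
    simp only [eval_idxE, Expr.eval, x1, x2, x3, x4, uL]
  rw [hidx u uI uA hum rfl]
  set w := u.setCell aNewG (idx q i a (digit q m l)) ((Expr.lit 1).eval u) with hw
  have warr : ∀ x, x ≠ aNewG → w.arr x = u.arr x := fun x hx => State.setCell_arr_ne u hx
  have hcopy := run_copyRow (dst := aNewW) (src := aTup)
    (r := idxE q (.reg rI) (.reg rA) (.get aLast (.reg rY))) (r' := .reg rY) (s := w)
    (n := n) (R := idx q i a (digit q m l)) (Q := m) u1 (by decide)
    (fun t ht ht' => hidx t (by rw [ht rI (by decide), hw, State.setCell_reg, uI])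
      (by rw [ht rA (by decide), hw, State.setCell_reg, uA])
      (by rw [ht rY (by decide), hw, State.setCell_reg, hum])
      (by rw [ht' aLast (by decide), warr _ (by decide)]))
    (fun t ht _ => by
      simp only [Expr.eval]; rw [ht rY (by decide), hw, State.setCell_reg, hum])
  rw [warr aTup (by decide), warr aNewW (by decide), hu2 aTup rfl] at hcopy
  have hGw : ∀ x, ((copyRow aNewW (idxE q (.reg rI) (.reg rA) (.get aLast (.reg rY))) aTup
      (.reg rY)).run w).arr aNewG x =
      if x = idx q i a (digit q m l) then 1 else u.arr aNewG x := by
    intro x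
    rw [run_arr rfl]
    simp only [hw, State.setCell_arr, Expr.eval, true_and]
  refine ⟨fun b hb => ?_, fun i' a' b ha' hb hne => ?_⟩
  · rw [hGw]
    have hrow := hcopy (idx q i a b)
    by_cases hbd : b = digit q m l
    · simp only [← hbd, if_true] at hrow ⊢
      exact ⟨⟨fun _ => ⟨m, Nat.lt_succ_self m, ⟨h1, h2⟩, hbd.symm⟩, fun _ => one_ne_zero⟩,
        fun _ => ⟨m, Nat.lt_succ_self m, ⟨h1, h2⟩, hbd.symm, hrow⟩⟩
    · have hx : idx q i a b ≠ idx q i a (digit q m l) := fun h =>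
        hbd ((idx_inj haq hb haq hdq).1 h).2.2
      simp only [if_neg hx] at hrow ⊢
      refine ⟨(i1 b hb).1.trans ⟨fun ⟨v, hv, hv'⟩ => ⟨v, by omega, hv'⟩,
        fun ⟨v, hv, hv'⟩ => ⟨v, ?_, hv'⟩⟩, fun hG => ?_⟩
      · rcases Nat.lt_succ_iff_lt_or_eq.mp hv with hv | rfl
        exacts [hv, absurd hv'.2.symm hbd]
      · obtain ⟨v, hv, hv1, hv2, hv3⟩ := (i1 b hb).2 hG
        exact ⟨v, by omega, hv1, hv2, fun k hk => (hrow k hk).trans (hv3 k hk)⟩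
  · have hx : idx q i' a' b ≠ idx q i a (digit q m l) := fun h => by
      obtain ⟨e1, e2, -⟩ := (idx_inj ha' hb haq hdq).1 h
      exact hne ⟨e1, e2⟩
    rw [hGw, if_neg hx]
    obtain ⟨g1, g2⟩ := i2 i' a' b ha' hb hne
    exact ⟨g1, fun k hk => by rw [hcopy _ k hk, if_neg hx]; exact g2 k hk⟩

/-- The entries of the new tables for `i` and `a` are determined by any one tuple `u` that satisfies
the constraint and has the value `a` at `i`. -/
theorem run_updateEntry (hf : IsOp q f) (hS : IsRel n q f S)
    (hl : 0 < l) (hn : s.reg 1 = n)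
    (hT : Tables q l f s.arr) {i a : ℕ} (hi : s.reg rI = i) (hin : i < n) (ha : s.reg rA = a)
    (haq : a < q) (hR : Represents n q 0 (s.arr aG) (s.arr aW) S)
    (hC : Constrains n q l (s.arr aCon) (s.arr aScope) S X)
    (h0 : ∀ b < q, s.arr aNewG (idx q i a b) = 0) :
    EntryDone n q (((updateEntry q l).run s).arr aNewG) (((updateEntry q l).run s).arr aNewW)
      (fun t => S t ∧ X t) i a ∧
    ∀ i' a' b, a' < q → b < q → ¬ (i' = i ∧ a' = a) →
      ((updateEntry q l).run s).arr aNewG (idx q i' a' b) = s.arr aNewG (idx q i' a' b) ∧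
      ∀ k < n, row n (((updateEntry q l).run s).arr aNewW) (idx q i' a' b) k =
        row n (s.arr aNewW) (idx q i' a' b) k := by
  obtain ⟨hsc, hcon⟩ := hC
  rw [updateEntry, run_seq, run_seq, run_seq, run_seq]
  have hrep := run_copyRep (q := q) (g' := aWorkG) (w' := aWorkW) (g := aG) (w := aW) hn (by decide)
    (by decide) (by decide) (by decide) (by decide)
  set p := scopeVec l (s.arr aScope) i with hp
  have hpn : ∀ x < l + 1, p x < n := scopeVec_lt hsc hin
  have hpl : p l = i := by simp [hp, scopeVec]
  have hproj : ∀ p' : ℕ → ℕ, (∀ x < l + 1, p' x = p x) → ∀ t,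
      projCode q (l + 1) p' t = projCode q (l + 1) p t := fun p' h t =>
    enc_congr fun x hx => by rw [h x hx]
  have hdig : ∀ t, S t → digit q (projCode q (l + 1) p t) l = t i := fun t ht => by
    rw [digit_projCode hS hpn ht, hpl]
  have hX : ∀ t, S t → (s.arr aCon (projCode q (l + 1) p t) ≠ 0 ↔ X t) := fun t ht =>
    hcon t ht i hin
  -- the projection of `S` to the scope and to `i`, in which a tuple `u` is searched for
  obtain ⟨s1, hs1⟩ : ∃ x, x = (copyRep q aWorkG aWorkW aG aW).run s := ⟨_, rfl⟩
  obtain ⟨s2, hs2⟩ : ∃ x, x = (scopePos l (.reg rI)).run s1 := ⟨_, rfl⟩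
  obtain ⟨s3, hs3⟩ : ∃ x, x = (closure q l).run s2 := ⟨_, rfl⟩
  obtain ⟨s4, hs4⟩ : ∃ x, x = (search q l).run s3 := ⟨_, rfl⟩
  rw [← hs1, ← hs2, ← hs3, ← hs4]
  rw [← hs1] at hrep
  have n1 : s1.reg 1 = n := by rw [hs1, run_reg rfl, hn]
  have n2 : s2.reg 1 = n := by rw [hs2, run_reg rfl, n1]
  have n3 : s3.reg 1 = n := by rw [hs3, run_reg rfl, n2]
  have n4 : s4.reg 1 = n := by rw [hs4, run_reg rfl, n3]
  have i1 : s1.reg rI = i := by rw [hs1, run_reg rfl, hi]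
  have i4 : s4.reg rI = i := by
    rw [hs4, run_reg rfl, hs3, run_reg rfl, hs2, run_reg rfl, i1]
  have a3 : s3.reg rA = a := by
    rw [hs3, run_reg rfl, hs2, run_reg rfl, hs1, run_reg rfl, ha]
  have a4 : s4.reg rA = a := by rw [hs4, run_reg rfl, a3]
  have t1 : Tables q l f s1.arr := hT.of_keeps (copyRep q aWorkG aWorkW aG aW) rfl
    fun b h => by rw [hs1, run_arr h]
  have t2 : Tables q l f s2.arr := t1.of_keeps (scopePos l (.reg rI)) rfl
    fun b h => by rw [hs2, run_arr h]
  have t3 : Tables q l f s3.arr := t2.of_keeps (closure q l) rfl fun b h => by rw [hs3, run_arr h]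
  have t4 : Tables q l f s4.arr := t3.of_keeps (search q l) rfl fun b h => by rw [hs4, run_arr h]
  have r1 : Represents n q 0 (s1.arr aWorkG) (s1.arr aWorkW) S := hR.congr hS hrep
  have sc1 : s1.arr aScope = s.arr aScope := by rw [hs1, run_arr rfl]
  have p2 : ∀ x < l + 1, s2.arr aPos x = p x := by
    rw [hs2, hp, ← sc1]
    exact run_scopePos n1 fun u hu => by simp only [Expr.eval]; rw [hu rI (by decide), i1]
  have r2 : Represents n q 0 (s2.arr aWorkG) (s2.arr aWorkW) S := by
    rw [hs2, run_arr rfl, run_arr rfl]; exact r1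
  have hP3 := run_closure hf hS n2 t2 r2 (by omega) (fun x hx => by rw [p2 x hx]; exact hpn x hx)
  rw [← hs3] at hP3
  have con3 : s3.arr aCon = s.arr aCon := by
    rw [hs3, run_arr rfl, hs2, run_arr rfl, hs1, run_arr rfl]
  have ng4 : s4.arr aNewG = s.arr aNewG := by
    rw [hs4, run_arr rfl, hs3, run_arr rfl, hs2, run_arr rfl, hs1, run_arr rfl]
  have nw4 : s4.arr aNewW = s.arr aNewW := by
    rw [hs4, run_arr rfl, hs3, run_arr rfl, hs2, run_arr rfl, hs1, run_arr rfl]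
  have hsearch := run_search n3 t3 a3
  rw [← hs4, con3] at hsearch
  have hfound : (Expr.get aFound (.lit 0)).eval s4 = s4.arr aFound 0 := rfl
  rw [run_ite, hfound]
  rcases hsearch with ⟨hz, hno⟩ | ⟨hz, v, hv, ⟨hv1, hv2, hv3⟩, hfix⟩
  · rw [if_pos hz]
    rw [show Code.skip.run s4 = s4 from rfl, ng4, nw4]
    refine ⟨Or.inr ⟨fun u hu hua => ?_, h0⟩, fun _ _ _ _ _ _ => ⟨rfl, fun _ _ => rfl⟩⟩
    have hlt := hS.projCode_lt hpn hu.1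
    refine hno _ hlt ⟨(hP3 _ hlt).1.2 ⟨u, hu.1, hproj _ p2 u⟩, (hX u hu.1).2 hu.2, ?_⟩
    rw [hdig u hu.1, hua]
  rw [if_neg hz, extend, run_seq, run_seq, run_seq]
  obtain ⟨hu, huv⟩ := (hP3 v hv).2 hv1
  rw [hproj _ p2] at huv
  set u := row n (s3.arr aTup) v with hudef
  have hua : u i = a := by rw [← hdig u hu, huv, hv3]
  have huX : X u := (hX u hu).1 (by rw [huv]; exact hv2)
  -- the tuples of `S` with the same beginning as `u`
  obtain ⟨s5, hs5⟩ : ∃ x, x = (fixPrefix q l).run s4 := ⟨_, rfl⟩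
  obtain ⟨s6, hs6⟩ : ∃ x, x = (scopePos l (.reg rI)).run s5 := ⟨_, rfl⟩
  obtain ⟨s7, hs7⟩ : ∃ x, x = (closure q l).run s6 := ⟨_, rfl⟩
  rw [← hs5, ← hs6, ← hs7]
  have n5 : s5.reg 1 = n := by rw [hs5, run_reg rfl, n4]
  have n6 : s6.reg 1 = n := by rw [hs6, run_reg rfl, n5]
  have n7 : s7.reg 1 = n := by rw [hs7, run_reg rfl, n6]
  have i5 : s5.reg rI = i := by rw [hs5, run_reg rfl, i4]
  have i7 : s7.reg rI = i := by rw [hs7, run_reg rfl, hs6, run_reg rfl, i5]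
  have a7 : s7.reg rA = a := by
    rw [hs7, run_reg rfl, hs6, run_reg rfl, hs5, run_reg rfl, a4]
  have t5 : Tables q l f s5.arr := t4.of_keeps (fixPrefix q l) rfl
    fun b h => by rw [hs5, run_arr h]
  have t6 : Tables q l f s6.arr := t5.of_keeps (scopePos l (.reg rI)) rfl
    fun b h => by rw [hs6, run_arr h]
  have t7 : Tables q l f s7.arr := t6.of_keeps (closure q l) rfl fun b h => by rw [hs7, run_arr h]
  have r4 : Represents n q 0 (s4.arr aWorkG) (s4.arr aWorkW) S := by
    rw [hs4, run_arr rfl, run_arr rfl, hs3, run_arr rfl, run_arr rfl]; exact r2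
  have hfixlt : ∀ k < n, s4.arr aFix k < q := fun k hk => by
    rw [hfix k hk]; exact hS.lt u hu k hk
  have r5 := run_fixPrefix hf hS hl n4 t4 i4 hin hfixlt r4
  rw [← hs5] at r5
  have hSu := hS.and_prefix hf (u := s4.arr aFix) (m := i) hin.le
    fun k hk => hfixlt k (hk.trans hin)
  have hSu' : ∀ t : ℕ → ℕ, (∀ k < i, t k = s4.arr aFix k) ↔ ∀ k < i, t k = u k := fun t =>
    forall₂_congr fun k hk => by rw [hfix k (hk.trans hin)]
  have sc5 : s5.arr aScope = s.arr aScope := by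
    rw [hs5, run_arr rfl, hs4, run_arr rfl, hs3, run_arr rfl, hs2, run_arr rfl, sc1]
  have p6 : ∀ x < l + 1, s6.arr aPos x = p x := by
    rw [hs6, hp, ← sc5]
    exact run_scopePos n5 fun u hu => by simp only [Expr.eval]; rw [hu rI (by decide), i5]
  have hP7 := run_closure hf hSu n6 t6 (j := i)
    (by rw [hs6, run_arr rfl, run_arr rfl]; exact r5) hin
    (fun x hx => by rw [p6 x hx]; exact hpn x hx)
  rw [← hs7] at hP7
  have con7 : s7.arr aCon = s.arr aCon := by
    rw [hs7, run_arr rfl, hs6, run_arr rfl, hs5, run_arr rfl, hs4, run_arr rfl, con3]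
  have ng7 : s7.arr aNewG = s.arr aNewG := by
    rw [hs7, run_arr rfl, hs6, run_arr rfl, hs5, run_arr rfl, ng4]
  have nw7 : s7.arr aNewW = s.arr aNewW := by
    rw [hs7, run_arr rfl, hs6, run_arr rfl, hs5, run_arr rfl, nw4]
  obtain ⟨st1, st2⟩ := run_store n7 t7 i7 a7 haq (by rw [ng7]; exact h0)
  rw [ng7, nw7] at st2
  refine ⟨Or.inl ⟨u, ⟨⟨hu, huX⟩, hua⟩, fun b hb => ?_⟩, st2⟩
  obtain ⟨h1, h2⟩ := st1 b hb
  rw [con7] at h1 h2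
  refine ⟨h1.trans ⟨?_, ?_⟩, fun hG => ?_⟩
  · rintro ⟨y, hy, ⟨hy1, hy2⟩, hy3⟩
    obtain ⟨t, ⟨ht, htu⟩, rfl⟩ := (hP7 y hy).1.1 hy1
    rw [hproj _ p6] at hy2 hy3
    exact ⟨t, ⟨ht, (hX t ht).1 hy2⟩, (hSu' t).1 htu, (hdig t ht).symm.trans hy3⟩
  · rintro ⟨t, ⟨ht, htX⟩, htu, htb⟩
    have hlt := hS.projCode_lt hpn ht
    exact ⟨_, hlt, ⟨(hP7 _ hlt).1.2 ⟨t, ⟨ht, (hSu' t).2 htu⟩, hproj _ p6 t⟩, (hX t ht).2 htX⟩,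
      by rw [hdig t ht, htb]⟩
  · obtain ⟨y, hy, ⟨hy1, hy2⟩, hy3, hrow⟩ := h2 hG
    obtain ⟨⟨ht, htu⟩, hty⟩ := (hP7 y hy).2 hy1
    rw [hproj _ p6] at hty
    have hrow' := fun k hk => (hrow k hk).symm
    refine ⟨⟨hS.ext _ _ hrow' ht, ?_⟩, fun k hk => ?_, ?_⟩
    · refine (hX _ (hS.ext _ _ hrow' ht)).1 ?_
      rw [projCode_ext hpn hrow, hty]
      exact hy2
    · rw [hrow k (hk.trans hin)]
      exact (hSu' _).1 htu k hk
    · rw [hrow i hin, ← hdig _ ht, hty, hy3]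

/-- A constraint that takes a relation to a closed relation is added to the representation. -/
theorem run_update (hf : IsOp q f) (hS : IsRel n q f S) (hSX : IsRel n q f fun t => S t ∧ X t)
    (hl : 0 < l) (hn : s.reg 1 = n) (hT : Tables q l f s.arr)
    (hR : Represents n q 0 (s.arr aG) (s.arr aW) S)
    (hC : Constrains n q l (s.arr aCon) (s.arr aScope) S X) :
    Represents n q 0 (((update q l).run s).arr aG) (((update q l).run s).arr aW)
      fun t => S t ∧ X t := by
  rw [update, run_seq, run_seq]
  have h0 : ∀ x < q * q * n, ((clear q aNewG).run s).arr aNewG x = 0 := run_clear hn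
  obtain ⟨s1, hs1⟩ : ∃ x, x = (clear q aNewG).run s := ⟨_, rfl⟩
  rw [← hs1] at h0 ⊢
  have n1 : s1.reg 1 = n := by rw [hs1, run_reg rfl, hn]
  have t1 : Tables q l f s1.arr := hT.of_keeps (clear q aNewG) rfl fun b h => by rw [hs1, run_arr h]
  have g1 : s1.arr aG = s.arr aG := by rw [hs1, run_arr rfl]
  have w1 : s1.arr aW = s.arr aW := by rw [hs1, run_arr rfl]
  have c1 : s1.arr aCon = s.arr aCon := by rw [hs1, run_arr rfl]
  have sc1 : s1.arr aScope = s.arr aScope := by rw [hs1, run_arr rfl]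
  obtain ⟨s2, hs2⟩ : ∃ x, x = (iter rI 0 1 (.iter rA q 0 (updateEntry q l))).run s1 := ⟨_, rfl⟩
  have key := iter_inv (x := rI) (c := 0) (d := 1) (P := .iter rA q 0 (updateEntry q l)) n1 rfl
    (fun m A => ∀ i < n, ∀ a < q,
      (i < m → EntryDone n q (A aNewG) (A aNewW) (fun t => S t ∧ X t) i a) ∧
      (m ≤ i → ∀ b < q, A aNewG (idx q i a b) = 0))
    (fun i hi a ha => ⟨fun h => absurd h (Nat.not_lt_zero i),
      fun _ b hb => h0 _ (idx_lt hi ha hb)⟩) ?_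
  · rw [zero_add, one_mul, ← hs2] at key
    rw [← hs2]
    exact (represents_of_entryDone hf hSX fun i hi a ha => (key i hi a ha).1 hi).congr hSX
      (run_copyRep (by rw [hs2, run_reg rfl, n1]) (by decide) (by decide) (by decide) (by decide)
        (by decide))
  intro m hm u hum hu1 hu2 hinv
  rw [zero_add, one_mul] at hm
  have u1 : u.reg 1 = n := by rw [hu1 1 (by decide) rfl, n1]
  have inner := iter_inv (x := rA) (c := q) (d := 0) (P := updateEntry q l) u1 rfl
    (fun m' A => ∀ i < n, ∀ a < q,
      (i < m ∨ i = m ∧ a < m' → EntryDone n q (A aNewG) (A aNewW) (fun t => S t ∧ X t) i a) ∧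
      (¬ (i < m ∨ i = m ∧ a < m') → ∀ b < q, A aNewG (idx q i a b) = 0))
    (fun i hi a ha => ⟨fun h => (hinv i hi a ha).1 (by omega), fun h =>
      (hinv i hi a ha).2 (by omega)⟩) ?_
  · rw [zero_mul, add_zero] at inner
    exact fun i hi a ha => ⟨fun h => (inner i hi a ha).1 (by omega),
      fun h => (inner i hi a ha).2 (by omega)⟩
  intro m' hm' w hwm hw1 hw2 hinv'
  rw [zero_mul, add_zero] at hm'
  have harr : ∀ b, (updateEntry q l).writesArr b = false → w.arr b = s1.arr b := fun b hb => by
    rw [hw2 b hb, hu2 b hb]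
  obtain ⟨e1, e2⟩ := run_updateEntry (X := X) (i := m) (a := m') hf hS hl
    (by rw [hw1 1 (by decide) rfl, u1]) (t1.of_keeps (updateEntry q l) rfl harr)
    (by rw [hw1 rI (by decide) rfl, hum]) hm hwm hm'
    (by rw [harr aG rfl, harr aW rfl, g1, w1]; exact hR)
    (by rw [harr aCon rfl, harr aScope rfl, c1, sc1]; exact hC)
    ((hinv' m hm m' hm').2 (by omega))
  intro i hi a ha
  by_cases hia : i = m ∧ a = m'
  · obtain ⟨rfl, rfl⟩ := hia
    exact ⟨fun _ => e1, fun h => absurd (Or.inr ⟨rfl, Nat.lt_succ_self _⟩) h⟩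
  · have e3 := fun b hb => e2 i a b ha hb hia
    refine ⟨fun h => ((hinv' i hi a ha).1 (by omega)).congr hSX hi e3, fun h b hb => ?_⟩
    rw [(e3 b hb).1]
    exact (hinv' i hi a ha).2 (by omega) b hb

/-- Since the witnesses generate the relation, it is enough to check them. -/
theorem run_check (hf : IsOp q f) (hS : IsRel n q f S) (hSX : IsRel n q f fun t => S t ∧ X t)
    (hn : s.reg 1 = n) (hn0 : 0 < n) (hR : Represents n q 0 (s.arr aG) (s.arr aW) S)
    (hC : Constrains n q l (s.arr aCon) (s.arr aScope) S X) :
    (((check q l).run s).arr aFound 0 = 0 → ∀ t, S t → X t) ∧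
    (((check q l).run s).arr aFound 0 ≠ 0 → ∃ t, S t ∧ ¬ X t) := by
  rw [check, run_seq, run_seq]
  have hp := run_scopePos (l := l) (e := .lit 0) (i := 0) hn fun u _ => rfl
  obtain ⟨s1, hs1⟩ : ∃ x, x = (scopePos l (.lit 0)).run s := ⟨_, rfl⟩
  rw [← hs1] at hp ⊢
  rw [run_put]
  obtain ⟨s2, hs2⟩ : ∃ x, x = s1.setCell aFound ((Expr.lit 0).eval s1) ((Expr.lit 0).eval s1) :=
    ⟨_, rfl⟩
  rw [← hs2]
  have n2 : s2.reg 1 = n := by rw [hs2, State.setCell_reg, hs1, run_reg rfl, hn]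
  have arr2 : ∀ b, b ≠ aFound → b ≠ aPos → s2.arr b = s.arr b := fun b hb hb' => by
    rw [hs2, State.setCell_arr_ne _ hb, hs1, run_arr (by simp [scopePos, writesArr, hb'])]
  have pos2 : s2.arr aPos = s1.arr aPos := by rw [hs2, State.setCell_arr_ne _ (by decide)]
  have hcode : ∀ t, S t → (s.arr aCon (projCode q (l + 1) (s1.arr aPos) t) ≠ 0 ↔ X t) := by
    intro t ht
    rw [← hC.2 t ht 0 hn0, projCode, projCode, enc_congr fun x hx => congrArg t (hp x hx)]
  have key := iter_inv (x := rX) (c := 0) (d := q * q)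
    (P := .ite (.get aG (.reg rX)) (.ite (.get aCon (projE q aW (.reg rX) (l + 1) 0)) .skip
      (.put aFound (.lit 0) (.lit 1))) .skip) n2 rfl
    (fun m A => (A aFound 0 = 0 → ∀ x < m, s.arr aG x ≠ 0 →
        s.arr aCon (projCode q (l + 1) (s1.arr aPos) (row n (s.arr aW) x)) ≠ 0) ∧
      (A aFound 0 ≠ 0 → ∃ x < q * q * n, s.arr aG x ≠ 0 ∧
        s.arr aCon (projCode q (l + 1) (s1.arr aPos) (row n (s.arr aW) x)) = 0))
    ⟨fun _ x hx => absurd hx (Nat.not_lt_zero x), fun h => absurd (by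
      simp [hs2, State.setCell_arr, Expr.eval]) h⟩ ?_
  · rw [zero_add] at key
    refine ⟨fun h => ?_, fun h => ?_⟩
    · refine hR.generates hf hS hn0 hSX fun i hi a ha b hb hG => ?_
      exact (hcode _ (hR.mem i hi a ha b hb hG)).1 (key.1 h _ (idx_lt hi ha hb) hG)
    · obtain ⟨x, hx, hG, hx'⟩ := key.2 h
      obtain ⟨i, hi, a, ha, b, hb, rfl⟩ := exists_idx hx
      have hmem := hR.mem i hi a ha b hb hG
      exact ⟨_, hmem, fun hX => (hcode _ hmem).2 hX hx'⟩
  rintro m hm u hum hu1 hu2 ⟨i1, i2⟩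
  rw [zero_add] at hm
  have e1 : (Expr.get aG (.reg rX)).eval u = s.arr aG m := by
    simp only [Expr.eval, hum, hu2 aG rfl, arr2 aG (by decide) (by decide)]
  have e2 : (Expr.get aCon (projE q aW (.reg rX) (l + 1) 0)).eval u =
      s.arr aCon (projCode q (l + 1) (s1.arr aPos) (row n (s.arr aW) m)) := by
    have h1 : (projE q aW (.reg rX) (l + 1) 0).eval u =
        projCode q (l + 1) (s1.arr aPos) (row n (s.arr aW) m) := by
      rw [eval_projE, hu1 1 (by decide) rfl, n2, hu2 aW rfl, hu2 aPos rfl, pos2,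
        arr2 aW (by decide) (by decide)]
      simp only [Expr.eval, hum, zero_add]
      rfl
    simp only [Expr.eval]
    rw [h1, hu2 aCon rfl, arr2 aCon (by decide) (by decide)]
  rw [run_ite, e1]
  by_cases h1 : s.arr aG m = 0
  · rw [if_pos h1]
    refine ⟨fun h x hx hG => i1 h x ?_ hG, i2⟩
    rcases Nat.lt_succ_iff_lt_or_eq.mp hx with hx | rfl
    exacts [hx, absurd h1 hG]
  rw [if_neg h1, run_ite, e2]
  by_cases h2 : s.arr aCon (projCode q (l + 1) (s1.arr aPos) (row n (s.arr aW) m)) = 0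
  · rw [if_pos h2, run_put]
    exact ⟨fun h => absurd h (by simp [State.setCell_arr, Expr.eval]),
      fun _ => ⟨m, hm, h1, h2⟩⟩
  · rw [if_neg h2]
    refine ⟨fun h x hx hG => ?_, i2⟩
    rcases Nat.lt_succ_iff_lt_or_eq.mp hx with hx | rfl
    exacts [i1 h x hx hG, h2]

/-! ### The set of all tuples -/

theorem run_full (hn : s.reg 1 = n) :
    Represents n q 0 (((full q).run s).arr aG) (((full q).run s).arr aW)
      fun t => ∀ k < n, t k < q := by
  set Good : (ℕ → ℕ → ℕ) → ℕ → ℕ → ℕ → Prop := fun A k c d =>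
    A aG (idx q k c d) ≠ 0 ∧ ∀ h < n, row n (A aW) (idx q k c d) h = if h = k then d else 0
    with hGood
  suffices H : ∀ k < n, ∀ c < q, ∀ d < q, Good ((full q).run s).arr k c d by
    refine ⟨fun _ _ _ _ k hk => absurd hk (Nat.not_lt_zero k), fun i hi a ha b hb =>
      ⟨fun _ => ⟨Nat.zero_le _, fun h => if h = i then a else 0, fun h => if h = i then b else 0,
        fun k _ => ?_, fun k _ => ?_, fun k hk => ?_, if_pos rfl, if_pos rfl⟩,
        fun _ => (H i hi a ha b hb).1⟩,
      fun i hi a ha b hb _ k hk => ?_, fun i hi a ha b hb _ => ?_,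
      fun i hi a ha b hb _ k hk => ?_⟩
    · show (if k = i then a else 0) < q
      split_ifs <;> omega
    · show (if k = i then b else 0) < q
      split_ifs <;> omega
    · show (if k = i then a else 0) = if k = i then b else 0
      rw [if_neg (by omega), if_neg (by omega)]
    · rw [(H i hi a ha b hb).2 k hk]
      split_ifs <;> omega
    · rw [(H i hi a ha b hb).2 i hi, if_pos rfl]
    · rw [(H i hi a ha b hb).2 k (by omega), (H i hi a ha a ha).2 k (by omega),
        if_neg (by omega), if_neg (by omega)]
  have hbody : ∀ (u : State) (k c d : ℕ), u.reg 1 = n → u.reg rK = k → u.reg rC = c →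
      u.reg rD = d → k < n → c < q → d < q →
      let v := (seq (.put aG (idxE q (.reg rK) (.reg rC) (.reg rD)) (.lit 1))
        (.seq (fillRow aW (idxE q (.reg rK) (.reg rC) (.reg rD)) (.lit 0))
        (.put aW (cellE (idxE q (.reg rK) (.reg rC) (.reg rD)) (.reg rK)) (.reg rD)))).run u
      Good v.arr k c d ∧ ∀ k' c' d', c' < q → d' < q → Good u.arr k' c' d' →
        Good v.arr k' c' d' := by
    intro u k c d u1 uk uc ud hk hc hd v
    have hv : v = (seq (.put aG (idxE q (.reg rK) (.reg rC) (.reg rD)) (.lit 1))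
        (.seq (fillRow aW (idxE q (.reg rK) (.reg rC) (.reg rD)) (.lit 0))
        (.put aW (cellE (idxE q (.reg rK) (.reg rC) (.reg rD)) (.reg rK)) (.reg rD)))).run u := rfl
    clear_value v
    rw [run_seq, run_seq, run_put, run_put] at hv
    obtain ⟨w, hw⟩ : ∃ x, x = u.setCell aG ((idxE q (.reg rK) (.reg rC) (.reg rD)).eval u)
      ((Expr.lit 1).eval u) := ⟨_, rfl⟩
    have hidx : ∀ t : State, t.reg rK = k → t.reg rC = c → t.reg rD = d →
        (idxE q (.reg rK) (.reg rC) (.reg rD)).eval t = idx q k c d := by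
      intro t x1 x2 x3
      simp only [eval_idxE, Expr.eval, x1, x2, x3]
    rw [← hw] at hv
    have hfill := run_fillRow (dst := aW) (r := idxE q (.reg rK) (.reg rC) (.reg rD)) (e := .lit 0)
      (s := w) (n := n) (R := idx q k c d) (val := fun _ => 0) (by rw [hw, State.setCell_reg, u1])
      (fun t ht _ => by
        rw [hw, State.setCell_reg] at ht
        exact hidx t (by rw [ht rK (by decide), uk]) (by rw [ht rC (by decide), uc])
          (by rw [ht rD (by decide), ud])) (fun _ _ _ _ _ _ _ => rfl)
    obtain ⟨x, hx⟩ : ∃ x, x = (fillRow aW (idxE q (.reg rK) (.reg rC) (.reg rD)) (.lit 0)).run w :=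
      ⟨_, rfl⟩
    rw [← hx] at hv hfill
    have xr : ∀ y, y ≠ rH → x.reg y = u.reg y := fun y hy => by
      rw [hx, run_reg (by simp [fillRow, writesReg, hy]), hw, State.setCell_reg]
    have hcell : (cellE (idxE q (.reg rK) (.reg rC) (.reg rD)) (.reg rK)).eval x =
        idx q k c d * n + k := by
      rw [eval_cellE, hidx x (by rw [xr rK (by decide), uk]) (by rw [xr rC (by decide), uc])
        (by rw [xr rD (by decide), ud]), xr 1 (by decide), u1]
      simp only [Expr.eval]
      rw [xr rK (by decide), uk]
    have hval : (Expr.reg rD).eval x = d := by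
      simp only [Expr.eval]; rw [xr rD (by decide), ud]
    rw [hcell, hval] at hv
    have vG : ∀ y, v.arr aG y = if y = idx q k c d then 1 else u.arr aG y := by
      intro y
      rw [hv, State.setCell_arr_ne _ (by decide), hx, run_arr rfl, hw, State.setCell_arr,
        hidx u uk uc ud]
      simp [Expr.eval]
    have vW : ∀ y, ∀ h < n, row n (v.arr aW) y h =
        if y = idx q k c d then (if h = k then d else 0) else row n (u.arr aW) y h := by
      intro y h hh
      rw [row, hv, State.setCell_arr]
      have hf := hfill y h hh
      rw [row, hw, State.setCell_arr_ne _ (by decide)] at hf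
      rw [hf]
      by_cases hy : y = idx q k c d
      · rw [if_pos hy, if_pos hy]
        by_cases hhk : h = k
        · rw [if_pos ⟨rfl, by rw [hy, hhk]⟩, if_pos hhk]
        · rw [if_neg fun h' => hhk (row_index_inj hh hk h'.2).2, if_neg hhk]
      · rw [if_neg hy, if_neg fun h' => hy (row_index_inj hh hk h'.2).1, if_neg hy]
    refine ⟨⟨by rw [vG, if_pos rfl]; exact one_ne_zero, fun h hh => by
      rw [vW _ h hh, if_pos rfl]⟩, fun k' c' d' hc' hd' ⟨g1, g2⟩ => ?_⟩
    by_cases hy : idx q k' c' d' = idx q k c d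
    · obtain ⟨rfl, rfl, rfl⟩ := (idx_inj hc' hd' hc hd).1 hy
      exact ⟨by rw [vG, if_pos rfl]; exact one_ne_zero, fun h hh => by
        rw [vW _ h hh, if_pos rfl]⟩
    · exact ⟨by rw [vG, if_neg hy]; exact g1, fun h hh => by
        rw [vW _ h hh, if_neg hy]; exact g2 h hh⟩
  have key := iter_inv (x := rK) (c := 0) (d := 1) (P := .iter rC q 0 (.iter rD q 0
    (.seq (.put aG (idxE q (.reg rK) (.reg rC) (.reg rD)) (.lit 1))
      (.seq (fillRow aW (idxE q (.reg rK) (.reg rC) (.reg rD)) (.lit 0))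
        (.put aW (cellE (idxE q (.reg rK) (.reg rC) (.reg rD)) (.reg rK)) (.reg rD)))))) hn rfl
    (fun m A => ∀ k < m, ∀ c < q, ∀ d < q, Good A k c d)
    (fun k hk => absurd hk (Nat.not_lt_zero k)) ?_
  · rwa [zero_add, one_mul] at key
  intro m hm u hum hu1 hu2 hinv
  rw [zero_add, one_mul] at hm
  have u1 : u.reg 1 = n := by rw [hu1 1 (by decide) rfl, hn]
  have key := iter_inv (x := rC) (c := q) (d := 0) (P := .iter rD q 0
    (.seq (.put aG (idxE q (.reg rK) (.reg rC) (.reg rD)) (.lit 1))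
      (.seq (fillRow aW (idxE q (.reg rK) (.reg rC) (.reg rD)) (.lit 0))
        (.put aW (cellE (idxE q (.reg rK) (.reg rC) (.reg rD)) (.reg rK)) (.reg rD))))) u1 rfl
    (fun m' A => ∀ k c d, c < q → d < q → (k < m ∨ k = m ∧ c < m') → Good A k c d)
    (fun k c d hc hd h => hinv k (by omega) c hc d hd) ?_
  · rw [zero_mul, add_zero] at key
    exact fun k hk c hc d hd => key k c d hc hd (by omega)
  intro m' hm' w hwm hw1 hw2 hinv'
  rw [zero_mul, add_zero] at hm'
  have w1 : w.reg 1 = n := by rw [hw1 1 (by decide) rfl, u1]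
  have key := iter_inv (x := rD) (c := q) (d := 0) (P :=
    (.seq (.put aG (idxE q (.reg rK) (.reg rC) (.reg rD)) (.lit 1))
      (.seq (fillRow aW (idxE q (.reg rK) (.reg rC) (.reg rD)) (.lit 0))
        (.put aW (cellE (idxE q (.reg rK) (.reg rC) (.reg rD)) (.reg rK)) (.reg rD))))) w1 rfl
    (fun m'' A => ∀ k c d, c < q → d < q → (k < m ∨ k = m ∧ (c < m' ∨ c = m' ∧ d < m'')) →
      Good A k c d)
    (fun k c d hc hd h => hinv' k c d hc hd (by omega)) ?_
  · rw [zero_mul, add_zero] at key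
    exact fun k c d hc hd h => key k c d hc hd (by omega)
  intro m'' hm'' x hxm hx1 hx2 hinv'' k c d hc hd h
  rw [zero_mul, add_zero] at hm''
  obtain ⟨g1, g2⟩ := hbody x m m' m'' (by rw [hx1 1 (by decide) rfl, w1])
    (by rw [hx1 rK (by decide) rfl, hw1 rK (by decide) rfl, hum])
    (by rw [hx1 rC (by decide) rfl, hwm]) hxm hm hm' hm''
  by_cases heq : k = m ∧ c = m' ∧ d = m''
  · obtain ⟨rfl, rfl, rfl⟩ := heq
    exact g1
  · exact g2 k c d hc hd (hinv'' k c d hc hd (by omega))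

end Code
end RAM

namespace Maltsev

variable {n q : ℕ} {f : ℕ → ℕ → ℕ → ℕ}

/-! ### Elimination of variables -/

open Classical in
/-- The number of values that `t` may take at `j` without a change before `j` is odd. This depends
on `t` through its value at `j` only. -/
def OddAt (q : ℕ) (S : (ℕ → ℕ) → Prop) (j : ℕ) (t : ℕ → ℕ) : Prop :=
  Odd ((Finset.range q).filter fun d => sig S j (t j) d).card

/-- The relation `S` after the elimination of its last `e` variables. The positions remain; the
eliminated positions only take values that occur an odd number of times. -/
def eliminated (n q : ℕ) (S : (ℕ → ℕ) → Prop) : ℕ → (ℕ → ℕ) → Prop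
  | 0 => S
  | e + 1 => fun t => eliminated n q S e t ∧ OddAt q (eliminated n q S e) (n - 1 - e) t

open Classical in
/-- For a tuple `u` of a closed relation `T` which represents the relation `P'` of arity `j + 1`,
the number of extensions of the beginning of `u` in `P'` is odd if and only if `OddAt` holds. -/
theorem oddAt_iff (hf : IsOp q f) {T P P' : (ℕ → ℕ) → Prop} {j : ℕ} (hj : j < n)
    (hT : IsRel n q f T) (hP' : ∀ t, P' t ↔ ∃ u, T u ∧ ∀ k < j + 1, u k = t k)
    (hrec : ∀ t, (∀ k < j, t k < q) →
      (P t ↔ Odd ((Finset.range q).filter fun c => P' (Function.update t j c)).card))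
    {u : ℕ → ℕ} (hu : T u) : OddAt q T j u ↔ P u := by
  rw [hrec u fun k hk => hT.lt u hu k (hk.trans hj), OddAt]
  refine iff_of_eq (congrArg (fun s : Finset ℕ => Odd s.card) (Finset.filter_congr fun c _ => ?_))
  rw [hP']
  constructor
  · intro h
    obtain ⟨w, hw, hwu, hwc⟩ := hT.exists_of_sig hf hj h hu rfl
    refine ⟨w, hw, fun k hk => ?_⟩
    rcases Nat.lt_succ_iff_lt_or_eq.mp hk with hk | rfl
    · rw [Function.update_of_ne hk.ne, hwu k hk]
    · rw [Function.update_self, hwc]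
  · rintro ⟨w, hw, hwu⟩
    refine ⟨u, w, hu, hw, fun k hk => ?_, rfl, ?_⟩
    · rw [hwu k (by omega), Function.update_of_ne hk.ne]
    · rw [hwu j (Nat.lt_succ_self j), Function.update_self]

open Classical in
/-- If the relations `P n = S, P (n - 1), …, P 0` arise by counting the values of the last variable
modulo two, and all of them are closed, then `eliminated n q S e` projects onto `P (n - e)`. -/
theorem eliminated_spec (hf : IsOp q f) {S : (ℕ → ℕ) → Prop} {P : ℕ → (ℕ → ℕ) → Prop}
    (hn : P n = S) (hP : ∀ j ≤ n, IsRel j q f (P j))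
    (hrec : ∀ j < n, ∀ t, (∀ k < j, t k < q) → (P j t ↔
      Odd ((Finset.range q).filter fun c => P (j + 1) (Function.update t j c)).card))
    {e : ℕ} (he : e ≤ n) :
    IsRel n q f (eliminated n q S e) ∧
      ∀ t, P (n - e) t ↔ ∃ u, eliminated n q S e u ∧ ∀ k < n - e, u k = t k := by
  induction e with
  | zero =>
    have hS : IsRel n q f S := hn ▸ hP n le_rfl
    refine ⟨hS, fun t => ?_⟩
    rw [Nat.sub_zero, hn]
    exact ⟨fun h => ⟨t, h, fun _ _ => rfl⟩, fun ⟨u, hu, hut⟩ => hS.ext _ _ hut hu⟩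
  | succ e ih =>
    obtain ⟨hT, hproj⟩ := ih (by omega)
    have hj : n - (e + 1) < n := by omega
    have hj1 : n - e = n - (e + 1) + 1 := by omega
    have hj2 : n - 1 - e = n - (e + 1) := by omega
    simp only [eliminated, hj2]
    rw [hj1] at hproj
    generalize n - (e + 1) = j at *
    have hPj := hP j hj.le
    have hodd : ∀ u, eliminated n q S e u → (OddAt q (eliminated n q S e) j u ↔ P j u) :=
      fun u hu => oddAt_iff hf hj hT hproj (hrec j hj) hu
    refine ⟨⟨fun t t' h ht => ?_, fun t ht => hT.lt t ht.1, fun x y z hx hy hz => ?_⟩,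
      fun t => ⟨fun h => ?_, ?_⟩⟩
    · have h' := hT.ext _ _ h ht.1
      exact ⟨h', (hodd _ h').2 (hPj.ext _ _ (fun k hk => h k (hk.trans hj))
        ((hodd _ ht.1).1 ht.2))⟩
    · have h' := hT.closed _ _ _ hx.1 hy.1 hz.1
      exact ⟨h', (hodd _ h').2 (hPj.closed _ _ _ ((hodd _ hx.1).1 hx.2)
        ((hodd _ hy.1).1 hy.2) ((hodd _ hz.1).1 hz.2))⟩
    · have h1 := (hrec j hj t (hPj.lt t h)).1 h
      obtain ⟨c, hc⟩ := Finset.card_pos.1 h1.pos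
      obtain ⟨u, hu, hut⟩ := (hproj _).1 (Finset.mem_filter.1 hc).2
      have hut' : ∀ k < j, u k = t k := fun k hk => by
        rw [hut k (by omega), Function.update_of_ne hk.ne]
      exact ⟨u, ⟨hu, (hodd u hu).2 (hPj.ext _ _ (fun k hk => (hut' k hk).symm) h)⟩, hut'⟩
    · rintro ⟨u, ⟨hu, hu'⟩, hut⟩
      exact hPj.ext _ _ hut ((hodd u hu).1 hu')

end Maltsev

namespace RAM

open Maltsev

namespace Code

variable {n q l j : ℕ} {f : ℕ → ℕ → ℕ → ℕ} {S : (ℕ → ℕ) → Prop} {s : State}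

theorem run_oddTable (hn : s.reg 1 = n) (hj : s.reg rF = j) :
    ∀ c < q, ((oddTable q).run s).arr aOdd c =
      ((Finset.range q).filter fun d => s.arr aG (idx q j c d) ≠ 0).card % 2 := by
  have key := iter_inv (x := rC) (c := q) (d := 0) (P := .seq (.put aOdd (.reg rC) (.lit 0))
    (.iter rD q 0 (.ite (.get aG (idxE q (.reg rF) (.reg rC) (.reg rD)))
      (.put aOdd (.reg rC) (.sub (.lit 1) (.get aOdd (.reg rC)))) .skip))) hn rfl
    (fun m A => ∀ c < m, A aOdd c =
      ((Finset.range q).filter fun d => s.arr aG (idx q j c d) ≠ 0).card % 2)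
    (fun c hc => absurd hc (Nat.not_lt_zero c)) ?_
  · rwa [zero_mul, add_zero] at key
  intro m hm u hum hu1 hu2 hinv
  rw [run_seq, run_put]
  obtain ⟨w, hw⟩ : ∃ x, x = u.setCell aOdd ((Expr.reg rC).eval u) ((Expr.lit 0).eval u) := ⟨_, rfl⟩
  rw [← hw]
  have w1 : w.reg 1 = n := by rw [hw, State.setCell_reg, hu1 1 (by decide) rfl, hn]
  have wC : w.reg rC = m := by rw [hw, State.setCell_reg, hum]
  have wF : w.reg rF = j := by rw [hw, State.setCell_reg, hu1 rF (by decide) rfl, hj]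
  have wG : w.arr aG = s.arr aG := by
    rw [hw, State.setCell_arr_ne _ (by decide), hu2 aG rfl]
  have key := iter_inv (x := rD) (c := q) (d := 0)
    (P := .ite (.get aG (idxE q (.reg rF) (.reg rC) (.reg rD)))
      (.put aOdd (.reg rC) (.sub (.lit 1) (.get aOdd (.reg rC)))) .skip) w1 rfl
    (fun m' A => (∀ c < m, A aOdd c =
      ((Finset.range q).filter fun d => s.arr aG (idx q j c d) ≠ 0).card % 2) ∧ A aOdd m =
      ((Finset.range m').filter fun d => s.arr aG (idx q j m d) ≠ 0).card % 2)
    ⟨fun c hc => by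
      rw [hw, State.setCell_arr, if_neg (by simp only [Expr.eval, hum]; omega)]
      exact hinv c hc, by simp [hw, State.setCell_arr, Expr.eval, hum]⟩ ?_
  · rw [zero_mul, add_zero] at key
    intro c hc
    rcases Nat.lt_succ_iff_lt_or_eq.mp hc with hc | rfl
    exacts [key.1 c hc, key.2]
  rintro m' hm' x hxm hx1 hx2 ⟨i1, i2⟩
  have hG : (Expr.get aG (idxE q (.reg rF) (.reg rC) (.reg rD))).eval x =
      s.arr aG (idx q j m m') := by
    simp only [Expr.eval, eval_idxE]
    rw [hx2 aG rfl, wG, hx1 rF (by decide) rfl, hx1 rC (by decide) rfl, wF, wC, hxm]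
  rw [run_ite, hG, Finset.range_add_one, Finset.filter_insert]
  by_cases h : s.arr aG (idx q j m m') = 0
  · rw [if_pos h, if_neg (not_not.2 h)]
    exact ⟨i1, i2⟩
  · rw [if_neg h, if_pos h, Finset.card_insert_of_notMem (by simp), run_put]
    have xC : (Expr.reg rC).eval x = m := by
      simp only [Expr.eval]; rw [hx1 rC (by decide) rfl, wC]
    have xv : (Expr.sub (.lit 1) (.get aOdd (.reg rC))).eval x = 1 - x.arr aOdd m := by
      rw [← xC]; rfl
    rw [xC, xv, i2]
    refine ⟨fun c hc => ?_, ?_⟩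
    · rw [State.setCell_arr, if_neg (by omega)]; exact i1 c hc
    · rw [State.setCell_arr, if_pos ⟨rfl, rfl⟩]; omega

/-- The elimination of a variable is an update with a unary constraint, given as a constraint whose
scope repeats this variable. -/
theorem run_eliminate (hf : IsOp q f) (hS : IsRel n q f S) (hl : 0 < l) (hn : s.reg 1 = n)
    (hT : Tables q l f s.arr) {e : ℕ} (he : s.reg rE = e) (hen : e < n)
    (hSX : IsRel n q f fun t => S t ∧ OddAt q S (n - 1 - e) t)
    (hR : Represents n q 0 (s.arr aG) (s.arr aW) S) :
    Represents n q 0 (((eliminate q l).run s).arr aG) (((eliminate q l).run s).arr aW)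
      fun t => S t ∧ OddAt q S (n - 1 - e) t := by
  classical
  rw [eliminate, run_seq, run_seq, run_seq, run_seq]
  have hj : n - 1 - e < n := by omega
  obtain ⟨j, hjdef⟩ : ∃ j, j = n - 1 - e := ⟨_, rfl⟩
  rw [← hjdef] at hSX hj ⊢
  obtain ⟨s1, hs1⟩ : ∃ x, x = (set rF (.sub (.sub (.reg 1) (.lit 1)) (.reg rE))).run s := ⟨_, rfl⟩
  obtain ⟨s2, hs2⟩ : ∃ x, x = (oddTable q).run s1 := ⟨_, rfl⟩
  obtain ⟨s3, hs3⟩ : ∃ x, x = (iter rY (q ^ (l + 1)) 0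
    (.put aCon (.reg rY) (.get aOdd (.get aFirst (.reg rY))))).run s2 := ⟨_, rfl⟩
  obtain ⟨s4, hs4⟩ : ∃ x, x = (iter rL l 0 (.put aScope (.reg rL) (.reg rF))).run s3 := ⟨_, rfl⟩
  rw [← hs1, ← hs2, ← hs3, ← hs4]
  have n1 : s1.reg 1 = n := by rw [hs1, run_reg rfl, hn]
  have n2 : s2.reg 1 = n := by rw [hs2, run_reg rfl, n1]
  have n3 : s3.reg 1 = n := by rw [hs3, run_reg rfl, n2]
  have n4 : s4.reg 1 = n := by rw [hs4, run_reg rfl, n3]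
  have j1 : s1.reg rF = j := by
    rw [hs1, hjdef, Code.run, State.setReg_reg, if_pos rfl]
    simp only [Expr.eval, hn, he]
  have j3 : s3.reg rF = j := by rw [hs3, run_reg rfl, hs2, run_reg rfl, j1]
  have a1 : s1.arr = s.arr := by rw [hs1]; rfl
  have t2 : Tables q l f s2.arr := hT.of_keeps (oddTable q) rfl
    fun b h => by rw [hs2, run_arr h, a1]
  have t3 : Tables q l f s3.arr := t2.of_keeps (.put aCon (.lit 0) (.lit 0)) rfl
    fun b h => by rw [hs3, run_arr (by simpa [writesArr] using h)]
  have t4 : Tables q l f s4.arr := t3.of_keeps (.put aScope (.lit 0) (.lit 0)) rfl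
    fun b h => by rw [hs4, run_arr (by simpa [writesArr] using h)]
  have hodd := run_oddTable (q := q) n1 j1
  rw [← hs2, a1] at hodd
  have hcon := run_fill (x := rY) (c := q ^ (l + 1)) (d := 0) (a := aCon)
    (e := .get aOdd (.get aFirst (.reg rY))) (val := fun y => s2.arr aOdd (s2.arr aFirst y)) n2
    (fun k hk u h1 h2 h3 => by
      simp only [Expr.eval, h1, h3 aOdd (by decide), h3 aFirst (by decide)])
  have hsc := run_fill (x := rL) (c := l) (d := 0) (a := aScope)
    (e := .reg rF) (val := fun _ => j) n3
    (fun k hk u h1 h2 h3 => by simp only [Expr.eval]; rw [h2 rF (by decide), j3])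
  rw [zero_mul, add_zero] at hcon hsc
  rw [← hs3] at hcon
  rw [← hs4] at hsc
  have con4 : s4.arr aCon = s3.arr aCon := by rw [hs4, run_arr rfl]
  have g4 : s4.arr aG = s.arr aG := by
    rw [hs4, run_arr rfl, hs3, run_arr rfl, hs2, run_arr rfl, a1]
  have w4 : s4.arr aW = s.arr aW := by
    rw [hs4, run_arr rfl, hs3, run_arr rfl, hs2, run_arr rfl, a1]
  refine run_update hf hS hSX hl n4 t4 (by rw [g4, w4]; exact hR)
    ⟨fun x hx => by rw [hsc x hx]; exact hj, fun t ht i hi => ?_⟩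
  have hp : ∀ x < l + 1, scopeVec l (s4.arr aScope) i x < n :=
    scopeVec_lt (fun x hx => by rw [hsc x hx]; exact hj) hi
  have hlt := hS.projCode_lt hp ht
  have htj := hS.lt t ht j hj
  rw [con4, hcon _ hlt, t2.first _ hlt, projCode,
    digit_enc (fun x hx => hS.lt t ht _ (hp x hx)) (Nat.succ_pos l),
    scopeVec, if_pos hl, hsc 0 hl, hodd _ htj, OddAt, Nat.odd_iff, Nat.mod_two_ne_zero]
  refine iff_of_eq (congrArg (fun s : Finset ℕ => s.card % 2 = 1)
    (Finset.filter_congr fun d hd => ?_))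
  rw [hR.flag j hj _ htj d (Finset.mem_range.1 hd)]
  exact ⟨fun h => h.2, fun h => ⟨Nat.zero_le _, h⟩⟩

/-- After the elimination of all variables, the answer is whether any tuple has survived. -/
theorem run_finish (hf : IsOp q f) (hl : 0 < l) (hn : s.reg 1 = n) (hn0 : 0 < n)
    (hT : Tables q l f s.arr) (hS : ∀ e ≤ n, IsRel n q f (eliminated n q S e))
    (hR : Represents n q 0 (s.arr aG) (s.arr aW) S) :
    ((∃ t, eliminated n q S n t) → ((finish q l).run s).reg 0 = 1) ∧
    ((¬ ∃ t, eliminated n q S n t) → ((finish q l).run s).reg 0 = 0) := by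
  rw [finish, run_seq, run_seq, run_seq, run_put]
  have key := iter_inv (x := rE) (c := 0) (d := 1) (P := eliminate q l) hn rfl
    (fun m A => Represents n q 0 (A aG) (A aW) (eliminated n q S m)) hR ?_
  · rw [zero_add, one_mul] at key
    obtain ⟨s1, hs1⟩ : ∃ x, x = (iter rE 0 1 (eliminate q l)).run s := ⟨_, rfl⟩
    obtain ⟨s2, hs2⟩ : ∃ x, x = s1.setCell aFound ((Expr.lit 0).eval s1) ((Expr.lit 0).eval s1) :=
      ⟨_, rfl⟩
    rw [← hs1] at key ⊢
    rw [← hs2]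
    have n2 : s2.reg 1 = n := by rw [hs2, State.setCell_reg, hs1, run_reg rfl, hn]
    have g2 : s2.arr aG = s1.arr aG := by rw [hs2, State.setCell_arr_ne _ (by decide)]
    have key2 := iter_inv (x := rC) (c := q) (d := 0)
      (P := .ite (.get aG (idxE q (.lit 0) (.reg rC) (.reg rC)))
        (.put aFound (.lit 0) (.lit 1)) .skip) n2 rfl
      (fun m A => (A aFound 0 = 1 ∧ ∃ c < q, s1.arr aG (idx q 0 c c) ≠ 0) ∨
        (A aFound 0 = 0 ∧ ∀ c < m, s1.arr aG (idx q 0 c c) = 0))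
      (Or.inr ⟨by simp [hs2, State.setCell_arr, Expr.eval],
        fun c hc => absurd hc (Nat.not_lt_zero c)⟩) ?_
    · rw [zero_mul, add_zero] at key2
      rw [Code.run, State.setReg_reg, if_pos rfl]
      simp only [Expr.eval]
      have hiff : (∃ t, eliminated n q S n t) ↔ ∃ c < q, s1.arr aG (idx q 0 c c) ≠ 0 := by
        constructor
        · rintro ⟨t, ht⟩
          have hc := (hS n le_rfl).lt t ht 0 hn0
          exact ⟨t 0, hc, (key.flag 0 hn0 _ hc _ hc).2
            ⟨le_rfl, t, t, ht, ht, fun _ _ => rfl, rfl, rfl⟩⟩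
        · rintro ⟨c, hc, hG⟩
          obtain ⟨-, t, -, ht, -⟩ := (key.flag 0 hn0 c hc c hc).1 hG
          exact ⟨t, ht⟩
      rw [hiff]
      rcases key2 with ⟨h1, h2⟩ | ⟨h1, h2⟩
      · exact ⟨fun _ => h1, fun h => absurd h2 h⟩
      · exact ⟨fun ⟨c, hc, h⟩ => absurd (h2 c hc) h, fun _ => h1⟩
    intro m hm u hum hu1 hu2 hinv
    rw [zero_mul, add_zero] at hm
    have hG : (Expr.get aG (idxE q (.lit 0) (.reg rC) (.reg rC))).eval u =
        s1.arr aG (idx q 0 m m) := by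
      simp only [Expr.eval, eval_idxE, hum, hu2 aG rfl, g2]
    rw [run_ite, hG]
    by_cases h : s1.arr aG (idx q 0 m m) = 0
    · rw [if_pos h]
      refine hinv.imp_right fun ⟨h1, h2⟩ => ⟨h1, fun c hc => ?_⟩
      rcases Nat.lt_succ_iff_lt_or_eq.mp hc with hc | rfl
      exacts [h2 c hc, h]
    · rw [if_neg h, run_put]
      exact Or.inl ⟨by simp [State.setCell_arr, Expr.eval], m, hm, h⟩
  intro m hm u hum hu1 hu2 hinv
  rw [zero_add, one_mul] at hm
  exact run_eliminate hf (hS m hm.le) hl (by rw [hu1 1 (by decide) rfl, hn])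
    (hT.of_keeps (eliminate q l) rfl hu2) hum hm (hS (m + 1) hm) hinv

end Code
end RAM

/-! ### The modular clone on tuples of numbers -/

namespace Maltsev

variable {L : Language} {H : Type*} {q k : ℕ}

/-- The tuples with an odd number of extensions by one entry in `R`. -/
def oddProj (R : Set (Fin (k + 1) → H)) : Set (Fin k → H) :=
  {a | Odd (Nat.card {c : H // Fin.snoc (α := fun _ => H) a c ∈ R})}

theorem oddProj_mem_modularClone [L.Structure H] {R : Set (Fin (k + 1) → H)}
    (hR : R ∈ modularClone L H 2 (k + 1)) : oddProj R ∈ modularClone L H 2 k := by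
  obtain ⟨φ, rfl⟩ := hR
  refine ⟨.quant 1 φ, Set.ext fun a => ?_⟩
  have h : Nat.card {b : Fin 1 → H // Fin.append a b ∈ φ.eval H 2} =
      Nat.card {c : H // Fin.snoc (α := fun _ => H) a c ∈ φ.eval H 2} :=
    Nat.card_congr ((Equiv.funUnique (Fin 1) H).subtypeEquiv fun b => by
      rw [Fin.append_right_eq_snoc]; rfl)
  change ¬ 2 ∣ _ ↔ Odd _
  rw [h, ← even_iff_two_dvd, Nat.not_even_iff_odd]

/-- The quantifier `∃^{≡2}` preserves the parity of the number of tuples. -/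
theorem odd_card_oddProj [Finite H] (R : Set (Fin (k + 1) → H)) :
    Odd (Nat.card (oddProj R)) ↔ Odd (Nat.card R) := by
  classical
  have := Fintype.ofFinite H
  have E : R ≃ Σ a : Fin k → H, {c : H // Fin.snoc (α := fun _ => H) a c ∈ R} :=
    { toFun := fun x => ⟨Fin.init x.1, x.1 (Fin.last k), by rw [Fin.snoc_init_self]; exact x.2⟩
      invFun := fun y => ⟨Fin.snoc (α := fun _ => H) y.1 y.2.1, y.2.2⟩
      left_inv := fun x => Subtype.ext (Fin.snoc_init_self _)
      right_inv := by
        rintro ⟨a, c, h⟩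
        have h1 : Fin.init (Fin.snoc (α := fun _ => H) a c) = a := Fin.init_snoc _ _
        have h2 : Fin.snoc (α := fun _ => H) a c (Fin.last k) = c := Fin.snoc_last _ _
        refine Sigma.ext h1 ?_
        exact (Subtype.heq_iff_coe_eq fun x => iff_of_eq (congrArg
          (fun b : Fin k → H => Fin.snoc (α := fun _ => H) b x ∈ R) h1)).2 h2 }
  rw [Nat.card_congr E, Nat.card_sigma, Finset.odd_sum_iff_odd_card_odd]
  refine iff_of_eq (congrArg Odd (Nat.subtype_card _ fun a => ?_))
  rw [Finset.mem_filter]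
  exact and_iff_right (Finset.mem_univ a)

/-- The relations that arise from a relation in the clone when its variables are eliminated one
after the other. -/
theorem exists_elimination_chain [L.Structure H] {n : ℕ} {R : Set (Fin n → H)}
    (hR : R ∈ modularClone L H 2 n) : ∃ P : ∀ j, Set (Fin j → H), P n = R ∧
      (∀ j ≤ n, P j ∈ modularClone L H 2 j) ∧ ∀ j < n, P j = oddProj (P (j + 1)) := by
  induction n with
  | zero =>
    refine ⟨Function.update (fun _ => ∅) 0 R, Function.update_self _ _ _, fun j hj => ?_,
      fun j hj => absurd hj (Nat.not_lt_zero j)⟩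
    obtain rfl := Nat.le_zero.1 hj
    rwa [Function.update_self]
  | succ n ih =>
    obtain ⟨P, h1, h2, h3⟩ := ih (oddProj_mem_modularClone hR)
    refine ⟨Function.update P (n + 1) R, Function.update_self _ _ _, fun j hj => ?_,
      fun j hj => ?_⟩
    · rcases Nat.le_succ_iff.mp hj with hj | rfl
      · rw [Function.update_of_ne (by omega)]
        exact h2 j hj
      · rwa [Function.update_self]
    · rw [Function.update_of_ne (by omega)]
      rcases Nat.lt_succ_iff_lt_or_eq.mp hj with hj | rfl
      · rw [Function.update_of_ne (by omega)]
        exact h3 j hj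
      · rw [Function.update_self, h1]

/-- A relation on `H` as a set of sequences of numbers, for a numbering of `H`. -/
def lift (eH : H ≃ Fin q) (R : Set (Fin k → H)) (t : ℕ → ℕ) : Prop :=
  ∃ x ∈ R, ∀ i : Fin k, t i = eH (x i)

theorem lift_iff {eH : H ≃ Fin q} {R : Set (Fin k → H)} {t : ℕ → ℕ} {x : Fin k → H}
    (h : ∀ i : Fin k, t i = eH (x i)) : lift eH R t ↔ x ∈ R := by
  refine ⟨fun ⟨y, hy, hyt⟩ => ?_, fun hx => ⟨x, hx, h⟩⟩
  have : x = y := funext fun i => eH.injective (Fin.ext (by rw [← h, ← hyt]))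
  rwa [this]

theorem exists_coords (eH : H ≃ Fin q) {t : ℕ → ℕ} (ht : ∀ i < k, t i < q) :
    ∃ x : Fin k → H, ∀ i : Fin k, t i = eH (x i) :=
  ⟨fun i => eH.symm ⟨t i, ht i i.2⟩, fun i => by simp⟩

/-- An operation on `H` as an operation on numbers, for a numbering of `H`. -/
def liftOp (eH : H ≃ Fin q) (f : H → H → H → H) (a b c : ℕ) : ℕ :=
  if h : a < q ∧ b < q ∧ c < q then
    eH (f (eH.symm ⟨a, h.1⟩) (eH.symm ⟨b, h.2.1⟩) (eH.symm ⟨c, h.2.2⟩)) else 0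

theorem liftOp_apply (eH : H ≃ Fin q) (f : H → H → H → H) (x y z : H) :
    liftOp eH f (eH x) (eH y) (eH z) = eH (f x y z) := by
  rw [liftOp, dif_pos ⟨(eH x).2, (eH y).2, (eH z).2⟩]
  simp

theorem isOp_liftOp (eH : H ≃ Fin q) {f : H → H → H → H} (hf : IsMaltsev f) :
    IsOp q (liftOp eH f) := by
  have lt : ∀ {a}, a < q → ∃ x, a = (eH x : ℕ) := fun ha => ⟨eH.symm ⟨_, ha⟩, by simp⟩
  refine ⟨fun a b c ha hb hc => ?_, fun a b ha hb => ?_, fun a b ha hb => ?_⟩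
  · rw [liftOp, dif_pos ⟨ha, hb, hc⟩]
    exact Fin.is_lt _
  all_goals
    obtain ⟨x, rfl⟩ := lt ha
    obtain ⟨y, rfl⟩ := lt hb
    rw [liftOp_apply]
  · rw [(hf x y).1]
  · rw [(hf x y).2]

theorem isRel_lift (eH : H ≃ Fin q) {f : H → H → H → H} {R : Set (Fin k → H)}
    (hR : IsPolymorphism₃ f R) : IsRel k q (liftOp eH f) (lift eH R) := by
  refine ⟨fun t t' h => ?_, fun t => ?_, fun u v w => ?_⟩
  · rintro ⟨x, hx, hxt⟩
    exact ⟨x, hx, fun i => by rw [← h i i.2, hxt]⟩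
  · rintro ⟨x, hx, hxt⟩ i hi
    rw [hxt ⟨i, hi⟩]
    exact Fin.is_lt _
  · rintro ⟨x, hx, hxt⟩ ⟨y, hy, hyt⟩ ⟨z, hz, hzt⟩
    refine ⟨_, hR x hx y hy z hz, fun i => ?_⟩
    simp only [hxt, hyt, hzt, liftOp_apply]

open Classical in
theorem lift_oddProj_iff (eH : H ≃ Fin q) (R : Set (Fin (k + 1) → H)) {t : ℕ → ℕ}
    (ht : ∀ i < k, t i < q) : lift eH (oddProj R) t ↔
      Odd ((Finset.range q).filter fun c => lift eH R (Function.update t k c)).card := by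
  obtain ⟨x, hx⟩ := exists_coords eH ht
  rw [lift_iff hx]
  have hc : ∀ c : H, lift eH R (Function.update t k (eH c : ℕ)) ↔
      Fin.snoc (α := fun _ => H) x c ∈ R := fun c => by
    refine lift_iff fun i => ?_
    induction i using Fin.lastCases with
    | last => simp
    | cast i =>
      rw [Fin.snoc_castSucc, ← hx, Fin.val_castSucc, Function.update_of_ne i.2.ne]
  have h : Nat.card {c : H // Fin.snoc (α := fun _ => H) x c ∈ R} =
      Nat.card {d // d ∈ (Finset.range q).filter fun c => lift eH R (Function.update t k c)} :=
    Nat.card_congr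
      { toFun := fun c => ⟨eH c.1, by
          rw [Finset.mem_filter, hc]; exact ⟨Finset.mem_range.2 (Fin.is_lt _), c.2⟩⟩
        invFun := fun d => ⟨eH.symm ⟨d.1, Finset.mem_range.1 (Finset.mem_filter.1 d.2).1⟩, by
          rw [← hc, Equiv.apply_symm_apply]; exact (Finset.mem_filter.1 d.2).2⟩
        left_inv := fun c => by simp
        right_inv := fun d => by simp }
  change Odd _ ↔ _
  rw [h, Nat.subtype_card _ fun _ => Iff.rfl]

/-- For a relation in the clone, elimination stays within the relations closed under the Mal'tsev
operation, and some tuple survives if and only if the number of tuples is odd. -/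
theorem eliminated_lift [L.Structure H] [Finite H] (eH : H ≃ Fin q) {f : H → H → H → H}
    (hf : IsMaltsev f) (hpol : ∀ n, ∀ R ∈ modularClone L H 2 n, IsPolymorphism₃ f R) {n : ℕ}
    {R : Set (Fin n → H)} (hR : R ∈ modularClone L H 2 n) :
    (∀ e ≤ n, IsRel n q (liftOp eH f) (eliminated n q (lift eH R) e)) ∧
    ((∃ t, eliminated n q (lift eH R) n t) ↔ Odd (Nat.card R)) := by
  classical
  obtain ⟨P, rfl, hP, hrec⟩ := exists_elimination_chain hR
  have spec := fun e (he : e ≤ n) => eliminated_spec (isOp_liftOp eH hf)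
    (P := fun j => lift eH (P j)) rfl (fun j hj => isRel_lift eH (hpol j _ (hP j hj)))
    (fun j hj t ht => by
      rw [hrec j hj, lift_oddProj_iff eH _ ht]) he
  refine ⟨fun e he => (spec e he).1, ?_⟩
  have h0 : (∃ t, eliminated n q (lift eH (P n)) n t) ↔ (P 0).Nonempty := by
    have h := (spec n le_rfl).2
    constructor
    · rintro ⟨t, ht⟩
      obtain ⟨x, hx, -⟩ := (h t).2 ⟨t, ht, fun _ _ => rfl⟩
      revert x
      rw [Nat.sub_self]
      exact fun x hx => ⟨x, hx⟩
    · rintro ⟨x, hx⟩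
      obtain ⟨u, hu, -⟩ := (h fun _ => 0).1 (by
        rw [Nat.sub_self]; exact ⟨x, hx, fun i => i.elim0⟩)
      exact ⟨u, hu⟩
  have h1 : Odd (Nat.card (P 0)) ↔ (P 0).Nonempty := by
    rcases (P 0).eq_empty_or_nonempty with h | h
    · simp [h]
    · have : Unique (P 0) := ⟨⟨⟨_, h.some_mem⟩⟩, fun _ => Subsingleton.elim _ _⟩
      simp [h]
  have h2 : ∀ j ≤ n, (Odd (Nat.card (P j)) ↔ Odd (Nat.card (P 0))) := by
    intro j
    induction j with
    | zero => exact fun _ => Iff.rfl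
    | succ j ih =>
      intro hj
      rw [← ih (by omega), hrec j hj, odd_card_oddProj]
  rw [h0, ← h1, h2 n le_rfl]

end Maltsev

/-! ### Instances -/

namespace Maltsev

variable {L : Language} {H : Type*} [L.Structure H] {q n r l : ℕ}

/-- The solutions of a list of constraints. -/
def solutions (H : Type*) [L.Structure H] (cs : List (Constraint L n)) : Set (Fin n → H) :=
  {φ | ∀ c ∈ cs, Language.Structure.RelMap c.symbol fun i => φ (c.scope i)}

theorem solutions_mem_modularClone (cs : List (Constraint L n)) :
    solutions H cs ∈ modularClone L H 2 n := by
  refine ⟨.conj (cs.map fun c => .rel c.symbol c.scope), Set.ext fun a => ?_⟩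
  simp only [MPPFormula.eval, solutions, Set.mem_ofPred_eq, List.forall_mem_map, PPAtom.Holds]

/-- One constraint on tuples of numbers. -/
def satisfies (eH : H ≃ Fin q) (c : Constraint L n) (t : ℕ → ℕ) : Prop :=
  ∃ x : Fin c.arity → H, Language.Structure.RelMap c.symbol x ∧ ∀ i, t (c.scope i) = eH (x i)

theorem lift_solutions_nil (eH : H ≃ Fin q) :
    lift eH (solutions H ([] : List (Constraint L n))) = fun t => ∀ k < n, t k < q := by
  funext t
  refine propext ⟨?_, fun h => ?_⟩
  · rintro ⟨x, -, hx⟩ k hk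
    rw [hx ⟨k, hk⟩]
    exact Fin.is_lt _
  · obtain ⟨x, hx⟩ := exists_coords eH h
    exact ⟨x, fun c hc => absurd hc List.not_mem_nil, hx⟩

theorem lift_solutions_append (eH : H ≃ Fin q) (cs : List (Constraint L n)) (c : Constraint L n) :
    lift eH (solutions H (cs ++ [c])) = fun t => lift eH (solutions H cs) t ∧ satisfies eH c t := by
  funext t
  refine propext ⟨?_, ?_⟩
  · rintro ⟨x, hx, hxt⟩
    exact ⟨⟨x, fun d hd => hx d (List.mem_append_left _ hd), hxt⟩, _,
      hx c (List.mem_append_right _ (List.mem_singleton_self c)), fun i => hxt _⟩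
  · rintro ⟨⟨x, hx, hxt⟩, y, hy, hyt⟩
    refine ⟨x, fun d hd => ?_, hxt⟩
    rcases List.mem_append.1 hd with hd | hd
    · exact hx d hd
    · obtain rfl := List.mem_singleton.1 hd
      have : (fun i => x (d.scope i)) = y :=
        funext fun i => eH.injective (Fin.ext (by rw [← hxt, hyt]))
      rwa [this]

/-- A positive number that no arity exceeds. -/
def arityBound (e : (Σ l, L.Relations l) ≃ Fin r) : ℕ :=
  (Finset.univ.sup fun s : Fin r => (e.symm s).1) + 1

theorem arity_le_arityBound (e : (Σ l, L.Relations l) ≃ Fin r) (c : Constraint L n) :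
    c.arity ≤ arityBound e := by
  have h : (e.symm (e ⟨c.arity, c.symbol⟩)).1 ≤ Finset.univ.sup fun s : Fin r => (e.symm s).1 :=
    Finset.le_sup (f := fun s : Fin r => (e.symm s).1) (Finset.mem_univ _)
  rw [e.symm_apply_apply] at h
  exact Nat.le_succ_of_le h

/-- The arities of the symbols. -/
def arityTable (e : (Σ l, L.Relations l) ≃ Fin r) (s : ℕ) : ℕ :=
  if h : s < r then (e.symm ⟨s, h⟩).1 else 0

theorem arityTable_apply (e : (Σ l, L.Relations l) ≃ Fin r) (p : Σ l, L.Relations l) :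
    arityTable e (e p) = p.1 := by
  rw [arityTable, dif_pos (e p).2, Fin.eta, e.symm_apply_apply]

open Classical in
/-- The relations of the structure on codes of tuples of length `l + 1`, of which a beginning is
used; the entries for a symbol form a block of length `q ^ (l + 1)`. -/
noncomputable def relTable (e : (Σ l, L.Relations l) ≃ Fin r) (eH : H ≃ Fin q) (l y : ℕ) : ℕ :=
  if ∃ (p : Σ l, L.Relations l) (x : Fin p.1 → H), y / q ^ (l + 1) = e p ∧
    Language.Structure.RelMap p.2 x ∧ ∀ i : Fin p.1, digit q (y % q ^ (l + 1)) i = eH (x i)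
  then 1 else 0

theorem relTable_ne_zero_iff (e : (Σ l, L.Relations l) ≃ Fin r) (eH : H ≃ Fin q) {k : ℕ}
    (R : L.Relations k) {v : ℕ} (hv : v < q ^ (l + 1)) :
    relTable e eH l ((e ⟨k, R⟩ : ℕ) * q ^ (l + 1) + v) ≠ 0 ↔
      ∃ x : Fin k → H, Language.Structure.RelMap R x ∧ ∀ i : Fin k, digit q v i = eH (x i) := by
  classical
  have h1 : ((e ⟨k, R⟩ : ℕ) * q ^ (l + 1) + v) / q ^ (l + 1) = e ⟨k, R⟩ := by
    rw [mul_comm, Nat.mul_add_div (by omega), Nat.div_eq_of_lt hv, add_zero]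
  have h2 : ((e ⟨k, R⟩ : ℕ) * q ^ (l + 1) + v) % q ^ (l + 1) = v := by
    rw [mul_comm, Nat.mul_add_mod, Nat.mod_eq_of_lt hv]
  rw [relTable, ite_ne_right_iff, and_iff_left one_ne_zero, h1, h2]
  refine ⟨?_, fun ⟨x, hx⟩ => ⟨⟨k, R⟩, x, rfl, hx⟩⟩
  rintro ⟨p, x, hp, hx⟩
  obtain rfl := e.injective (Fin.ext hp)
  exact ⟨x, hx⟩

/-- A constraint is decided by the block of its symbol in the table of relations. Unused cells of
the scope may hold any variable, for instance `0`. -/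
theorem constrains_satisfies (e : (Σ l, L.Relations l) ≃ Fin r) (eH : H ≃ Fin q)
    {f : ℕ → ℕ → ℕ → ℕ} {S : (ℕ → ℕ) → Prop} (hS : IsRel n q f S) (c : Constraint L n)
    (hl : c.arity ≤ l) {Con sc : ℕ → ℕ} (hsc : ∀ i : Fin c.arity, sc i = c.scope i)
    (hsc' : ∀ x < l, sc x < n)
    (hcon : ∀ v < q ^ (l + 1),
      Con v = relTable e eH l ((e ⟨c.arity, c.symbol⟩ : ℕ) * q ^ (l + 1) + v)) :
    RAM.Code.Constrains n q l Con sc S (satisfies eH c) := by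
  refine ⟨hsc', fun t ht i hi => ?_⟩
  have hp : ∀ x < l + 1, RAM.Code.scopeVec l sc i x < n := RAM.Code.scopeVec_lt hsc' hi
  have hv := hS.projCode_lt hp ht
  rw [hcon _ hv, relTable_ne_zero_iff e eH c.symbol hv, satisfies]
  refine exists_congr fun x => and_congr_right fun _ => forall_congr' fun j => ?_
  have hj : (j : ℕ) < l := j.2.trans_le hl
  rw [projCode, digit_enc (fun x hx => hS.lt t ht _ (hp x hx)) (Nat.lt_succ_of_lt hj),
    RAM.Code.scopeVec, if_pos hj, hsc]

/-- Position of the constraint after `pre` in the encoding of an instance. -/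
theorem encode_getD (e : (Σ l, L.Relations l) ≃ Fin r) {I : CSPInstance L}
    {pre suf : List (Constraint L I.numVars)} {c : Constraint L I.numVars}
    (h : I.constraints = pre ++ c :: suf) :
    (I.encode e).getD (2 + (pre.flatMap (Constraint.encode e)).length) 0 =
      (e ⟨c.arity, c.symbol⟩ : ℕ) ∧
    ∀ i : Fin c.arity,
      (I.encode e).getD (2 + (pre.flatMap (Constraint.encode e)).length + 1 + i) 0 = c.scope i := by
  have h1 : I.encode e = (I.numVars :: I.numConstraints :: pre.flatMap (Constraint.encode e)) ++
      ((e ⟨c.arity, c.symbol⟩ : ℕ) :: (List.ofFn (fun i => (c.scope i : ℕ)) ++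
        suf.flatMap (Constraint.encode e))) := by
    simp [CSPInstance.encode, h, Constraint.encode]
  have h2 : 2 + (pre.flatMap (Constraint.encode e)).length =
    (I.numVars :: I.numConstraints :: pre.flatMap (Constraint.encode e)).length := by
    simp only [List.length_cons]; omega
  rw [h1, h2]
  refine ⟨by simp [List.getD_eq_getElem?_getD], fun i => ?_⟩
  rw [List.getD_append_right _ _ _ _ (by omega), add_assoc, Nat.add_sub_cancel_left, add_comm 1,
    List.getD_cons_succ, List.getD_append _ _ _ _ (by simp)]
  simp [List.getD_eq_getElem?_getD]

theorem length_encode (e : (Σ l, L.Relations l) ≃ Fin r) (c : Constraint L n) :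
    (c.encode e).length = 1 + c.arity := by
  simp [Constraint.encode, add_comm]

end Maltsev

namespace RAM
namespace Code

variable {n q l : ℕ} {s : State}

/-- The scope is padded with `0` beyond the arity `k` of the symbol. -/
theorem run_read {pos sym k : ℕ} (hn : s.reg 1 = n) (hpos : s.reg rP = pos)
    (hsym : s.arr 0 pos = sym) (hk : s.arr aArity sym = k) :
    (∀ x < l, ((read q l).run s).arr aScope x = if x < k then s.arr 0 (pos + 1 + x) else 0) ∧
    (∀ y < q ^ (l + 1), ((read q l).run s).arr aCon y = s.arr aRel (sym * q ^ (l + 1) + y)) ∧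
    ((read q l).run s).reg rS = sym := by
  have hr : ((read q l).run s).reg rS = sym := by
    rw [read, run_seq, run_seq, run_seq, run_reg rfl, run_reg rfl, run_reg rfl, Code.run,
      State.setReg_reg, if_pos rfl]
    simp only [Expr.eval, hpos, hsym]
  refine ⟨?_, ?_, hr⟩
  all_goals
    rw [read, run_seq, run_seq, run_seq, Code.run]
    obtain ⟨s1, hs1⟩ : ∃ x, x = s.setReg rS ((Expr.get 0 (.reg rP)).eval s) := ⟨_, rfl⟩
    obtain ⟨s2, hs2⟩ : ∃ x, x = (iter rL l 0 (.put aScope (.reg rL) (.lit 0))).run s1 := ⟨_, rfl⟩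
    have n1 : s1.reg 1 = n := by rw [hs1, State.setReg_reg, if_neg (by decide), hn]
    have p1 : s1.reg rP = pos := by rw [hs1, State.setReg_reg, if_neg (by decide), hpos]
    have y1 : s1.reg rS = sym := by
      rw [hs1, State.setReg_reg, if_pos rfl]; simp only [Expr.eval, hpos, hsym]
    have a1 : s1.arr = s.arr := by rw [hs1, State.setReg_arr]
    have n2 : s2.reg 1 = n := by rw [hs2, run_reg rfl, n1]
    have p2 : s2.reg rP = pos := by rw [hs2, run_reg rfl, p1]
    have y2 : s2.reg rS = sym := by rw [hs2, run_reg rfl, y1]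
    have z2 : s2.arr 0 = s.arr 0 := by rw [hs2, run_arr rfl, a1]
    have ar2 : s2.arr aArity = s.arr aArity := by rw [hs2, run_arr rfl, a1]
    have re2 : s2.arr aRel = s.arr aRel := by rw [hs2, run_arr rfl, a1]
    rw [← hs1, ← hs2]
  · intro x hx
    rw [run_arr rfl]
    have h0 := run_fill (x := rL) (c := l) (d := 0) (a := aScope) (e := .lit 0)
      (val := fun _ => 0) n1 fun _ _ _ _ _ _ => rfl
    rw [zero_mul, add_zero, ← hs2] at h0
    have key := iter_inv (x := rL) (c := l) (d := 0)
      (P := .ite (.lt (.reg rL) (.get aArity (.reg rS)))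
        (.put aScope (.reg rL) (.get 0 (.add (.add (.reg rP) (.lit 1)) (.reg rL)))) .skip) n2 rfl
      (fun m A => ∀ x < l, A aScope x = if x < m ∧ x < k then s.arr 0 (pos + 1 + x) else 0)
      (fun x hx => by rw [if_neg (by omega), h0 x hx]) ?_
    · rw [zero_mul, add_zero] at key
      rw [key x hx]
      simp only [hx, true_and]
    intro m hm u hum hu1 hu2 hinv
    have hc : (Expr.lt (.reg rL) (.get aArity (.reg rS))).eval u = if m < k then 1 else 0 := by
      simp only [Expr.eval, hum, hu1 rS (by decide) rfl, hu2 aArity rfl, ar2, y2, hk]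
    have hv : (Expr.get 0 (.add (.add (.reg rP) (.lit 1)) (.reg rL))).eval u =
        s.arr 0 (pos + 1 + m) := by
      simp only [Expr.eval, hum, hu1 rP (by decide) rfl, hu2 0 rfl, z2, p2]
    rw [run_ite, hc]
    by_cases hmk : m < k
    · rw [if_pos hmk, if_neg one_ne_zero, run_put, hv]
      intro x hx
      rw [State.setCell_arr]
      simp only [Expr.eval, hum, true_and]
      by_cases hxm : x = m
      · subst hxm; rw [if_pos rfl, if_pos ⟨Nat.lt_succ_self x, hmk⟩]
      · rw [if_neg hxm, hinv x hx]
        simp only [show x < m + 1 ↔ x < m by omega]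
    · rw [if_neg hmk, if_pos rfl]
      intro x hx
      change u.arr aScope x = _
      rw [hinv x hx]
      simp only [show x < m + 1 ∧ x < k ↔ x < m ∧ x < k by omega]
  · intro y hy
    obtain ⟨s3, hs3⟩ : ∃ x, x = (iter rL l 0 (.ite (.lt (.reg rL) (.get aArity (.reg rS)))
      (.put aScope (.reg rL) (.get 0 (.add (.add (.reg rP) (.lit 1)) (.reg rL)))) .skip)).run s2 :=
      ⟨_, rfl⟩
    rw [← hs3]
    have n3 : s3.reg 1 = n := by rw [hs3, run_reg rfl, n2]
    have y3 : s3.reg rS = sym := by rw [hs3, run_reg rfl, y2]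
    have re3 : s3.arr aRel = s.arr aRel := by rw [hs3, run_arr rfl, re2]
    have key := run_fill (x := rY) (c := q ^ (l + 1)) (d := 0) (a := aCon)
      (e := .get aRel (.add (.mul (.reg rS) (.lit (q ^ (l + 1)))) (.reg rY)))
      (val := fun y => s.arr aRel (sym * q ^ (l + 1) + y)) n3 (fun k hk u huk h1 h2 => by
        simp only [Expr.eval, huk, h1 rS (by decide), h2 aRel (by decide), re3, y3])
    rw [zero_mul, add_zero] at key
    exact key y hy

end Code
end RAM

namespace RAM

open Maltsev Code

/-! ### The algorithm -/

/-- Tables, the set of all tuples, and the position of the first constraint. -/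
def start (q l : ℕ) (f : ℕ → ℕ → ℕ → ℕ) (r : ℕ) (ar rel : ℕ → ℕ) : Code :=
  .seq (tables q l f r ar rel) <| .seq (full q) <| .seq (.set rM (.get 0 (.lit 1))) <|
  .seq (.set rP (.lit 2)) (.set rT (.lit 0))

/-- Read a constraint and decide whether it has to be added to the current relation. -/
def readCheck (q l : ℕ) : Code := .seq (read q l) (check q l)

/-- Treat one constraint. The current relation is only computed anew if it gets smaller. -/
def step (q l : ℕ) : Prog :=
  .seq (readCheck q l).prog <| .seq (.ite (.get aFound (.lit 0)) (update q l).prog .skip) <|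
  .seq (.assign rP (.add (.add (.reg rP) (.lit 1)) (.get aArity (.reg rS))))
    (.assign rT (.add (.reg rT) (.lit 1)))

/-- Treat all constraints. -/
def steps (q l : ℕ) : Prog := .loop (.lt (.reg rT) (.reg rM)) (step q l)

/-- The algorithm. Without variables, there is one solution, since there are no constraints. -/
def solve (q l : ℕ) (f : ℕ → ℕ → ℕ → ℕ) (r : ℕ) (ar rel : ℕ → ℕ) : Prog :=
  .seq (.assign 1 (.get 0 (.lit 0))) (.ite (.reg 1)
    (.seq (start q l f r ar rel).prog (.seq (steps q l) (finish q l).prog)) (.assign 0 (.lit 1)))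

theorem depth_start (q l : ℕ) (f : ℕ → ℕ → ℕ → ℕ) (r : ℕ) (ar rel : ℕ → ℕ) :
    (start q l f r ar rel).depth ≤ 5 := by
  simp [start, depth, full, fillRow, depth_tables]

theorem WF_start (q l : ℕ) (f : ℕ → ℕ → ℕ → ℕ) (r : ℕ) (ar rel : ℕ → ℕ) :
    (start q l f r ar rel).WF = true := by
  have : (full q).WF = true := rfl
  simp [start, WF, WF_tables, this, Expr.Tame]

variable {L : Language} {H : Type*} [L.Structure H] {q l r D B : ℕ}

/-- The situation after the constraints in `pre` have been treated. -/
structure StepInv (e : (Σ l, L.Relations l) ≃ Fin r) (eH : H ≃ Fin q) (f : ℕ → ℕ → ℕ → ℕ)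
    (l D : ℕ) (I : CSPInstance L) (pre : List (Constraint L I.numVars)) (s : State) : Prop where
  vars : s.reg 1 = I.numVars
  total : s.reg rM = I.numConstraints
  count : s.reg rT = pre.length
  pos : s.reg rP = 2 + (pre.flatMap (Constraint.encode e)).length
  tables : Tables q l f s.arr
  arity : ∀ x < r, s.arr aArity x = arityTable e x
  rel : ∀ x < r * q ^ (l + 1), s.arr aRel x = relTable e eH l x
  input : ∀ i, s.arr 0 i = (I.encode e).getD i 0
  rep : Represents I.numVars q 0 (s.arr aG) (s.arr aW) (lift eH (solutions H pre))
  le : s.AllLe D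

/-- The amortized cost of one constraint, with the cardinality of the signature as the potential: it
drops whenever the representation is computed anew. -/
theorem exec_step (e : (Σ l, L.Relations l) ≃ Fin r) (eH : H ≃ Fin q) {f : H → H → H → H}
    (hf : IsMaltsev f) (hpol : ∀ n, ∀ R ∈ modularClone L H 2 n, IsPolymorphism₃ f R)
    {I : CSPInstance L} (hn0 : 0 < I.numVars) {pre suf : List (Constraint L I.numVars)}
    {c : Constraint L I.numVars} (hI : I.constraints = pre ++ c :: suf) (hl : c.arity ≤ l)
    (hl0 : 0 < l) (hD : 1 ≤ D)
    (hD1 : (readCheck q l).lits * (I.numVars + 1) ≤ D)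
    (hD2 : (update q l).lits * (I.numVars + 1) ≤ D) (hD3 : I.numConstraints ≤ D)
    (hD4 : 2 + ((pre ++ [c]).flatMap (Constraint.encode e)).length ≤ D)
    (hB1 : (readCheck q l).size D ≤ B) (hB2 : (update q l).size D ≤ B) (hB : 4 * D ≤ B)
    {s : State} (hs : StepInv e eH (liftOp eH f) l D I pre s) :
    ∃ t s', Exec B (step q l) s t s' ∧ StepInv e eH (liftOp eH f) l D I (pre ++ [c]) s' ∧
      t + sigCard I.numVars q (lift eH (solutions H (pre ++ [c]))) * (update q l).cost I.numVars ≤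
        sigCard I.numVars q (lift eH (solutions H pre)) * (update q l).cost I.numVars +
          ((readCheck q l).cost I.numVars + 20) := by
  have hop := isOp_liftOp eH hf
  have hS := isRel_lift eH (hpol _ _ (solutions_mem_modularClone (H := H) pre))
  have hS' := isRel_lift eH (hpol _ _ (solutions_mem_modularClone (H := H) (pre ++ [c])))
  rw [lift_solutions_append] at hS' ⊢
  obtain ⟨e1, e2⟩ := encode_getD e hI
  have hsym : s.arr 0 (2 + (pre.flatMap (Constraint.encode e)).length) =
      (e ⟨c.arity, c.symbol⟩ : ℕ) := by rw [hs.input, e1]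
  have har : s.arr aArity (e ⟨c.arity, c.symbol⟩ : ℕ) = c.arity := by
    rw [hs.arity _ (Fin.is_lt _), arityTable_apply]
  obtain ⟨r1, r2, r3⟩ := run_read (q := q) (l := l) hs.vars hs.pos hsym har
  obtain ⟨⟨t1, ht1, x1⟩, b1⟩ := Code.exec (readCheck q l) s rfl hs.vars hD hD1 hB1 hs.le
  obtain ⟨s0, hs0⟩ : ∃ x, x = (read q l).run s := ⟨_, rfl⟩
  obtain ⟨s1, hs1⟩ : ∃ x, x = (check q l).run s0 := ⟨_, rfl⟩
  have h01 : (readCheck q l).run s = s1 := by rw [readCheck, run_seq, hs1, hs0]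
  rw [← hs0] at r1 r2 r3
  rw [h01] at x1 b1
  have g0 : s0.arr aG = s.arr aG := by rw [hs0, run_arr rfl]
  have w0 : s0.arr aW = s.arr aW := by rw [hs0, run_arr rfl]
  have n0 : s0.reg 1 = I.numVars := by rw [hs0, run_reg rfl, hs.vars]
  have reg1 : ∀ y, (readCheck q l).writesReg y = false → s1.reg y = s.reg y := fun y hy => by
    rw [← h01, run_reg hy]
  have arr1 : ∀ a, (readCheck q l).writesArr a = false → s1.arr a = s.arr a := fun a ha => by
    rw [← h01, run_arr ha]
  have c0 : Constrains I.numVars q l (s0.arr aCon) (s0.arr aScope) (lift eH (solutions H pre))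
      (satisfies eH c) := by
    refine constrains_satisfies e eH hS c hl (fun i => ?_) (fun x hx => ?_) fun v hv => ?_
    · rw [r1 i (i.2.trans_le hl), if_pos i.2, hs.input, e2]
    · rw [r1 x hx]
      split_ifs with h
      · rw [hs.input, e2 ⟨x, h⟩]
        exact Fin.is_lt _
      · exact hn0
    · rw [r2 v hv, hs.rel]
      calc _ < (e ⟨c.arity, c.symbol⟩ : ℕ) * q ^ (l + 1) + q ^ (l + 1) := Nat.add_lt_add_left hv _
        _ = ((e ⟨c.arity, c.symbol⟩ : ℕ) + 1) * q ^ (l + 1) := by ring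
        _ ≤ r * q ^ (l + 1) := Nat.mul_le_mul_right _ (Fin.is_lt _)
  have hrep0 := hs.rep
  rw [← g0, ← w0] at hrep0
  obtain ⟨k1, k2⟩ := run_check hop hS hS' n0 hn0 hrep0 c0
  rw [← hs1] at k1 k2
  have key : ∃ t2 s2, Exec B (.ite (.get aFound (.lit 0)) (update q l).prog .skip) s1 t2 s2 ∧
      s2.AllLe D ∧ (∀ y, (update q l).writesReg y = false → s2.reg y = s1.reg y) ∧
      (∀ a, (update q l).writesArr a = false → s2.arr a = s1.arr a) ∧
      Represents I.numVars q 0 (s2.arr aG) (s2.arr aW)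
        (fun t => lift eH (solutions H pre) t ∧ satisfies eH c t) ∧
      t2 + sigCard I.numVars q (fun t => lift eH (solutions H pre) t ∧ satisfies eH c t) *
        (update q l).cost I.numVars ≤
        sigCard I.numVars q (lift eH (solutions H pre)) * (update q l).cost I.numVars + 4 := by
    have hfit : (Expr.get aFound (.lit 0)).Fits B s1 :=
      Expr.fits b1 _ (by simp only [Expr.size]; omega)
    by_cases h : s1.arr aFound 0 = 0
    · have heq : (fun t => lift eH (solutions H pre) t ∧ satisfies eH c t) =
          lift eH (solutions H pre) :=
        funext fun t => propext (and_iff_left_of_imp (k1 h t))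
      rw [heq]
      refine ⟨_, s1, .ite_false hfit h (.skip s1), b1, fun _ _ => rfl, fun _ _ => rfl, ?_, ?_⟩
      · rw [arr1 aG rfl, arr1 aW rfl]
        exact hs.rep
      · simp only [Expr.cost]
        omega
    · obtain ⟨t, ht, htc⟩ := k2 h
      have n1 : s1.reg 1 = I.numVars := by rw [reg1 1 rfl, hs.vars]
      obtain ⟨⟨t2, ht2, x2⟩, b2⟩ := Code.exec (update q l) s1 rfl n1 hD hD2 hB2 b1
      refine ⟨_, _, .ite_true hfit h x2, b2, fun y hy => run_reg hy s1, fun a ha => run_arr ha s1,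
        ?_, ?_⟩
      · refine run_update hop hS hS' hl0 n1 (hs.tables.of_keeps (readCheck q l) rfl arr1) ?_ ?_
        · rw [arr1 aG rfl, arr1 aW rfl]
          exact hs.rep
        · rw [hs1, run_arr (b := aCon) rfl, run_arr (b := aScope) rfl]
          exact c0
      · have hlt := hS.sigCard_lt hop hS' hn0 (fun t ht => ht.1) ht fun h => htc h.2
        have := Nat.mul_le_mul_right ((update q l).cost I.numVars) (Nat.succ_le_of_lt hlt)
        rw [Nat.succ_mul] at this
        simp only [Expr.cost]
        omega
  obtain ⟨t2, s2, x2, b2, reg2, arr2, rep2, ht2⟩ := key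
  have f0 : ∀ i, s2.arr 0 i = (I.encode e).getD i 0 := by
    rw [arr2 0 rfl, arr1 0 rfl]; exact hs.input
  have f1 : ∀ x < r, s2.arr aArity x = arityTable e x := by
    rw [arr2 aArity rfl, arr1 aArity rfl]; exact hs.arity
  have f2 : ∀ x < r * q ^ (l + 1), s2.arr aRel x = relTable e eH l x := by
    rw [arr2 aRel rfl, arr1 aRel rfl]; exact hs.rel
  have hsum : ((pre ++ [c]).flatMap (Constraint.encode e)).length =
      (pre.flatMap (Constraint.encode e)).length + (1 + c.arity) := by
    simp [length_encode]
  have hP : (Expr.add (.add (.reg rP) (.lit 1)) (.get aArity (.reg rS))).eval s2 =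
      2 + ((pre ++ [c]).flatMap (Constraint.encode e)).length := by
    have hrS : s2.reg rS = (e ⟨c.arity, c.symbol⟩ : ℕ) := by
      rw [reg2 rS rfl, hs1, run_reg rfl, r3]
    simp only [Expr.eval]
    rw [reg2 rP rfl, reg1 rP rfl, hs.pos, hrS, f1 _ (Fin.is_lt _), arityTable_apply, hsum]
    dsimp only
    omega
  have b3 := b2.setReg (x := rP) (hP.le.trans hD4)
  have hT : (Expr.add (.reg rT) (.lit 1)).eval (s2.setReg rP
      ((Expr.add (.add (.reg rP) (.lit 1)) (.get aArity (.reg rS))).eval s2)) =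
      (pre ++ [c]).length := by
    simp only [Expr.eval, State.setReg_reg, if_neg (show rT ≠ rP by decide)]
    rw [reg2 rT rfl, reg1 rT rfl, hs.count, List.length_append, List.length_singleton]
  have hlen : (pre ++ [c]).length ≤ D := by
    have : I.constraints.length ≤ D := hD3
    rw [hI] at this
    simp only [List.length_append, List.length_cons, List.length_nil] at this ⊢
    omega
  refine ⟨_, _, .seq x1 (.seq x2 (.seq (.assign rP _ s2 ?_) (.assign rT _ (s2.setReg rP _) ?_))),
    ⟨?_, ?_, ?_, ?_, ?_, ?_, ?_, ?_, ?_, b3.setReg (x := rT) (hT.le.trans hlen)⟩, ?_⟩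
  · exact Expr.fits b2 _ (by simp only [Expr.size]; omega)
  · exact Expr.fits b3 _ (by simp only [Expr.size]; omega)
  · change s2.reg 1 = _
    rw [reg2 1 rfl, reg1 1 rfl, hs.vars]
  · change s2.reg rM = _
    rw [reg2 rM rfl, reg1 rM rfl, hs.total]
  · exact hT
  · exact hP
  · exact (hs.tables.of_keeps (readCheck q l) rfl arr1).of_keeps (update q l) rfl arr2
  · exact f1
  · exact f2
  · exact f0
  · rw [lift_solutions_append]
    exact rep2
  · simp only [Expr.cost]
    omega

theorem exec_steps (e : (Σ l, L.Relations l) ≃ Fin r) (eH : H ≃ Fin q) {f : H → H → H → H}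
    (hf : IsMaltsev f) (hpol : ∀ n, ∀ R ∈ modularClone L H 2 n, IsPolymorphism₃ f R)
    {I : CSPInstance L} (hn0 : 0 < I.numVars) (hl : ∀ c ∈ I.constraints, c.arity ≤ l)
    (hl0 : 0 < l) (hD : 1 ≤ D)
    (hD1 : (readCheck q l).lits * (I.numVars + 1) ≤ D)
    (hD2 : (update q l).lits * (I.numVars + 1) ≤ D) (hD3 : I.numConstraints ≤ D)
    (hD4 : 2 + (I.constraints.flatMap (Constraint.encode e)).length ≤ D)
    (hB1 : (readCheck q l).size D ≤ B) (hB2 : (update q l).size D ≤ B) (hB : 4 * D ≤ B)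
    {pre suf : List (Constraint L I.numVars)} (hI : I.constraints = pre ++ suf)
    {s : State} (hs : StepInv e eH (liftOp eH f) l D I pre s) :
    ∃ t s', Exec B (steps q l) s t s' ∧ StepInv e eH (liftOp eH f) l D I I.constraints s' ∧
      t ≤ sigCard I.numVars q (lift eH (solutions H pre)) * (update q l).cost I.numVars +
        suf.length * ((readCheck q l).cost I.numVars + 24) + 4 := by
  have hfit : ∀ {u : State}, u.AllLe D → (Expr.lt (.reg rT) (.reg rM)).Fits B u := fun hu =>
    Expr.fits hu _ (by simp only [Expr.size]; omega)
  induction suf generalizing pre s with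
  | nil =>
    rw [List.append_nil] at hI
    refine ⟨_, s, .loop_done (hfit hs.le) ?_, hI ▸ hs, ?_⟩
    · simp only [Expr.eval, hs.count, hs.total, CSPInstance.numConstraints, hI, lt_irrefl, if_false]
    · simp only [Expr.cost]
      omega
  | cons c suf ih =>
    have hI' : I.constraints = (pre ++ [c]) ++ suf := by rw [hI, List.append_assoc]; rfl
    obtain ⟨t1, s1, x1, i1, ht1⟩ := exec_step e eH hf hpol hn0 hI (hl c (by simp [hI])) hl0 hD hD1
      hD2 hD3 (le_trans (by rw [hI', List.flatMap_append (xs := pre ++ [c]), List.length_append]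
                            omega) hD4) hB1 hB2 hB hs
    obtain ⟨t2, s2, x2, i2, ht2⟩ := ih hI' i1
    refine ⟨_, s2, .loop_step (hfit hs.le) ?_ x1 x2, i2, ?_⟩
    · have : pre.length < I.numConstraints := by
        rw [CSPInstance.numConstraints, hI]; simp
      simp only [Expr.eval, hs.count, hs.total, this, if_true]
      exact one_ne_zero
    · simp only [Expr.cost, List.length_cons, Nat.succ_mul]
      omega

theorem length_flatMap_encode_le (e : (Σ l, L.Relations l) ≃ Fin r) {n : ℕ}
    {cs : List (Constraint L n)} (h : ∀ c ∈ cs, c.arity ≤ l) :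
    (cs.flatMap (Constraint.encode e)).length ≤ cs.length * (1 + l) := by
  induction cs with
  | nil => simp
  | cons c cs ih =>
    have h1 := h c List.mem_cons_self
    have h2 := ih fun d hd => h d (List.mem_cons_of_mem _ hd)
    rw [List.flatMap_cons, List.length_append, length_encode, List.length_cons, Nat.succ_mul]
    omega

theorem getD_encode_le (e : (Σ l, L.Relations l) ≃ Fin r) (I : CSPInstance L) (i : ℕ) :
    (I.encode e).getD i 0 ≤ r + I.numVars + I.numConstraints := by
  have h : ∀ x ∈ I.encode e, x ≤ r + I.numVars + I.numConstraints := by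
    intro x hx
    simp only [CSPInstance.encode, List.mem_cons, List.mem_flatMap, Constraint.encode,
      List.mem_ofFn] at hx
    rcases hx with rfl | rfl | ⟨c, -, rfl | ⟨j, rfl⟩⟩
    · omega
    · omega
    · have := (e ⟨c.arity, c.symbol⟩).2
      omega
    · have := (c.scope j).2
      omega
  rw [List.getD_eq_getElem?_getD]
  cases hg : (I.encode e)[i]? with
  | none => exact Nat.zero_le _
  | some x => exact h x (List.mem_of_getElem? hg)

theorem stepInv_start (e : (Σ l, L.Relations l) ≃ Fin r) (eH : H ≃ Fin q) (f : ℕ → ℕ → ℕ → ℕ)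
    {I : CSPInstance L} {s : State} (hn : s.reg 1 = I.numVars)
    (hin : ∀ i, s.arr 0 i = (I.encode e).getD i 0)
    (hle : ((start q l f r (arityTable e) (relTable e eH l)).run s).AllLe D) :
    StepInv e eH f l D I [] ((start q l f r (arityTable e) (relTable e eH l)).run s) := by
  revert hle
  rw [start, run_seq, run_seq, run_seq, run_seq, Code.run, Code.run, Code.run]
  obtain ⟨h1, h2, h3⟩ := run_tables q l f r (arityTable e) (relTable e eH l) s
  obtain ⟨s1, hs1⟩ : ∃ x, x = (tables q l f r (arityTable e) (relTable e eH l)).run s := ⟨_, rfl⟩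
  rw [← hs1] at h1 h2 h3 ⊢
  have n1 : s1.reg 1 = I.numVars := by rw [hs1, run_reg (writesReg_tables ..), hn]
  have in1 : s1.arr 0 = s.arr 0 := by rw [hs1, run_arr (writesArr_tables_zero ..)]
  have rep := run_full (q := q) n1
  rw [← lift_solutions_nil (L := L) eH] at rep
  obtain ⟨s2, hs2⟩ : ∃ x, x = (full q).run s1 := ⟨_, rfl⟩
  rw [← hs2] at rep ⊢
  have in2 : ∀ i, s2.arr 0 i = (I.encode e).getD i 0 := by rw [hs2, run_arr rfl, in1]; exact hin
  intro hle
  refine ⟨?_, ?_, ?_, ?_, ?_, ?_, ?_, ?_, ?_, hle⟩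
  · change s2.reg 1 = _
    rw [hs2, run_reg rfl, n1]
  · change s2.arr 0 1 = _
    rw [in2]
    rfl
  · rfl
  · rfl
  · exact h1.of_keeps (full q) rfl fun a ha => by
      change s2.arr a = _
      rw [hs2, run_arr ha]
  · change ∀ x < r, s2.arr aArity x = _
    rw [hs2, run_arr rfl]
    exact h2
  · change ∀ x < r * q ^ (l + 1), s2.arr aRel x = _
    rw [hs2, run_arr rfl]
    exact h3
  · exact in2
  · exact rep

end RAM

namespace RAM

open Maltsev Code

variable {L : Language} {H : Type*} [L.Structure H] {q r : ℕ}

/-- The run of the algorithm on an instance with variables, in terms of a bound `D` for registers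
and cells and a bound `B` for all values. -/
theorem exec_solve [Finite H] (e : (Σ l, L.Relations l) ≃ Fin r) (eH : H ≃ Fin q)
    {f : H → H → H → H} (hf : IsMaltsev f)
    (hpol : ∀ n, ∀ R ∈ modularClone L H 2 n, IsPolymorphism₃ f R) {l : ℕ} (hl0 : 0 < l)
    {I : CSPInstance L} (hl : ∀ c ∈ I.constraints, c.arity ≤ l) (hn0 : 0 < I.numVars) {D B : ℕ}
    {P₁ : Code} (hP₁ : P₁ = start q l (liftOp eH f) r (arityTable e) (relTable e eH l))
    (hD : (P₁.lits + (readCheck q l).lits + (update q l).lits + (finish q l).lits) *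
      (I.numVars + 1) ≤ D)
    (hD3 : r + I.numVars + I.numConstraints ≤ D) (hD4 : 2 + I.numConstraints * (1 + l) ≤ D)
    (hB : P₁.size D + (readCheck q l).size D + (update q l).size D + (finish q l).size D + 4 * D ≤
      B) :
    ∃ t s, Exec B (solve q l (liftOp eH f) r (arityTable e) (relTable e eH l))
        (State.init (I.encode e)) t s ∧
      t ≤ P₁.cost I.numVars + q * q * I.numVars * (update q l).cost I.numVars +
        I.numConstraints * ((readCheck q l).cost I.numVars + 24) + (finish q l).cost I.numVars +
        20 ∧
      s.reg 0 = I.numSolutions H % 2 := by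
  simp only [add_mul] at hD
  have b0 : (State.init (I.encode e)).AllLe D := by
    refine ⟨fun x => Nat.zero_le _, fun a i => ?_⟩
    simp only [State.init]
    split_ifs
    · exact (getD_encode_le e I i).trans hD3
    · exact Nat.zero_le _
  have hin : (Expr.get 0 (.lit 0)).eval (State.init (I.encode e)) = I.numVars := rfl
  have b1 := b0.setReg (x := 1) (hin.le.trans (by omega))
  obtain ⟨s1, hs1⟩ : ∃ x, x = (State.init (I.encode e)).setReg 1
    ((Expr.get 0 (.lit 0)).eval (State.init (I.encode e))) := ⟨_, rfl⟩
  rw [← hs1] at b1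
  have n1 : s1.reg 1 = I.numVars := by rw [hs1, State.setReg_reg, if_pos rfl, hin]
  have i1 : ∀ i, s1.arr 0 i = (I.encode e).getD i 0 := fun i => by rw [hs1]; rfl
  obtain ⟨⟨t2, ht2, x2⟩, b2⟩ := Code.exec P₁ s1 (hP₁ ▸ WF_start ..) n1 (by omega) (by omega)
    (show P₁.size D ≤ B by omega) b1
  subst hP₁
  have inv := stepInv_start e eH (liftOp eH f) n1 i1 b2
  obtain ⟨t3, s3, x3, inv3, ht3⟩ := exec_steps e eH hf hpol hn0 hl hl0 (by omega) (by omega)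
    (by omega) (by omega)
    (le_trans (Nat.add_le_add_left (length_flatMap_encode_le e hl) 2) hD4)
    (show (readCheck q l).size D ≤ B by omega) (by omega) (by omega)
    (pre := []) (List.nil_append _).symm inv
  obtain ⟨⟨t4, ht4, x4⟩, -⟩ := Code.exec (finish q l) s3 rfl inv3.vars (by omega) (by omega)
    (show (finish q l).size D ≤ B by omega) inv3.le
  have hR := solutions_mem_modularClone (H := H) I.constraints
  obtain ⟨hel, hodd⟩ := eliminated_lift eH hf hpol hR
  obtain ⟨h1, h0⟩ := run_finish (isOp_liftOp eH hf) hl0 inv3.vars hn0 inv3.tables hel inv3.rep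
  have x1 : Exec B (.assign 1 (.get 0 (.lit 0))) (State.init (I.encode e)) 3 s1 := by
    rw [hs1]
    exact .assign 1 _ _ (Expr.fits b0 _ (by simp only [Expr.size]; omega))
  have hne : (Expr.reg 1).eval s1 ≠ 0 := by
    change s1.reg 1 ≠ 0
    omega
  refine ⟨_, _, .seq x1 (.ite_true (Expr.fits b1 _ (by simp only [Expr.size]; omega)) hne
    (.seq x2 (.seq x3 x4))), ?_, ?_⟩
  · simp only [Expr.cost]
    have := Nat.mul_le_mul_right ((update q l).cost I.numVars)
      (sigCard_le (n := I.numVars) (q := q)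
        (S := lift eH (solutions H ([] : List (Constraint L I.numVars)))))
    have h5 : I.constraints.length = I.numConstraints := rfl
    rw [h5] at ht3
    omega
  · have hcard : I.numSolutions H = Nat.card (solutions H I.constraints) := rfl
    rw [hcard]
    by_cases h : Odd (Nat.card (solutions H I.constraints))
    · rw [h1 (hodd.2 h), Nat.odd_iff.1 h]
    · rw [h0 (mt hodd.1 h), Nat.not_odd_iff.1 h]

/-- The run of the algorithm on an instance without variables. -/
theorem exec_solve_of_numVars_eq_zero [IsEmpty (L.Relations 0)]
    (e : (Σ l, L.Relations l) ≃ Fin r) {I : CSPInstance L} (hn : I.numVars = 0) {q l B : ℕ}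
    {f : ℕ → ℕ → ℕ → ℕ} {ar rel : ℕ → ℕ} (hB : 1 ≤ B) :
    ∃ t s, Exec B (solve q l f r ar rel) (State.init (I.encode e)) t s ∧ t ≤ 20 ∧
      s.reg 0 = I.numSolutions H % 2 := by
  have hin : (State.init (I.encode e)).arr 0 0 = 0 := hn
  have hE : (Expr.get 0 (.lit 0)).eval (State.init (I.encode e)) = 0 := hin
  refine ⟨_, _, .seq (.assign 1 _ _ ⟨Nat.zero_le _, hE.le.trans (Nat.zero_le _)⟩)
    (.ite_false (s := (State.init (I.encode e)).setReg 1
      ((Expr.get 0 (.lit 0)).eval (State.init (I.encode e)))) ?_ ?_ (.assign 0 _ _ hB)), ?_, ?_⟩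
  · simp only [Expr.Fits, hE]
    simp
  · simp only [Expr.eval, hin]
    simp
  · simp only [Expr.cost]
    omega
  · have h1 : I.numSolutions H = 1 := by
      obtain ⟨n, cs⟩ := I
      obtain rfl : n = 0 := hn
      have hc : ∀ c ∈ cs, False := by
        rintro ⟨k, R, sc⟩ -
        cases k with
        | zero => exact isEmptyElim R
        | succ k => exact (sc 0).elim0
      have : Unique {φ : Fin 0 → H // ∀ c ∈ cs,
          Language.Structure.RelMap c.symbol fun i => φ (c.scope i)} :=
        ⟨⟨⟨Fin.elim0, fun c h => (hc c h).elim⟩⟩, fun _ => Subsingleton.elim _ _⟩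
      exact Nat.card_unique
    rw [h1]
    rfl

end RAM

open RAM Maltsev RAM.Code

theorem mainTheorem2 (L : FirstOrder.Language) [L.IsRelational] [IsEmpty (L.Relations 0)]
    {r : ℕ} (e : (Σ l, L.Relations l) ≃ Fin r) (H : Type*) [Finite H] [L.Structure H]
    (hrigid : IsRigidMod L H 2) (hrect : IsStronglyRectangularMod L H 2)
    (hmal : ModularCloneHasMaltsev L H 2) :
    ∃ (P : RAM.Prog) (C : ℕ), ∀ I : CSPInstance L, ∃ (t : ℕ) (s : RAM.State),
      RAM.Exec (C * (1 + I.numVars + I.numConstraints) ^ C) P (RAM.State.init (I.encode e)) t s ∧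
      t ≤ C * (1 + I.numVars ^ 5 + I.numVars * I.numConstraints) ∧
      s.reg 0 = I.numSolutions H % 2 := by
  obtain ⟨f, hf, hpol⟩ := hmal
  obtain ⟨q, ⟨eH⟩⟩ := Finite.exists_equiv_fin H
  obtain ⟨l, hlb⟩ : ∃ l, l = arityBound e := ⟨_, rfl⟩
  have hl0 : 0 < l := hlb ▸ Nat.succ_pos _
  obtain ⟨P₁, hP₁⟩ : ∃ P, P = start q l (liftOp eH f) r (arityTable e) (relTable e eH l) :=
    ⟨_, rfl⟩
  have hd₁ : P₁.depth ≤ 5 := hP₁ ▸ depth_start ..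
  obtain ⟨C₁, hC₁⟩ := P₁.exists_cost_le
  obtain ⟨C₂, hC₂⟩ := (readCheck q l).exists_cost_le
  obtain ⟨C₃, hC₃⟩ := (update q l).exists_cost_le
  obtain ⟨C₄, hC₄⟩ := (finish q l).exists_cost_le
  -- registers and cells hold numbers up to `K * (1 + n + m)`
  obtain ⟨K, hK⟩ : ∃ K, K = P₁.lits + (readCheck q l).lits + (update q l).lits +
    (finish q l).lits + r + l + 3 := ⟨_, rfl⟩
  obtain ⟨C₅, hC₅⟩ := ((((P₁.polyBounded_size K).add ((readCheck q l).polyBounded_size K)).add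
    ((update q l).polyBounded_size K)).add ((finish q l).polyBounded_size K)).add
    ((PolyBounded.const 4).mul (.linear K))
  obtain ⟨C, hC⟩ : ∃ C, C = C₅ + 32 * C₁ + q * q * (16 * C₃) + (2 * C₂ + 24) + 32 * C₄ + 20 :=
    ⟨_, rfl⟩
  refine ⟨solve q l (liftOp eH f) r (arityTable e) (relTable e eH l), C, fun I => ?_⟩
  obtain ⟨n, hn⟩ : ∃ n, n = I.numVars := ⟨_, rfl⟩
  obtain ⟨m, hm⟩ : ∃ m, m = I.numConstraints := ⟨_, rfl⟩
  rw [← hn, ← hm]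
  rcases Nat.eq_zero_or_pos n with h0 | h0
  · obtain ⟨t, s, hx, ht, hs⟩ := exec_solve_of_numVars_eq_zero (H := H) e (hn.symm.trans h0)
      (q := q) (l := l) (f := liftOp eH f) (ar := arityTable e) (rel := relTable e eH l)
      (B := C * (1 + n + m) ^ C) (Nat.mul_pos (by omega) (Nat.pow_pos (by omega)))
    refine ⟨t, s, hx, ht.trans ?_, hs⟩
    calc 20 ≤ C * 1 := by omega
      _ ≤ _ := Nat.mul_le_mul_left _ (by omega)
  have hM : n + 1 ≤ 1 + n + m := by omega
  obtain ⟨t, s, hx, ht, hs⟩ := exec_solve e eH hf hpol hl0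
    (fun c _ => hlb ▸ arity_le_arityBound e c) (hn ▸ h0) hP₁ (D := K * (1 + n + m))
    (B := C * (1 + n + m) ^ C)
    (by
      rw [← hn]
      exact Nat.mul_le_mul (by omega) hM)
    (by
      rw [← hn, ← hm, hK]
      nlinarith [Nat.zero_le (r * (n + m)), Nat.zero_le ((P₁.lits + (readCheck q l).lits +
        (update q l).lits + (finish q l).lits + l) * (1 + n + m))])
    (by
      rw [← hm, hK]
      nlinarith [Nat.zero_le ((P₁.lits + (readCheck q l).lits +
        (update q l).lits + (finish q l).lits + r) * (1 + n + m)), Nat.zero_le (l * (1 + n))])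
    ((hC₅ (1 + n + m) (by omega)).trans (Nat.mul_le_mul (by omega)
      (Nat.pow_le_pow_right (by omega) (by omega))))
  refine ⟨t, s, hx, ht.trans ?_, hs⟩
  rw [← hn, ← hm]
  -- here `n` is positive, so that `n + 1 ≤ 2 * n`
  have hpow : ∀ {d k : ℕ}, d ≤ k → (n + 1) ^ d ≤ 2 ^ k * n ^ k := fun {d k} hdk => by
    rw [← mul_pow]
    exact (Nat.pow_le_pow_right (by omega) hdk).trans (Nat.pow_le_pow_left (by omega) k)
  have k₁ := (hC₁ n).trans (Nat.mul_le_mul_left C₁ (hpow hd₁))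
  have k₂ := (hC₂ n).trans (Nat.mul_le_mul_left C₂ (hpow (depth_check_read q l)))
  have k₃ := (hC₃ n).trans (Nat.mul_le_mul_left C₃ (hpow (depth_update q l)))
  have k₄ := (hC₄ n).trans (Nat.mul_le_mul_left C₄ (hpow (depth_finish q l)))
  calc P₁.cost n + q * q * n * (update q l).cost n + m * ((readCheck q l).cost n + 24) +
        (finish q l).cost n + 20
      ≤ C₁ * (2 ^ 5 * n ^ 5) + q * q * n * (C₃ * (2 ^ 4 * n ^ 4)) +
        m * (C₂ * (2 ^ 1 * n ^ 1) + 24 * n) + C₄ * (2 ^ 5 * n ^ 5) + 20 := by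
        gcongr
        omega
    _ = (32 * C₁ + q * q * (16 * C₃) + 32 * C₄) * n ^ 5 + (2 * C₂ + 24) * (n * m) + 20 * 1 := by
        ring
    _ ≤ C * n ^ 5 + C * (n * m) + C * 1 := by
        gcongr <;> omega
    _ = C * (1 + n ^ 5 + n * m) := by ring
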